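/- Let $b,R,c_V,\mu,\kappa>0$ and $\lambda\in\mathbb R$ with $\mu+\tfrac32\lambda\ge0$, and let $\Omega=\{x\in\mathbb R^3:|x|\le b\}$. Consider the compressible Navier–Stokes–Fourier system $$\rho_t+\nabla\cdot(\rho U)=0,\qquad (\rho U)_t+\nabla\cdot(\rho U\otimes U)+\nabla(R\rho\theta)=\mu\Delta U+(\mu+\lambda)\nabla(\nabla\cdot U),$$ $$c_V\big((\rho\theta)_t+\nabla\cdot(\rho\theta U)\big)+R\rho\theta\,\nabla\cdot U=\kappa\Delta\theta+2\mu|\mathcal D(U)|^2+\lambda(\nabla\cdot U)^2,\qquad \mathcal D(U)=\tfrac12(\nabla U+\nabla U^t),$$ in $\Omega$ with $U=0$ and $\partial\theta/\partial n=0$ on $\partial\Omega$. The spherically symmetric initial data are $\rho_0(|x|)$, $u_0(|x|)\frac{x}{|x|}$, $\theta_0(|x|)$ with $\rho_0\ge\underline\rho>0$, $\theta_0>0$ on $[0,b]$ and $\int_0^b\rho_0r^2\,dr=1$. For $0<T^*<\infty$, a classical spherically symmetric solution on $[0,T^*)$ is a solution of the form $\rho(t,|x|)$, $U=u(t,|x|)\frac{x}{|x|}$,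 $\theta(t,|x|)$ that attains the initial data, is continuous on $[0,T^*)\times\Omega$, and on $(0,T^*)\times\Omega$ (up to $\partial\Omega$) is $C^1$ in $(t,x)$, with $U,\theta$ moreover twice continuously differentiable in $x$. Let $h=\int_0^r\rho(t,s)s^2\,ds\in[0,1]$ be the Lagrangian mass coordinate and $r(t,h)$ its inverse; write $f(t,h)=f(t,r(t,h))$ for $f=\rho,u,\theta$, and $B_h^c=\{x\in\Omega:|x|>r(\tau,h)\}$ at time $\tau$. 1. There is $C>0$ depending only on the parameters and the initial data such that for every such $T^*$ and every classical spherically symmetric solution on $[0,T^*)$, $$C^{-1}\le\int_0^1\theta(t,h)\,dh\le C\qquad(0\le t<T^*),$$ the integrand being integrable. 2. Let $(\rho,U,\theta)$ be a classical spherically symmetric solution on $[0,T^*)$ and suppose that for some $\varepsilon,r_1>0$ and $M$, $$\rho+\frac1\rho+|U|\le M\qquad\text{for } t\in(T^*-\varepsilon,T^*),\ t\ge 0,\ |x|\le r_1.$$ Then for every $h_0\in(0,1]$ there is $C(h_0)>0$ such that for all $t\in[0,T^*)$ $$C(h_0)^{-1}\le\rho(t,h)\le C(h_0)\quad(h_0\le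 h\le1),\qquad \int_0^t\max_{h\in[h_0,1]}u^2(\tau,h)\,d\tau\le C(h_0),$$ $$\rho(t,h)+\|U\|_{L^2(0,t;L^\infty(B_h^c))}\le C(h_0)\quad(h_0\le h\le1).$$ 3. If the bound $\rho+\frac1\rho+|U|\le M$ for $|x|\le r_1$ holds for all $t\in[0,T^*)$, then $C(h_0)$ in 2 can be chosen depending only on the parameters, the initial data, $T^*$, $r_1$, $M$ and $h_0$, uniformly over all such solutions. -/

import Mathlib

open Set MeasureTheory
open scoped ENNReal

namespace NSF

/-- Physical space `ℝ³` with the Euclidean norm. -/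
abbrev E3 := EuclideanSpace ℝ (Fin 3)

/-- Radius of the ball, gas constant, heat capacity, viscosities and heat conductivity. -/
structure Params where
  b : ℝ
  R : ℝ
  cV : ℝ
  mu : ℝ
  lam : ℝ
  kappa : ℝ
  b_pos : 0 < b
  R_pos : 0 < R
  cV_pos : 0 < cV
  mu_pos : 0 < mu
  kappa_pos : 0 < kappa
  visc_nonneg : 0 ≤ mu + 3 / 2 * lam

/-- The closed ball `|x| ≤ b`. -/
def Params.dom (P : Params) : Set E3 := Metric.closedBall 0 P.b

/-- The spherically symmetric scalar field `x ↦ f(|x|)`. -/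
noncomputable def radialScalar (f : ℝ → ℝ) (x : E3) : ℝ := f ‖x‖

/-- The spherically symmetric vector field `x ↦ f(|x|) x / |x|`, with value `0` at the origin. -/
noncomputable def radialVector (f : ℝ → ℝ) (x : E3) : E3 := (f ‖x‖ / ‖x‖) • x

/-- The `i`-th partial derivative relative to `Ω` (one-sided at the boundary of `Ω`; the ordinary
partial derivative at interior points). -/
noncomputable def pd (Ω : Set E3) (i : Fin 3) (f : E3 → ℝ) (x : E3) : ℝ :=
  fderivWithin ℝ f Ω x (EuclideanSpace.single i 1)

/-- The time derivative. -/
noncomputable def dt (f : ℝ → E3 → ℝ) (t : ℝ) (x : E3) : ℝ := deriv (fun s => f s x) t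

/-- Continuous on `[0,T) × Ω`, and once continuously differentiable in time and space
on `(0,T) × Ω`, up to the boundary of `Ω`. -/
structure IsC1 (T : ℝ) (Ω : Set E3) (f : ℝ → E3 → ℝ) : Prop where
  cont : ContinuousOn (fun p : ℝ × E3 => f p.1 p.2) (Ico 0 T ×ˢ Ω)
  diff_time : ∀ t ∈ Ioo 0 T, ∀ x ∈ Ω, DifferentiableAt ℝ (fun s => f s x) t
  cont_time : ContinuousOn (fun p : ℝ × E3 => dt f p.1 p.2) (Ioo 0 T ×ˢ Ω)
  diff_space : ∀ t ∈ Ioo 0 T, ContDiffOn ℝ 1 (f t) Ω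
  cont_space : ∀ i, ContinuousOn (fun p : ℝ × E3 => pd Ω i (f p.1) p.2) (Ioo 0 T ×ˢ Ω)

/-- As `IsC1`, and moreover twice continuously differentiable in space on `(0,T) × Ω`. -/
structure IsC12 (T : ℝ) (Ω : Set E3) (f : ℝ → E3 → ℝ) : Prop extends IsC1 T Ω f where
  diff_space_two : ∀ t ∈ Ioo 0 T, ContDiffOn ℝ 2 (f t) Ω
  cont_space_two : ∀ i j, ContinuousOn
    (fun p : ℝ × E3 => pd Ω i (pd Ω j (f p.1)) p.2) (Ioo 0 T ×ˢ Ω)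

/-- Divergence of a vector field. -/
noncomputable def divg (Ω : Set E3) (V : E3 → E3) (x : E3) : ℝ :=
  ∑ j, pd Ω j (fun y => V y j) x

/-- Laplacian of a scalar field. -/
noncomputable def lapl (Ω : Set E3) (f : E3 → ℝ) (x : E3) : ℝ :=
  ∑ j, pd Ω j (pd Ω j f) x

/-- Entries of the symmetric gradient `(∇V + ∇Vᵗ) / 2`. -/
noncomputable def symGrad (Ω : Set E3) (V : E3 → E3) (i j : Fin 3) (x : E3) : ℝ :=
  (pd Ω j (fun y => V y i) x + pd Ω i (fun y => V y j) x) / 2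

/-- Viscous dissipation `Ψ[∇V] = 2 μ |D(V)|² + λ (div V)²`. -/
noncomputable def dissipation (P : Params) (V : E3 → E3) (x : E3) : ℝ :=
  2 * P.mu * ∑ i, ∑ j, symGrad P.dom V i j x ^ 2 + P.lam * divg P.dom V x ^ 2

/-- Classical solutions `(ρ, U, θ)` on `[0,T) × {|x| ≤ b}` of the compressible
Navier-Stokes-Fourier system with pressure `R ρ θ`, no slip and no heat flux at `|x| = b`. -/
structure IsClassicalSolution (P : Params) (T : ℝ)
    (ρ : ℝ → E3 → ℝ) (U : ℝ → E3 → E3) (θ : ℝ → E3 → ℝ) : Prop where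
  reg_density : IsC1 T P.dom ρ
  reg_velocity : ∀ i, IsC12 T P.dom (fun t x => U t x i)
  reg_temperature : IsC12 T P.dom θ
  mass_eq : ∀ t ∈ Ioo 0 T, ∀ x ∈ Metric.ball (0 : E3) P.b,
    dt ρ t x + divg P.dom (fun y => ρ t y • U t y) x = 0
  momentum_eq : ∀ t ∈ Ioo 0 T, ∀ x ∈ Metric.ball (0 : E3) P.b, ∀ i,
    dt (fun s y => ρ s y * U s y i) t x
        + divg P.dom (fun y => (ρ t y * U t y i) • U t y) x
        + pd P.dom i (fun y => P.R * ρ t y * θ t y) x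
      = P.mu * lapl P.dom (fun y => U t y i) x
        + (P.mu + P.lam) * pd P.dom i (divg P.dom (U t)) x
  energy_eq : ∀ t ∈ Ioo 0 T, ∀ x ∈ Metric.ball (0 : E3) P.b,
    P.cV * (dt (fun s y => ρ s y * θ s y) t x
        + divg P.dom (fun y => (ρ t y * θ t y) • U t y) x)
        + P.R * ρ t x * θ t x * divg P.dom (U t) x
      = P.kappa * lapl P.dom (θ t) x + dissipation P (U t) x
  no_slip : ∀ t ∈ Ioo 0 T, ∀ x ∈ Metric.sphere (0 : E3) P.b, U t x = 0
  no_flux : ∀ t ∈ Ioo 0 T, ∀ x ∈ Metric.sphere (0 : E3) P.b,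
    fderivWithin ℝ (θ t) P.dom x (‖x‖⁻¹ • x) = 0

/-- Radial initial profiles with density bounded below by a positive constant, positive temperature
and normalized mass. -/
structure IsInitialData (P : Params) (ρ₀ θ₀ : ℝ → ℝ) : Prop where
  density_pos : ∃ c > 0, ∀ r ∈ Icc 0 P.b, c ≤ ρ₀ r
  temperature_pos : ∀ r ∈ Icc 0 P.b, 0 < θ₀ r
  mass_one : ∫ r in (0 : ℝ)..P.b, ρ₀ r * r ^ 2 = 1

/-- The radial profiles `(ρ, u, θ)` give a classical spherically symmetric solution
on `[0,T)` with initial profiles `(ρ₀, u₀, θ₀)`. -/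
structure IsSphericalSolution (P : Params) (T : ℝ) (ρ₀ u₀ θ₀ : ℝ → ℝ)
    (ρ u θ : ℝ → ℝ → ℝ) : Prop where
  solution : IsClassicalSolution P T (fun t => radialScalar (ρ t))
    (fun t => radialVector (u t)) (fun t => radialScalar (θ t))
  init_density : ∀ x ∈ P.dom, radialScalar (ρ 0) x = radialScalar ρ₀ x
  init_velocity : ∀ x ∈ P.dom, radialVector (u 0) x = radialVector u₀ x
  init_temperature : ∀ x ∈ P.dom, radialScalar (θ 0) x = radialScalar θ₀ x

/-- `ρ + 1/ρ + |U| ≤ M` at time `t` for `|x| ≤ r₁` inside the ball. -/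
def CenterBound (P : Params) (r₁ M : ℝ) (ρ u : ℝ → ℝ → ℝ) (t : ℝ) : Prop :=
  ∀ x ∈ P.dom, ‖x‖ ≤ r₁ →
    radialScalar (ρ t) x + (radialScalar (ρ t) x)⁻¹ + ‖radialVector (u t) x‖ ≤ M

/-- The Lagrangian mass coordinate `h = ∫_0^r ρ(t,s) s² ds`. -/
noncomputable def massCoord (ρ : ℝ → ℝ → ℝ) (t r : ℝ) : ℝ :=
  ∫ s in (0 : ℝ)..r, ρ t s * s ^ 2

/-- The radius `r(t,h) ∈ [0,b]` whose mass coordinate at time `t` is `h`. -/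
noncomputable def lagRadius (P : Params) (ρ : ℝ → ℝ → ℝ) (t h : ℝ) : ℝ :=
  Function.invFunOn (massCoord ρ t) (Icc 0 P.b) h

/-- The radial quantity `f` in the Lagrangian coordinates `(t,h)`. -/
noncomputable def lag (P : Params) (ρ f : ℝ → ℝ → ℝ) (t h : ℝ) : ℝ :=
  f t (lagRadius P ρ t h)

/-- The part of the ball outside the ball of mass coordinate `h` at time `t`. -/
def outerRegion (P : Params) (ρ : ℝ → ℝ → ℝ) (t h : ℝ) : Set E3 :=
  {x ∈ P.dom | lagRadius P ρ t h < ‖x‖}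

/-- The estimates on `[0,T) × [h₀,1]` with constant `C`. -/
structure OuterBounds (P : Params) (T h₀ C : ℝ) (ρ u : ℝ → ℝ → ℝ) : Prop where
  density : ∀ t ∈ Ico 0 T, ∀ h ∈ Icc h₀ 1, C⁻¹ ≤ lag P ρ ρ t h ∧ lag P ρ ρ t h ≤ C
  velocity : ∀ t ∈ Ico 0 T,
    ∫⁻ τ in Ioc 0 t, ⨆ h ∈ Icc h₀ 1, ENNReal.ofReal (lag P ρ u τ h ^ 2) ≤ ENNReal.ofReal C
  combined : ∀ t ∈ Ico 0 T, ∀ h ∈ Icc h₀ 1,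
    ENNReal.ofReal (lag P ρ ρ t h)
      + (∫⁻ τ in Ioc 0 t,
          eLpNorm (radialVector (u τ)) ∞ (volume.restrict (outerRegion P ρ τ h)) ^ 2)
            ^ (1 / 2 : ℝ)
      ≤ ENNReal.ofReal C

end NSF

/-! ### Calculus on an interval: parametric integrals, first-touch comparison, Cauchy–Schwarz. -/

namespace NSF

open Filter Topology

/-! On one ray the equations become a one-dimensional system for `(ρ, u, θ)` in `r`
(`exists_radialFlow`), and a first-touch minimum principle keeps `ρ` and `θ` positive. Conservation
of energy bounds `∫ ρ u² r²` and `∫ ρ θ r²`. The entropy `∫ ρ (c_V log θ - R log ρ) r²` has a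
derivative `G(t) ≥ 0` that controls `r θ_r / θ` and the deformation `(r u_r - u)² / θ`. By concavity
of the logarithm the entropy is at most `c_V log ∫ ρ θ r² + R b³`; since it increases, the total
temperature is bounded below, and in the same way `∫ G dt` is bounded. As `dh = ρ r² dr`, this is
the first claim.

For the density put `ν = 2μ + λ` and take a potential `Φ` with `Φ_r = ρ u`. The mass and momentum
equations give `(∂_t + u ∂_r)(ν log ρ + Φ) = -R ρ θ + remainder`, where `Φ` and the remainder are
bounded by mass, energy and the bounds near the center (`potential_time`, `abs_potential_le`,
`abs_remainder_le`). At a spatial extremum the convective term drops out. At a maximum the pressure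
has the good sign, so `ρ` is bounded above. At a minimum the pressure has to be bounded:
Cauchy–Schwarz with `G` gives `θ ≲ 1 + G · sup (1/ρ)`, while at the minimum point `ρ` is at most a
constant over the barrier value that bounds `1/ρ`; hence `ρ θ ≲ 1 + G`, which is integrable in time.
So `log ρ` is bounded on the whole ball (`abs_log_density_le`).

The hypothesis near the center enters in three ways: it bounds `ρ` at the inner end `r = c` of the
comparison interval, it provides a radius at which `θ` is controlled by the energy, and it allows
`Φ` to be normalized by a cutoff so that no stress at `r = c` appears. The velocity vanishes at `r =
b`, so Cauchy–Schwarz with `G` gives `u² ≲ G · sup (1/ρ)` away from the center, and integration in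
time finishes the proof. All constants are explicit in the parameters, a bound `A` of the data, `M`,
`c`, the time and the cutoff, hence uniform over solutions. A bound valid only close to the final
time is completed by compactness on the earlier closed interval. -/

theorem continuousOn_parametric_primitive {I : Set ℝ} {p q : ℝ} (hpq : p ≤ q) {f : ℝ → ℝ → ℝ}
    (hf : ContinuousOn (fun x : ℝ × ℝ => f x.1 x.2) (I ×ˢ Icc p q)) :
    ContinuousOn (fun x : ℝ × ℝ => ∫ s in p..x.2, f x.1 s) (I ×ˢ Icc p q) := by
  -- Clamping the space variable to `[p, q]` makes the integrand globally continuous without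
  -- changing the integral.
  have h1 : Continuous (Function.uncurry fun (t : I) (s : ℝ) => f t (projIcc p q hpq s)) := by
    have : Continuous fun z : I × ℝ => ((z.1 : ℝ), (projIcc p q hpq z.2 : ℝ)) := by fun_prop
    exact hf.comp_continuous this fun z => ⟨z.1.2, (projIcc p q hpq z.2).2⟩
  have h2 := intervalIntegral.continuous_parametric_primitive_of_continuous (μ := volume)
    (a₀ := p) h1
  rw [continuousOn_iff_continuous_domRestrict]
  have h3 : Continuous fun z : (I ×ˢ Icc p q : Set (ℝ × ℝ)) =>
      ((⟨z.1.1, z.2.1⟩ : I), (z.1.2 : ℝ)) := by fun_prop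
  refine (h2.comp h3).congr fun z => ?_
  refine intervalIntegral.integral_congr fun s hs => ?_
  rw [uIcc_of_le z.2.2.1] at hs
  have : s ∈ Icc p q := ⟨hs.1, hs.2.trans z.2.2.2⟩
  simp only [projIcc_of_mem hpq this]

theorem continuousOn_parametric_integral {I : Set ℝ} {p q : ℝ} (hpq : p ≤ q) {f : ℝ → ℝ → ℝ}
    (hf : ContinuousOn (fun x : ℝ × ℝ => f x.1 x.2) (I ×ˢ Icc p q)) :
    ContinuousOn (fun t => ∫ s in p..q, f t s) I := by
  have h := continuousOn_parametric_primitive hpq hf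
  have h2 : ContinuousOn (fun t : ℝ => ((t, q) : ℝ × ℝ)) I := by fun_prop
  exact h.comp h2 fun t ht => ⟨ht, right_mem_Icc.2 hpq⟩

theorem slice_continuousOn {I J : Set ℝ} {f : ℝ → ℝ → ℝ}
    (hf : ContinuousOn (fun x : ℝ × ℝ => f x.1 x.2) (I ×ˢ J)) {t : ℝ} (ht : t ∈ I) :
    ContinuousOn (fun r => f t r) J := by
  have h2 : ContinuousOn (fun r : ℝ => ((t, r) : ℝ × ℝ)) J := by fun_prop
  exact hf.comp h2 fun r hr => ⟨ht, hr⟩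

theorem slice_continuousOn' {I J : Set ℝ} {f : ℝ → ℝ → ℝ}
    (hf : ContinuousOn (fun x : ℝ × ℝ => f x.1 x.2) (I ×ˢ J)) {r : ℝ} (hr : r ∈ J) :
    ContinuousOn (fun t => f t r) I := by
  have h2 : ContinuousOn (fun t : ℝ => ((t, r) : ℝ × ℝ)) I := by fun_prop
  exact hf.comp h2 fun t ht => ⟨ht, hr⟩

theorem hasDerivAt_parametric_integral {T p q : ℝ} (hpq : p ≤ q) {f ft : ℝ → ℝ → ℝ}
    (hd : ∀ t ∈ Ioo 0 T, ∀ r ∈ Icc p q, HasDerivAt (fun s => f s r) (ft t r) t)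
    (hf : ∀ t ∈ Ioo 0 T, ContinuousOn (fun r => f t r) (Icc p q))
    (hft : ContinuousOn (fun x : ℝ × ℝ => ft x.1 x.2) (Ioo 0 T ×ˢ Icc p q))
    {t : ℝ} (ht : t ∈ Ioo 0 T) :
    HasDerivAt (fun t => ∫ r in p..q, f t r) (∫ r in p..q, ft t r) t := by
  -- On a compact time neighbourhood the time derivative is bounded, so a constant dominates it.
  obtain ⟨ε, hε, hsub⟩ := Metric.nhds_basis_closedBall.mem_iff.1 (Ioo_mem_nhds ht.1 ht.2)
  have hcomp : IsCompact (Metric.closedBall t ε ×ˢ Icc p q) :=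
    (isCompact_closedBall t ε).prod isCompact_Icc
  obtain ⟨C, hC⟩ := hcomp.exists_bound_of_continuousOn (hft.mono (prod_mono hsub le_rfl))
  have hsubI : uIoc p q ⊆ Icc p q := by rw [uIoc_of_le hpq]; exact Ioc_subset_Icc_self
  refine (intervalIntegral.hasDerivAt_integral_of_dominated_loc_of_deriv_le (bound := fun _ => C)
    (s := Metric.closedBall t ε) (Metric.closedBall_mem_nhds t hε) ?_ ?_ ?_ ?_ ?_ ?_).2
  · filter_upwards [Metric.closedBall_mem_nhds t hε] with s hs
    exact ((hf s (hsub hs)).mono hsubI).aestronglyMeasurable measurableSet_uIoc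
  · exact ContinuousOn.intervalIntegrable_of_Icc hpq (hf t ht)
  · exact ((slice_continuousOn hft ht).mono hsubI).aestronglyMeasurable measurableSet_uIoc
  · exact Eventually.of_forall fun r hr s hs => hC (s, r) ⟨hs, hsubI hr⟩
  · exact intervalIntegrable_const
  · exact Eventually.of_forall fun r hr s hs => hd s (hsub hs) r (hsubI hr)

/-- A function which is positive initially and which at a first zero would have to be increasing
in time stays positive. -/
theorem pos_of_first_touch {t₀ t₁ : ℝ} {K : Set ℝ} (hK : IsCompact K)
    {g : ℝ → ℝ → ℝ} (hg : ContinuousOn (fun x : ℝ × ℝ => g x.1 x.2) (Icc t₀ t₁ ×ˢ K))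
    (h0 : ∀ x ∈ K, 0 < g t₀ x)
    (htouch : ∀ t ∈ Ioc t₀ t₁, ∀ x ∈ K, g t x = 0 → (∀ y ∈ K, 0 ≤ g t y) →
      ∃ d > 0, HasDerivAt (fun s => g s x) d t) :
    ∀ t ∈ Icc t₀ t₁, ∀ x ∈ K, 0 < g t x := by
  by_contra! hcon
  obtain ⟨t', ht', x', hx', hneg⟩ := hcon
  let Z : Set (ℝ × ℝ) := (Icc t₀ t₁ ×ˢ K) ∩ (fun x : ℝ × ℝ => g x.1 x.2) ⁻¹' Iic 0
  have hcomp : IsCompact (Icc t₀ t₁ ×ˢ K) := isCompact_Icc.prod hK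
  have hZ : IsCompact Z :=
    hcomp.of_isClosed_subset (hg.preimage_isClosed_of_isClosed hcomp.isClosed isClosed_Iic)
      inter_subset_left
  have hne : Z.Nonempty := ⟨(t', x'), ⟨ht', hx'⟩, hneg⟩
  -- The earliest point of the compact set where `g ≤ 0`. Before it `g` is positive, so at `(t, x)`
  -- the time derivative, if it exists, is nonpositive.
  obtain ⟨⟨t, x⟩, ⟨⟨htI, hxK⟩, htx⟩, hmin⟩ :=
    hZ.exists_isMinOn hne (continuous_fst.continuousOn)
  simp only [mem_preimage, mem_Iic] at htx
  simp only at htI hxK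
  have hbefore : ∀ s ∈ Icc t₀ t₁, s < t → ∀ y ∈ K, 0 < g s y := by
    intro s hs hst y hy
    by_contra! hle
    have := hmin (show (s, y) ∈ Z from ⟨⟨hs, hy⟩, hle⟩)
    simp only [mem_ofPred_eq] at this
    linarith
  have ht0 : t₀ < t := by
    rcases htI.1.eq_or_lt with h | h
    · subst h; exact absurd (h0 x hxK) (by linarith)
    · exact h
  have hge : ∀ y ∈ K, 0 ≤ g t y := by
    intro y hy
    have hc : ContinuousWithinAt (fun s => g s y) (Ioo t₀ t) t :=
      ((slice_continuousOn' hg hy) t htI).mono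
        fun s hs => ⟨hs.1.le, hs.2.le.trans htI.2⟩
    have : (𝓝[Ioo t₀ t] t).NeBot := by
      rw [← mem_closure_iff_nhdsWithin_neBot, closure_Ioo ht0.ne]
      exact right_mem_Icc.2 ht0.le
    refine ge_of_tendsto hc ?_
    filter_upwards [self_mem_nhdsWithin] with s hs
    exact (hbefore s ⟨hs.1.le, hs.2.le.trans htI.2⟩ hs.2 y hy).le
  have hzero : g t x = 0 := le_antisymm htx (hge x hxK)
  obtain ⟨d, hd, hder⟩ := htouch t ⟨ht0, htI.2⟩ x hxK hzero hge
  have hs := hasDerivAt_iff_tendsto_slope.1 hder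
  have hs2 : Tendsto (slope (fun s => g s x) t) (𝓝[Ioo t₀ t] t) (𝓝 d) :=
    hs.mono_left (nhdsWithin_mono _ fun s hs => hs.2.ne)
  have : (𝓝[Ioo t₀ t] t).NeBot := by
    rw [← mem_closure_iff_nhdsWithin_neBot, closure_Ioo ht0.ne]
    exact right_mem_Icc.2 ht0.le
  have : d ≤ 0 := by
    refine le_of_tendsto hs2 ?_
    filter_upwards [self_mem_nhdsWithin] with s hs
    rw [slope_def_field, hzero, sub_zero]
    exact div_nonpos_of_nonneg_of_nonpos
      (hbefore s ⟨hs.1.le, hs.2.le.trans htI.2⟩ hs.2 x hxK).le (by linarith [hs.2])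
  linarith

/-- The quadratic `k ↦ ∫ (f - k g)²` is nonnegative, so its discriminant is at most zero. -/
theorem integral_mul_sq_le {p q : ℝ} (hpq : p ≤ q) {f g : ℝ → ℝ} (hf : ContinuousOn f (Icc p q))
    (hg : ContinuousOn g (Icc p q)) :
    (∫ x in p..q, f x * g x) ^ 2 ≤ (∫ x in p..q, f x ^ 2) * ∫ x in p..q, g x ^ 2 := by
  have key : ∀ k : ℝ, 0 ≤ (∫ x in p..q, g x ^ 2) * (k * k) + (-2 * ∫ x in p..q, f x * g x) * k
      + ∫ x in p..q, f x ^ 2 := by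
    intro k
    have h1 : 0 ≤ ∫ x in p..q, (f x - k * g x) ^ 2 :=
      intervalIntegral.integral_nonneg hpq fun x _ => sq_nonneg _
    have i1 : IntervalIntegrable (fun x => g x ^ 2 * (k * k)) volume p q :=
      ContinuousOn.intervalIntegrable_of_Icc hpq (by fun_prop)
    have i2 : IntervalIntegrable (fun x => f x * g x * (-2 * k)) volume p q :=
      ContinuousOn.intervalIntegrable_of_Icc hpq (by fun_prop)
    have i3 : IntervalIntegrable (fun x => f x ^ 2) volume p q :=
      ContinuousOn.intervalIntegrable_of_Icc hpq (by fun_prop)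
    have h2 : ∫ x in p..q, (f x - k * g x) ^ 2
        = ∫ x in p..q, (g x ^ 2 * (k * k) + f x * g x * (-2 * k) + f x ^ 2) := by
      congr 1; ext x; ring
    rw [h2, intervalIntegral.integral_add (i1.add i2) i3, intervalIntegral.integral_add i1 i2,
      intervalIntegral.integral_mul_const, intervalIntegral.integral_mul_const] at h1
    linarith
  have := discrim_le_zero key
  unfold discrim at this
  nlinarith

/-- The derivative vanishes at an interior minimum relative to an interval. -/
theorem deriv_eq_zero_of_isMinOn_Icc {p q x d : ℝ} {f : ℝ → ℝ} (hx : x ∈ Ioo p q)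
    (hmin : ∀ y ∈ Icc p q, f x ≤ f y) (hd : HasDerivWithinAt f d (Icc p q) x) : d = 0 := by
  have h1 : IsLocalMin f x := by
    filter_upwards [Icc_mem_nhds hx.1 hx.2] with y hy using hmin y hy
  exact h1.hasDerivAt_eq_zero (hd.hasDerivAt (Icc_mem_nhds hx.1 hx.2))

/-- At a minimum with vanishing derivative the second derivative is nonnegative. -/
theorem second_deriv_nonneg_of_isMinOn_Icc {p q x d : ℝ} {f f' : ℝ → ℝ} (hpq : p < q)
    (hx : x ∈ Icc p q) (hmin : ∀ y ∈ Icc p q, f x ≤ f y)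
    (hf : ∀ y ∈ Icc p q, HasDerivWithinAt f (f' y) (Icc p q) y) (h0 : f' x = 0)
    (hd : HasDerivWithinAt f' d (Icc p q) x) : 0 ≤ d := by
  by_contra! hneg
  have hs := hasDerivWithinAt_iff_tendsto_slope.1 hd
  have hev : ∀ᶠ y in 𝓝[Icc p q \ {x}] x, slope f' x y < 0 := hs.eventually (gt_mem_nhds hneg)
  rw [eventually_nhdsWithin_iff, Metric.eventually_nhds_iff] at hev
  obtain ⟨ε, hε, hball⟩ := hev
  have hf' : ∀ y ∈ Icc p q, dist y x < ε → y ≠ x → f' y / (y - x) < 0 := by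
    intro y hy hyx hne
    have := hball hyx ⟨hy, hne⟩
    rwa [slope_def_field, h0, sub_zero] at this
  have hcont : ContinuousOn f (Icc p q) := fun y hy => (hf y hy).continuousWithinAt
  -- If `d < 0`, then `f' y / (y - x) < 0` near `x`. The mean value theorem on a short interval to
  -- the right of `x`, or to the left when `x = q`, then contradicts minimality.
  rcases hx.2.lt_or_eq with hlt | heq
  · obtain ⟨y, hy1, hy2⟩ : ∃ y, x < y ∧ y < min q (x + ε) :=
      exists_between (lt_min hlt (by linarith))
    have hyq := hy2.trans_le (min_le_left _ _)
    have hye := hy2.trans_le (min_le_right _ _)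
    obtain ⟨z, hz, hzeq⟩ := exists_hasDerivAt_eq_slope f f' hy1
      (hcont.mono (Icc_subset_Icc hx.1 hyq.le)) fun z hz =>
        (hf z ⟨hx.1.trans hz.1.le, (hz.2.trans hyq).le⟩).hasDerivAt
          (Icc_mem_nhds (hx.1.trans_lt hz.1) (hz.2.trans hyq))
    have h2 := hf' z ⟨hx.1.trans hz.1.le, (hz.2.trans hyq).le⟩
      (by rw [Real.dist_eq, abs_of_pos (by linarith [hz.1])]; linarith [hz.2]) hz.1.ne'
    have h3 : f' z < 0 := by
      by_contra! h
      exact absurd (div_nonneg h (by linarith [hz.1] : (0:ℝ) ≤ z - x)) (by linarith)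
    have h4 : 0 ≤ f' z := by
      rw [hzeq]; exact div_nonneg (by linarith [hmin y ⟨hx.1.trans hy1.le, hyq.le⟩]) (by linarith)
    linarith
  · have hlt : p < x := heq ▸ hpq
    obtain ⟨y, hy1, hy2⟩ : ∃ y, max p (x - ε) < y ∧ y < x :=
      exists_between (max_lt hlt (by linarith))
    have hyq := (le_max_left _ _).trans_lt hy1
    have hye := (le_max_right _ _).trans_lt hy1
    obtain ⟨z, hz, hzeq⟩ := exists_hasDerivAt_eq_slope f f' hy2
      (hcont.mono (Icc_subset_Icc hyq.le hx.2)) fun z hz =>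
        (hf z ⟨(hyq.trans hz.1).le, hz.2.le.trans hx.2⟩).hasDerivAt
          (Icc_mem_nhds (hyq.trans hz.1) (hz.2.trans_le hx.2))
    have h2 := hf' z ⟨(hyq.trans hz.1).le, hz.2.le.trans hx.2⟩
      (by rw [Real.dist_eq, abs_of_neg (by linarith [hz.2])]; linarith [hz.1]) hz.2.ne
    have h3 : 0 < f' z := by
      by_contra! h
      exact absurd (div_nonneg_of_nonpos h (by linarith [hz.2] : z - x ≤ 0)) (by linarith)
    have h4 : f' z ≤ 0 := by
      rw [hzeq]
      exact div_nonpos_of_nonpos_of_nonneg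
        (by linarith [hmin y ⟨hyq.le, hy2.le.trans hx.2⟩]) (by linarith)
    linarith

end NSF

/-! ### Derivatives of radial scalar fields. -/

namespace NSF

open Filter Topology

/-- The first unit vector. -/
noncomputable def axis : E3 := EuclideanSpace.single 0 1

theorem norm_smul_axis (r : ℝ) : ‖r • axis‖ = |r| := by simp [axis, norm_smul]

theorem smul_axis_apply (r : ℝ) (i : Fin 3) : (r • axis) i = if i = 0 then r else 0 := by
  simp [axis]

theorem Params.smul_axis_mem_dom (P : Params) {r : ℝ} (hr : r ∈ Icc 0 P.b) :
    r • axis ∈ P.dom := by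
  simp only [Params.dom, Metric.mem_closedBall, dist_zero_right, norm_smul_axis,
    abs_of_nonneg hr.1]
  exact hr.2

theorem Params.uniqueDiffOn_dom (P : Params) : UniqueDiffOn ℝ P.dom :=
  uniqueDiffOn_convex (convex_closedBall _ _)
    ((Metric.nonempty_ball.2 P.b_pos).mono Metric.ball_subset_interior_closedBall)

theorem Params.dom_mem_nhds (P : Params) {x : E3} (hx : ‖x‖ < P.b) : P.dom ∈ 𝓝 x :=
  mem_of_superset (Metric.isOpen_ball.mem_nhds (by simpa using hx)) Metric.ball_subset_closedBall

theorem pd_eq {Ω : Set E3} {x : E3} (hΩ : Ω ∈ 𝓝 x) {F : E3 → ℝ} {F' : E3 →L[ℝ] ℝ}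
    (h : HasFDerivAt F F' x) (j : Fin 3) : pd Ω j F x = F' (EuclideanSpace.single j 1) := by
  rw [pd, fderivWithin_of_mem_nhds hΩ, h.fderiv]

theorem pd_congr {Ω : Set E3} {x : E3} {F G : E3 → ℝ} (h : F =ᶠ[𝓝 x] G) (j : Fin 3) :
    pd Ω j F x = pd Ω j G x := by
  rw [pd, pd, h.fderivWithin_eq_of_nhds]

theorem pd_mul {Ω : Set E3} {x : E3} (hΩ : Ω ∈ 𝓝 x) {F G : E3 → ℝ}
    (hF : DifferentiableAt ℝ F x) (hG : DifferentiableAt ℝ G x) (j : Fin 3) :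
    pd Ω j (fun y => F y * G y) x = pd Ω j F x * G x + F x * pd Ω j G x := by
  rw [pd_eq hΩ (hF.hasFDerivAt.fun_mul hG.hasFDerivAt), pd_eq hΩ hF.hasFDerivAt,
    pd_eq hΩ hG.hasFDerivAt]
  simp
  ring

theorem hasFDerivAt_radial {φ : ℝ → ℝ} {φ' : ℝ} {x : E3} (hx : x ≠ 0)
    (h : HasDerivAt φ φ' ‖x‖) :
    HasFDerivAt (fun y : E3 => φ ‖y‖) ((φ' * ‖x‖⁻¹) • innerSL ℝ x) x := by
  have hn : HasFDerivAt (fun y : E3 => ‖y‖) (‖x‖⁻¹ • innerSL ℝ x) x := by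
    have h1 := (hasStrictFDerivAt_norm_sq x).hasFDerivAt.sqrt (by positivity)
    simp only [Real.sqrt_sq (norm_nonneg _)] at h1
    refine h1.congr_fderiv ?_
    ext y
    simp
    field_simp
  refine (h.comp_hasFDerivAt x hn).congr_fderiv ?_
  rw [mul_smul]

theorem innerSL_single (x : E3) (j : Fin 3) :
    innerSL ℝ x (EuclideanSpace.single j 1) = x j := by
  simp [EuclideanSpace.inner_single_right]

theorem hasFDerivAt_coord (x : E3) (i : Fin 3) :
    HasFDerivAt (fun y : E3 => y i) (EuclideanSpace.proj i : E3 →L[ℝ] ℝ) x :=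
  (EuclideanSpace.proj i : E3 →L[ℝ] ℝ).hasFDerivAt

theorem pd_radial {Ω : Set E3} {φ : ℝ → ℝ} {φ' : ℝ} {x : E3} (hΩ : Ω ∈ 𝓝 x) (hx : x ≠ 0)
    (h : HasDerivAt φ φ' ‖x‖) (j : Fin 3) :
    pd Ω j (fun y => φ ‖y‖) x = φ' / ‖x‖ * x j := by
  rw [pd_eq hΩ (hasFDerivAt_radial hx h)]
  rw [smul_apply, innerSL_single, smul_eq_mul, div_eq_mul_inv]

theorem pd_radial_coord {Ω : Set E3} {φ : ℝ → ℝ} {φ' : ℝ} {x : E3} (hΩ : Ω ∈ 𝓝 x) (hx : x ≠ 0)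
    (h : HasDerivAt φ φ' ‖x‖) (i j : Fin 3) :
    pd Ω j (fun y => φ ‖y‖ * y i) x
      = φ' / ‖x‖ * x j * x i + φ ‖x‖ * (if i = j then 1 else 0) := by
  rw [pd_mul hΩ (hasFDerivAt_radial hx h).differentiableAt (hasFDerivAt_coord x i).differentiableAt,
    pd_radial hΩ hx h, pd_eq hΩ (hasFDerivAt_coord x i)]
  simp

theorem hasDerivWithinAt_axis {P : Params} {F : E3 → ℝ} (hF : DifferentiableOn ℝ F P.dom)
    {r : ℝ} (hr : r ∈ Icc 0 P.b) :
    HasDerivWithinAt (fun s : ℝ => F (s • axis)) (pd P.dom 0 F (r • axis)) (Icc 0 P.b) r := by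
  have h1 := (hF _ (P.smul_axis_mem_dom hr)).hasFDerivWithinAt
  have h2 : HasDerivWithinAt (fun s : ℝ => s • axis) axis (Icc 0 P.b) r := by
    simpa using ((hasDerivAt_id r).smul_const axis).hasDerivWithinAt
  exact h1.comp_hasDerivWithinAt r h2 fun s hs => P.smul_axis_mem_dom hs

theorem differentiableOn_pd {P : Params} {F : E3 → ℝ} (hF : ContDiffOn ℝ 2 F P.dom)
    (j : Fin 3) : DifferentiableOn ℝ (pd P.dom j F) P.dom := by
  have h1 : ContDiffOn ℝ 1 (fderivWithin ℝ F P.dom) P.dom :=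
    hF.fderivWithin P.uniqueDiffOn_dom (by norm_num)
  exact (h1.differentiableOn (by norm_num)).clm_apply (differentiableOn_const _)

section Axis

variable {P : Params} {r : ℝ}

theorem axis_facts (hr : r ∈ Ioo 0 P.b) :
    r • axis ≠ 0 ∧ P.dom ∈ 𝓝 (r • axis) ∧ ‖r • axis‖ = r := by
  have h3 : ‖r • axis‖ = r := by rw [norm_smul_axis, abs_of_pos hr.1]
  refine ⟨?_, P.dom_mem_nhds (h3.trans_lt hr.2), h3⟩
  rw [← norm_pos_iff, h3]; exact hr.1

theorem eventually_dom {x : E3} (hx0 : x ≠ 0) (hx : ‖x‖ < P.b) :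
    ∀ᶠ y in 𝓝 x, y ≠ 0 ∧ ‖y‖ < P.b :=
  (isOpen_ne.eventually_mem hx0).and (continuous_norm.continuousAt.eventually_lt_const hx)

/-- The radial derivative of a radial function. -/
theorem hasDerivAt_profile {f : ℝ → ℝ} (hF : DifferentiableOn ℝ (radialScalar f) P.dom)
    (hr : r ∈ Ioo 0 P.b) :
    HasDerivAt f (pd P.dom 0 (radialScalar f) (r • axis)) r := by
  refine ((hasDerivWithinAt_axis hF (Ioo_subset_Icc_self hr)).hasDerivAt
    (Icc_mem_nhds hr.1 hr.2)).congr_of_eventuallyEq ?_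
  filter_upwards [lt_mem_nhds hr.1] with s hs
  rw [radialScalar, norm_smul_axis, abs_of_pos hs]

theorem pd_radialScalar {f : ℝ → ℝ} (hF : DifferentiableOn ℝ (radialScalar f) P.dom) {x : E3}
    (hx0 : x ≠ 0) (hx : ‖x‖ < P.b) (j : Fin 3) :
    pd P.dom j (radialScalar f) x
      = pd P.dom 0 (radialScalar f) (‖x‖ • axis) / ‖x‖ * x j :=
  pd_radial (P.dom_mem_nhds hx) hx0 (hasDerivAt_profile hF ⟨norm_pos_iff.2 hx0, hx⟩) j

/-- A radial function is even along the axis, so its derivative at the origin equals its own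
negative. -/
theorem pd_radialScalar_zero {f : ℝ → ℝ} (hF : DifferentiableOn ℝ (radialScalar f) P.dom) :
    pd P.dom 0 (radialScalar f) ((0 : ℝ) • axis) = 0 := by
  have h0 : P.dom ∈ 𝓝 ((0 : ℝ) • axis) := P.dom_mem_nhds (by simpa using P.b_pos)
  have hd := (hF.differentiableAt h0).hasFDerivAt
  have h2 : HasDerivAt (fun s : ℝ => s • axis) axis 0 := by
    simpa using (hasDerivAt_id (0 : ℝ)).smul_const axis
  have h3 := hd.comp_hasDerivAt (0 : ℝ) h2
  rw [pd_eq h0 hd]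
  set d := fderiv ℝ (radialScalar f) ((0 : ℝ) • axis) axis with hdd
  have h4 : HasDerivAt (fun s : ℝ => radialScalar f (-(s • axis))) (-d) 0 := by
    have := HasDerivAt.scomp (h := fun s : ℝ => -s) (h' := -1)
      (g₁ := radialScalar f ∘ fun s : ℝ => s • axis) (g₁' := d) (0 : ℝ) (by simpa using h3)
      (hasDerivAt_neg 0)
    simpa [Function.comp_def] using this
  have h5 : (fun s : ℝ => radialScalar f (-(s • axis)))
      = radialScalar f ∘ fun s : ℝ => s • axis := by
    ext s; simp only [radialScalar, Function.comp, norm_neg]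
  rw [h5] at h4
  have := h4.unique h3
  change d = 0
  linarith

/-- For a transversal index `j` the first derivative is `(f'(|y|) / |y|) y_j`. On the axis `y_j =
0`, so differentiating once more leaves only `f'(r) / r`; the two transversal directions give the
second term. -/
theorem lapl_radialScalar {f : ℝ → ℝ} (hF : ContDiffOn ℝ 2 (radialScalar f) P.dom)
    (hr : r ∈ Ioo 0 P.b) :
    lapl P.dom (radialScalar f) (r • axis)
      = pd P.dom 0 (pd P.dom 0 (radialScalar f)) (r • axis)
        + 2 * pd P.dom 0 (radialScalar f) (r • axis) / r := by
  obtain ⟨hne, hnhds, hn⟩ := axis_facts hr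
  have hF1 := hF.differentiableOn (by norm_num)
  set g : ℝ → ℝ := fun s => pd P.dom 0 (radialScalar f) (s • axis) with hg
  have hg' : HasDerivAt g (pd P.dom 0 (pd P.dom 0 (radialScalar f)) (r • axis)) r :=
    (hasDerivWithinAt_axis (differentiableOn_pd hF 0) (Ioo_subset_Icc_self hr)).hasDerivAt
      (Icc_mem_nhds hr.1 hr.2)
  have hφ := hg'.fun_div (hasDerivAt_id' r) hr.1.ne'
  rw [← hn] at hφ
  have hj : ∀ j : Fin 3, j ≠ 0 →
      pd P.dom j (pd P.dom j (radialScalar f)) (r • axis) = g r / r := by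
    intro j hj
    have he : pd P.dom j (radialScalar f) =ᶠ[𝓝 (r • axis)] fun y => g ‖y‖ / ‖y‖ * y j := by
      filter_upwards [eventually_dom hne (hn.trans_lt hr.2)] with y hy
      exact pd_radialScalar hF1 hy.1 hy.2 j
    rw [pd_congr he, pd_radial_coord hnhds hne hφ, smul_axis_apply, if_neg hj, hn]
    simp
  rw [lapl, Fin.sum_univ_three, hj 1 (by decide), hj 2 (by decide)]
  ring

end Axis

end NSF

/-! ### Derivatives of radial vector fields. -/

namespace NSF

open Filter Topology

/-- The radial component of a radial vector field along the first axis. -/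
noncomputable def radialComp (v : ℝ → ℝ) (r : ℝ) : ℝ := radialVector v (r • axis) 0

theorem radialVector_apply (v : ℝ → ℝ) (x : E3) (i : Fin 3) :
    radialVector v x i = v ‖x‖ / ‖x‖ * x i := by
  simp [radialVector]

theorem radialComp_of_pos {v : ℝ → ℝ} {r : ℝ} (hr : 0 < r) : radialComp v r = v r := by
  rw [radialComp, radialVector_apply, norm_smul_axis, abs_of_pos hr, smul_axis_apply, if_pos rfl,
    div_mul_cancel₀ _ hr.ne']

theorem radialComp_zero (v : ℝ → ℝ) : radialComp v 0 = 0 := by simp [radialComp, radialVector]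

theorem radialVector_apply' (v : ℝ → ℝ) {x : E3} (hx : x ≠ 0) (i : Fin 3) :
    radialVector v x i = radialComp v ‖x‖ / ‖x‖ * x i := by
  rw [radialVector_apply, radialComp_of_pos (norm_pos_iff.2 hx)]

section Axis

variable {P : Params} {r : ℝ} {v : ℝ → ℝ}

/-- The derivative of the radial component of a radial vector field. -/
noncomputable def radialCompDeriv (P : Params) (v : ℝ → ℝ) (r : ℝ) : ℝ :=
  pd P.dom 0 (fun y => radialVector v y 0) (r • axis)

/-- The second derivative of the radial component of a radial vector field. -/
noncomputable def radialCompDeriv2 (P : Params) (v : ℝ → ℝ) (r : ℝ) : ℝ :=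
  pd P.dom 0 (pd P.dom 0 (fun y => radialVector v y 0)) (r • axis)

theorem hasDerivAt_radialComp
    (hU : ∀ i, DifferentiableOn ℝ (fun x => radialVector v x i) P.dom) (hr : r ∈ Ioo 0 P.b) :
    HasDerivAt (radialComp v) (radialCompDeriv P v r) r :=
  (hasDerivWithinAt_axis (hU 0) (Ioo_subset_Icc_self hr)).hasDerivAt (Icc_mem_nhds hr.1 hr.2)

theorem hasDerivAt_radialComp_div
    (hU : ∀ i, DifferentiableOn ℝ (fun x => radialVector v x i) P.dom) (hr : r ∈ Ioo 0 P.b) :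
    HasDerivAt (fun s => radialComp v s / s)
      ((radialCompDeriv P v r * r - radialComp v r) / r ^ 2) r := by
  simpa using (hasDerivAt_radialComp hU hr).fun_div (hasDerivAt_id' r) hr.1.ne'

/-- Off the origin the field is `φ(|x|) x` with `φ(s) = v(s) / s`, so the product rule applies
componentwise. -/
theorem pd_radialVector (hU : ∀ i, DifferentiableOn ℝ (fun x => radialVector v x i) P.dom)
    {x : E3} (hx0 : x ≠ 0) (hx : ‖x‖ < P.b) (i j : Fin 3) :
    pd P.dom j (fun y => radialVector v y i) x
      = (radialCompDeriv P v ‖x‖ * ‖x‖ - radialComp v ‖x‖) / ‖x‖ ^ 2 / ‖x‖ * x j * x i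
        + radialComp v ‖x‖ / ‖x‖ * (if i = j then 1 else 0) := by
  have he : (fun y => radialVector v y i) =ᶠ[𝓝 x] fun y => radialComp v ‖y‖ / ‖y‖ * y i := by
    filter_upwards [eventually_dom hx0 hx] with y hy using radialVector_apply' v hy.1 i
  rw [pd_congr he, pd_radial_coord (P.dom_mem_nhds hx) hx0
    (hasDerivAt_radialComp_div hU ⟨norm_pos_iff.2 hx0, hx⟩)]

theorem divg_radialVector (hU : ∀ i, DifferentiableOn ℝ (fun x => radialVector v x i) P.dom)
    {x : E3} (hx0 : x ≠ 0) (hx : ‖x‖ < P.b) :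
    divg P.dom (radialVector v) x
      = radialCompDeriv P v ‖x‖ + 2 * radialComp v ‖x‖ / ‖x‖ := by
  have hn : ‖x‖ ≠ 0 := norm_ne_zero_iff.2 hx0
  have hsum : x 0 ^ 2 + x 1 ^ 2 + x 2 ^ 2 = ‖x‖ ^ 2 := by
    rw [EuclideanSpace.real_norm_sq_eq, Fin.sum_univ_three]
  rw [divg, Fin.sum_univ_three, pd_radialVector hU hx0 hx, pd_radialVector hU hx0 hx,
    pd_radialVector hU hx0 hx]
  simp only [if_true, mul_one]
  have : ∀ c d : ℝ, c * x 0 * x 0 + d + (c * x 1 * x 1 + d) + (c * x 2 * x 2 + d)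
      = c * ‖x‖ ^ 2 + 3 * d := by
    intro c d; rw [← hsum]; ring
  rw [this]
  field_simp
  ring

theorem hasDerivAt_radialCompDeriv
    (hU : ∀ i, ContDiffOn ℝ 2 (fun x => radialVector v x i) P.dom) (hr : r ∈ Ioo 0 P.b) :
    HasDerivAt (radialCompDeriv P v) (radialCompDeriv2 P v r) r :=
  (hasDerivWithinAt_axis (differentiableOn_pd (hU 0) 0) (Ioo_subset_Icc_self hr)).hasDerivAt
    (Icc_mem_nhds hr.1 hr.2)

theorem pd_divg_radialVector (hU : ∀ i, ContDiffOn ℝ 2 (fun x => radialVector v x i) P.dom)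
    (hr : r ∈ Ioo 0 P.b) :
    pd P.dom 0 (divg P.dom (radialVector v)) (r • axis)
      = radialCompDeriv2 P v r + 2 * radialCompDeriv P v r / r - 2 * radialComp v r / r ^ 2 := by
  obtain ⟨hne, hnhds, hn⟩ := axis_facts hr
  have hU1 := fun i => (hU i).differentiableOn (by norm_num : (2 : WithTop ℕ∞) ≠ 0)
  have he : divg P.dom (radialVector v) =ᶠ[𝓝 (r • axis)]
      fun y => (fun s => radialCompDeriv P v s + 2 * (radialComp v s / s)) ‖y‖ := by
    filter_upwards [eventually_dom hne (hn.trans_lt hr.2)] with y hy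
    rw [divg_radialVector hU1 hy.1 hy.2, mul_div_assoc]
  have hφ := (hasDerivAt_radialCompDeriv hU hr).fun_add
    ((hasDerivAt_radialComp_div hU1 hr).const_mul 2)
  have hr0 := hr.1.ne'
  rw [← hn] at hφ
  rw [pd_congr he, pd_radial hnhds hne hφ, smul_axis_apply, if_pos rfl, hn]
  field_simp
  ring

/-- The value agrees with that of `pd_divg_radialVector`: a radial field is a gradient, so its
Laplacian is the gradient of its divergence. The two viscous terms therefore merge with the single
coefficient `2μ + λ`. -/
theorem lapl_radialVector (hU : ∀ i, ContDiffOn ℝ 2 (fun x => radialVector v x i) P.dom)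
    (hr : r ∈ Ioo 0 P.b) :
    lapl P.dom (fun y => radialVector v y 0) (r • axis)
      = radialCompDeriv2 P v r + 2 * radialCompDeriv P v r / r - 2 * radialComp v r / r ^ 2 := by
  obtain ⟨hne, hnhds, hn⟩ := axis_facts hr
  have hU1 := fun i => (hU i).differentiableOn (by norm_num : (2 : WithTop ℕ∞) ≠ 0)
  set χ : ℝ → ℝ := fun s => (radialCompDeriv P v s * s - radialComp v s) / s ^ 2 / s with hχ
  have hχd : DifferentiableAt ℝ χ r := by
    have h1 := (hasDerivAt_radialCompDeriv hU hr).differentiableAt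
    have h2 := (hasDerivAt_radialComp hU1 hr).differentiableAt
    have hr0 := hr.1.ne'
    exact (((h1.mul differentiableAt_fun_id).sub h2).div (by fun_prop) (by positivity)).div
      differentiableAt_fun_id hr0
  have hχ' := hχd.hasDerivAt
  rw [← hn] at hχ'
  have hj : ∀ j : Fin 3, j ≠ 0 →
      pd P.dom j (pd P.dom j (fun y => radialVector v y 0)) (r • axis) = χ r * r := by
    intro j hj
    have he : pd P.dom j (fun y => radialVector v y 0)
        =ᶠ[𝓝 (r • axis)] fun y => (χ ‖y‖ * y j) * y 0 := by
      filter_upwards [eventually_dom hne (hn.trans_lt hr.2)] with y hy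
      rw [pd_radialVector hU1 hy.1 hy.2, if_neg hj.symm, mul_zero, add_zero]
    rw [pd_congr he, pd_mul hnhds ((hasFDerivAt_radial hne hχ').fun_mul
      (hasFDerivAt_coord _ j)).differentiableAt (hasFDerivAt_coord _ 0).differentiableAt,
      pd_radial_coord hnhds hne hχ']
    simp only [smul_axis_apply, if_neg hj, hn]
    simp
  rw [lapl, Fin.sum_univ_three, hj 1 (by decide), hj 2 (by decide)]
  change radialCompDeriv2 P v r + _ + _ = _
  have hr0 := hr.1.ne'
  rw [hχ]
  field_simp
  ring

theorem dissipation_radialVector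
    (hU : ∀ i, DifferentiableOn ℝ (fun x => radialVector v x i) P.dom) (hr : r ∈ Ioo 0 P.b) :
    dissipation P (radialVector v) (r • axis)
      = 2 * P.mu * (radialCompDeriv P v r ^ 2 + 2 * (radialComp v r / r) ^ 2)
        + P.lam * (radialCompDeriv P v r + 2 * radialComp v r / r) ^ 2 := by
  obtain ⟨hne, hnhds, hn⟩ := axis_facts hr
  have hb := hn.trans_lt hr.2
  have hr0 := hr.1.ne'
  rw [dissipation, divg_radialVector hU hne hb]
  simp only [symGrad, Fin.sum_univ_three, pd_radialVector hU hne hb, smul_axis_apply, hn]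
  simp
  left
  field_simp
  ring

theorem divg_smul_radialVector {a : E3 → ℝ} (hr : r ∈ Ioo 0 P.b)
    (ha : DifferentiableOn ℝ a P.dom)
    (hU : ∀ i, DifferentiableOn ℝ (fun x => radialVector v x i) P.dom) :
    divg P.dom (fun y => a y • radialVector v y) (r • axis)
      = pd P.dom 0 a (r • axis) * radialComp v r
        + a (r • axis) * (radialCompDeriv P v r + 2 * radialComp v r / r) := by
  obtain ⟨hne, hnhds, hn⟩ := axis_facts hr
  have hd := divg_radialVector hU hne (hn.trans_lt hr.2)
  rw [hn] at hd
  rw [← hd]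
  have hj : ∀ j, pd P.dom j (fun y => (a y • radialVector v y) j) (r • axis)
      = pd P.dom j a (r • axis) * radialVector v (r • axis) j
        + a (r • axis) * pd P.dom j (fun y => radialVector v y j) (r • axis) := fun j =>
    pd_mul hnhds (ha.differentiableAt hnhds) ((hU j).differentiableAt hnhds) j
  have h1 : radialVector v (r • axis) 1 = 0 := by
    rw [radialVector_apply, smul_axis_apply, if_neg (by decide), mul_zero]
  have h2 : radialVector v (r • axis) 2 = 0 := by
    rw [radialVector_apply, smul_axis_apply, if_neg (by decide), mul_zero]
  simp only [divg, Fin.sum_univ_three, hj, h1, h2, radialComp]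
  ring

end Axis

end NSF

/-! ### Reduction to a one-dimensional system. -/

namespace NSF

open Filter Topology

/-- A classical solution of the one-dimensional system satisfied by the radial profiles, together
with the derivatives of the profiles. -/
structure RadialFlow (P : Params) (T : ℝ) where
  (ρ u θ ρt ρr ut ur urr θt θr θrr : ℝ → ℝ → ℝ)
  ρ_cont : ContinuousOn (fun x : ℝ × ℝ => ρ x.1 x.2) (Ico 0 T ×ˢ Icc 0 P.b)
  u_cont : ContinuousOn (fun x : ℝ × ℝ => u x.1 x.2) (Ico 0 T ×ˢ Icc 0 P.b)
  θ_cont : ContinuousOn (fun x : ℝ × ℝ => θ x.1 x.2) (Ico 0 T ×ˢ Icc 0 P.b)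
  ρt_cont : ContinuousOn (fun x : ℝ × ℝ => ρt x.1 x.2) (Ioo 0 T ×ˢ Icc 0 P.b)
  ρr_cont : ContinuousOn (fun x : ℝ × ℝ => ρr x.1 x.2) (Ioo 0 T ×ˢ Icc 0 P.b)
  ut_cont : ContinuousOn (fun x : ℝ × ℝ => ut x.1 x.2) (Ioo 0 T ×ˢ Icc 0 P.b)
  ur_cont : ContinuousOn (fun x : ℝ × ℝ => ur x.1 x.2) (Ioo 0 T ×ˢ Icc 0 P.b)
  θt_cont : ContinuousOn (fun x : ℝ × ℝ => θt x.1 x.2) (Ioo 0 T ×ˢ Icc 0 P.b)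
  θr_cont : ContinuousOn (fun x : ℝ × ℝ => θr x.1 x.2) (Ioo 0 T ×ˢ Icc 0 P.b)
  θrr_cont : ContinuousOn (fun x : ℝ × ℝ => θrr x.1 x.2) (Ioo 0 T ×ˢ Icc 0 P.b)
  ρ_time : ∀ t ∈ Ioo 0 T, ∀ r ∈ Icc 0 P.b, HasDerivAt (fun s => ρ s r) (ρt t r) t
  u_time : ∀ t ∈ Ioo 0 T, ∀ r ∈ Icc 0 P.b, HasDerivAt (fun s => u s r) (ut t r) t
  θ_time : ∀ t ∈ Ioo 0 T, ∀ r ∈ Icc 0 P.b, HasDerivAt (fun s => θ s r) (θt t r) t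
  ρ_space : ∀ t ∈ Ioo 0 T, ∀ r ∈ Icc 0 P.b, HasDerivWithinAt (ρ t) (ρr t r) (Icc 0 P.b) r
  u_space : ∀ t ∈ Ioo 0 T, ∀ r ∈ Icc 0 P.b, HasDerivWithinAt (u t) (ur t r) (Icc 0 P.b) r
  ur_space : ∀ t ∈ Ioo 0 T, ∀ r ∈ Icc 0 P.b, HasDerivWithinAt (ur t) (urr t r) (Icc 0 P.b) r
  θ_space : ∀ t ∈ Ioo 0 T, ∀ r ∈ Icc 0 P.b, HasDerivWithinAt (θ t) (θr t r) (Icc 0 P.b) r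
  θr_space : ∀ t ∈ Ioo 0 T, ∀ r ∈ Icc 0 P.b, HasDerivWithinAt (θr t) (θrr t r) (Icc 0 P.b) r
  u_zero : ∀ t, u t 0 = 0
  u_bdry : ∀ t ∈ Ioo 0 T, u t P.b = 0
  θr_zero : ∀ t ∈ Ioo 0 T, θr t 0 = 0
  θr_bdry : ∀ t ∈ Ioo 0 T, θr t P.b = 0
  mass : ∀ t ∈ Ioo 0 T, ∀ r ∈ Ioo 0 P.b,
    ρt t r + (ρr t r * u t r + ρ t r * (ur t r + 2 * u t r / r)) = 0
  momentum : ∀ t ∈ Ioo 0 T, ∀ r ∈ Ioo 0 P.b,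
    (ρt t r * u t r + ρ t r * ut t r)
        + ((ρr t r * u t r + ρ t r * ur t r) * u t r
            + ρ t r * u t r * (ur t r + 2 * u t r / r))
        + P.R * (ρr t r * θ t r + ρ t r * θr t r)
      = (2 * P.mu + P.lam) * (urr t r + 2 * ur t r / r - 2 * u t r / r ^ 2)
  energy : ∀ t ∈ Ioo 0 T, ∀ r ∈ Ioo 0 P.b,
    P.cV * ((ρt t r * θ t r + ρ t r * θt t r)
        + ((ρr t r * θ t r + ρ t r * θr t r) * u t r
            + ρ t r * θ t r * (ur t r + 2 * u t r / r)))
        + P.R * ρ t r * θ t r * (ur t r + 2 * u t r / r)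
      = P.kappa * (θrr t r + 2 * θr t r / r)
        + (2 * P.mu * (ur t r ^ 2 + 2 * (u t r / r) ^ 2)
          + P.lam * (ur t r + 2 * u t r / r) ^ 2)

theorem radialScalar_axis (f : ℝ → ℝ) {r : ℝ} (hr : 0 ≤ r) : radialScalar f (r • axis) = f r := by
  rw [radialScalar, norm_smul_axis, abs_of_nonneg hr]

theorem continuousOn_comp_axis {P : Params} {I : Set ℝ} {f : ℝ → E3 → ℝ}
    (hf : ContinuousOn (fun p : ℝ × E3 => f p.1 p.2) (I ×ˢ P.dom)) :
    ContinuousOn (fun x : ℝ × ℝ => f x.1 (x.2 • axis)) (I ×ˢ Icc 0 P.b) := by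
  have h : ContinuousOn (fun x : ℝ × ℝ => (x.1, x.2 • axis)) (I ×ˢ Icc 0 P.b) := by fun_prop
  exact hf.comp h fun x hx => ⟨hx.1, P.smul_axis_mem_dom hx.2⟩

theorem hasDerivWithinAt_radialScalar {P : Params} {f : ℝ → ℝ}
    (hF : DifferentiableOn ℝ (radialScalar f) P.dom) {r : ℝ} (hr : r ∈ Icc 0 P.b) :
    HasDerivWithinAt f (pd P.dom 0 (radialScalar f) (r • axis)) (Icc 0 P.b) r :=
  (hasDerivWithinAt_axis hF hr).congr (fun _ hs => (radialScalar_axis f hs.1).symm)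
    (radialScalar_axis f hr.1).symm

theorem hasDerivAt_time_axis {T : ℝ} {P : Params} {f : ℝ → E3 → ℝ} (hf : IsC1 T P.dom f)
    {t r : ℝ} (ht : t ∈ Ioo 0 T) (hr : r ∈ Icc 0 P.b) :
    HasDerivAt (fun s => f s (r • axis)) (dt f t (r • axis)) t :=
  (hf.diff_time t ht _ (P.smul_axis_mem_dom hr)).hasDerivAt

/-- Everything is evaluated on the first axis. The velocity profile is replaced by `radialComp`,
since the vector field does not see the value of `u t` at `r = 0`; `radialComp` is zero there and
equals `u t` at positive radii. -/
theorem exists_radialFlow {P : Params} {T : ℝ} {ρ u θ : ℝ → ℝ → ℝ}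
    (h : IsClassicalSolution P T (fun t => radialScalar (ρ t)) (fun t => radialVector (u t))
      (fun t => radialScalar (θ t))) :
    ∃ F : RadialFlow P T, F.ρ = ρ ∧ F.u = (fun t => radialComp (u t)) ∧ F.θ = θ := by
  have hρ := h.reg_density
  have hU := h.reg_velocity
  have hθ := h.reg_temperature
  have hρd : ∀ t ∈ Ioo 0 T, DifferentiableOn ℝ (radialScalar (ρ t)) P.dom := fun t ht =>
    (hρ.diff_space t ht).differentiableOn (by norm_num)
  have hθd : ∀ t ∈ Ioo 0 T, DifferentiableOn ℝ (radialScalar (θ t)) P.dom := fun t ht =>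
    (hθ.diff_space t ht).differentiableOn (by norm_num)
  have hUd : ∀ t ∈ Ioo 0 T, ∀ i, DifferentiableOn ℝ (fun x => radialVector (u t) x i) P.dom :=
    fun t ht i => ((hU i).diff_space t ht).differentiableOn (by norm_num)
  have hU2 : ∀ t ∈ Ioo 0 T, ∀ i, ContDiffOn ℝ 2 (fun x => radialVector (u t) x i) P.dom :=
    fun t ht i => (hU i).diff_space_two t ht
  have hρt : ∀ t ∈ Ioo 0 T, ∀ r ∈ Icc 0 P.b, HasDerivAt (fun s => ρ s r)
      (dt (fun t => radialScalar (ρ t)) t (r • axis)) t := by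
    intro t ht r hr
    simpa only [radialScalar_axis _ hr.1] using hasDerivAt_time_axis hρ ht hr
  have hθt : ∀ t ∈ Ioo 0 T, ∀ r ∈ Icc 0 P.b, HasDerivAt (fun s => θ s r)
      (dt (fun t => radialScalar (θ t)) t (r • axis)) t := by
    intro t ht r hr
    simpa only [radialScalar_axis _ hr.1] using hasDerivAt_time_axis hθ.toIsC1 ht hr
  have hut : ∀ t ∈ Ioo 0 T, ∀ r ∈ Icc 0 P.b, HasDerivAt (fun s => radialComp (u s) r)
      (dt (fun t x => radialVector (u t) x 0) t (r • axis)) t := fun t ht r hr =>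
    hasDerivAt_time_axis (hU 0).toIsC1 ht hr
  have hball : ∀ r ∈ Ioo 0 P.b, r • axis ∈ Metric.ball (0 : E3) P.b := by
    intro r hr
    rw [mem_ball_zero_iff, (axis_facts hr).2.2]
    exact hr.2
  have hsph : P.b • axis ∈ Metric.sphere (0 : E3) P.b := by
    rw [mem_sphere_zero_iff_norm, norm_smul_axis, abs_of_pos P.b_pos]
  have hbaxis : ‖P.b • axis‖⁻¹ • (P.b • axis) = EuclideanSpace.single 0 1 := by
    rw [norm_smul_axis, abs_of_pos P.b_pos, smul_smul, inv_mul_cancel₀ P.b_pos.ne', one_smul, axis]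
  refine ⟨{
    ρ := ρ
    u := fun t => radialComp (u t)
    θ := θ
    ρt := fun t r => dt (fun t => radialScalar (ρ t)) t (r • axis)
    ρr := fun t r => pd P.dom 0 (radialScalar (ρ t)) (r • axis)
    ut := fun t r => dt (fun t x => radialVector (u t) x 0) t (r • axis)
    ur := fun t => radialCompDeriv P (u t)
    urr := fun t => radialCompDeriv2 P (u t)
    θt := fun t r => dt (fun t => radialScalar (θ t)) t (r • axis)
    θr := fun t r => pd P.dom 0 (radialScalar (θ t)) (r • axis)
    θrr := fun t r => pd P.dom 0 (pd P.dom 0 (radialScalar (θ t))) (r • axis)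
    ρ_cont := (continuousOn_comp_axis (f := fun t => radialScalar (ρ t)) hρ.cont).congr fun x hx =>
      (radialScalar_axis _ hx.2.1).symm
    u_cont := continuousOn_comp_axis (f := fun t x => radialVector (u t) x 0) (hU 0).cont
    θ_cont := (continuousOn_comp_axis (f := fun t => radialScalar (θ t)) hθ.cont).congr fun x hx =>
      (radialScalar_axis _ hx.2.1).symm
    ρt_cont := continuousOn_comp_axis (f := dt fun t => radialScalar (ρ t)) hρ.cont_time
    ρr_cont := continuousOn_comp_axis
      (f := fun t => pd P.dom 0 (radialScalar (ρ t))) (hρ.cont_space 0)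
    ut_cont := continuousOn_comp_axis
      (f := dt fun t x => radialVector (u t) x 0) (hU 0).cont_time
    ur_cont := continuousOn_comp_axis
      (f := fun t => pd P.dom 0 (fun y => radialVector (u t) y 0)) ((hU 0).cont_space 0)
    θt_cont := continuousOn_comp_axis (f := dt fun t => radialScalar (θ t)) hθ.cont_time
    θr_cont := continuousOn_comp_axis
      (f := fun t => pd P.dom 0 (radialScalar (θ t))) (hθ.cont_space 0)
    θrr_cont := continuousOn_comp_axis
      (f := fun t => pd P.dom 0 (pd P.dom 0 (radialScalar (θ t)))) (hθ.cont_space_two 0 0)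
    ρ_time := hρt
    u_time := hut
    θ_time := hθt
    ρ_space := fun t ht r hr => hasDerivWithinAt_radialScalar (hρd t ht) hr
    u_space := fun t ht r hr => hasDerivWithinAt_axis (hUd t ht 0) hr
    ur_space := fun t ht r hr => hasDerivWithinAt_axis (differentiableOn_pd (hU2 t ht 0) 0) hr
    θ_space := fun t ht r hr => hasDerivWithinAt_radialScalar (hθd t ht) hr
    θr_space := fun t ht r hr =>
      hasDerivWithinAt_axis (differentiableOn_pd (hθ.diff_space_two t ht) 0) hr
    u_zero := fun t => radialComp_zero _
    u_bdry := ?_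
    θr_zero := fun t ht => pd_radialScalar_zero (hθd t ht)
    θr_bdry := ?_
    mass := ?_
    momentum := ?_
    energy := ?_ }, rfl, rfl, rfl⟩
  · intro t ht
    rw [radialComp, h.no_slip t ht _ hsph]
    rfl
  · intro t ht
    have := h.no_flux t ht _ hsph
    rwa [hbaxis] at this
  · intro t ht r hr
    have h1 := h.mass_eq t ht _ (hball r hr)
    rwa [divg_smul_radialVector hr (hρd t ht) (hUd t ht), radialScalar_axis _ hr.1.le] at h1
  · intro t ht r hr
    have hnhds := (axis_facts hr).2.1
    have hrI := Ioo_subset_Icc_self hr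
    have h1 := h.momentum_eq t ht _ (hball r hr) 0
    have e1 : dt (fun s y => radialScalar (ρ s) y * radialVector (u s) y 0) t (r • axis)
        = dt (fun t => radialScalar (ρ t)) t (r • axis) * radialComp (u t) r
          + ρ t r * dt (fun t x => radialVector (u t) x 0) t (r • axis) := by
      have := ((hasDerivAt_time_axis hρ ht hrI).fun_mul
        (hasDerivAt_time_axis (hU 0).toIsC1 ht hrI)).deriv
      rwa [radialScalar_axis _ hr.1.le] at this
    have hprod : DifferentiableOn ℝ (fun y => radialScalar (ρ t) y * radialVector (u t) y 0)
        P.dom := (hρd t ht).fun_mul (hUd t ht 0)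
    have e2 := divg_smul_radialVector hr hprod (hUd t ht)
    rw [pd_mul hnhds ((hρd t ht).differentiableAt hnhds) ((hUd t ht 0).differentiableAt hnhds),
      radialScalar_axis _ hr.1.le] at e2
    have e3 : pd P.dom 0 (fun y => P.R * radialScalar (ρ t) y * radialScalar (θ t) y) (r • axis)
        = P.R * (pd P.dom 0 (radialScalar (ρ t)) (r • axis) * θ t r
          + ρ t r * pd P.dom 0 (radialScalar (θ t)) (r • axis)) := by
      have hc : DifferentiableAt ℝ (fun y => P.R * radialScalar (ρ t) y) (r • axis) :=
        ((hρd t ht).differentiableAt hnhds).const_mul _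
      rw [pd_mul hnhds hc ((hθd t ht).differentiableAt hnhds),
        pd_eq hnhds (((hρd t ht).differentiableAt hnhds).hasFDerivAt.const_mul P.R),
        pd_eq hnhds ((hρd t ht).differentiableAt hnhds).hasFDerivAt,
        radialScalar_axis _ hr.1.le, radialScalar_axis _ hr.1.le, smul_apply, smul_eq_mul]
      ring
    rw [e1, e2, e3, lapl_radialVector (hU2 t ht) hr, pd_divg_radialVector (hU2 t ht) hr] at h1
    change _ + (_ + ρ t r * radialComp (u t) r * _) + _ = _ at h1
    simp only [radialCompDeriv, radialComp] at h1 ⊢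
    linear_combination h1
  · intro t ht r hr
    have hnhds := (axis_facts hr).2.1
    have hrI := Ioo_subset_Icc_self hr
    have hne := (axis_facts hr).1
    have hn := (axis_facts hr).2.2
    have h1 := h.energy_eq t ht _ (hball r hr)
    have e1 : dt (fun s y => radialScalar (ρ s) y * radialScalar (θ s) y) t (r • axis)
        = dt (fun t => radialScalar (ρ t)) t (r • axis) * θ t r
          + ρ t r * dt (fun t => radialScalar (θ t)) t (r • axis) := by
      have := ((hasDerivAt_time_axis hρ ht hrI).fun_mul
        (hasDerivAt_time_axis hθ.toIsC1 ht hrI)).deriv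
      rwa [radialScalar_axis _ hr.1.le, radialScalar_axis _ hr.1.le] at this
    have hprod : DifferentiableOn ℝ (fun y => radialScalar (ρ t) y * radialScalar (θ t) y)
        P.dom := (hρd t ht).fun_mul (hθd t ht)
    have e2 := divg_smul_radialVector hr hprod (hUd t ht)
    rw [pd_mul hnhds ((hρd t ht).differentiableAt hnhds) ((hθd t ht).differentiableAt hnhds),
      radialScalar_axis _ hr.1.le, radialScalar_axis _ hr.1.le] at e2
    have e3 := divg_radialVector (hUd t ht) hne (hn.trans_lt hr.2)
    rw [hn] at e3
    rw [e1, e2, e3, lapl_radialScalar (hθ.diff_space_two t ht) hr,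
      dissipation_radialVector (hUd t ht) hr, radialScalar_axis _ hr.1.le,
      radialScalar_axis _ hr.1.le] at h1
    exact h1

end NSF

/-! ### Positivity of density and temperature. -/

namespace NSF

open Filter Topology

/-- Time derivatives exist only for positive times, so comparison arguments have to start at some `δ
> 0`; compactness carries the sign of the initial values over to `[0, δ]`. -/
theorem eventually_pos_of_continuousOn {T : ℝ} {K : Set ℝ} (hK : IsCompact K) {f : ℝ → ℝ → ℝ}
    (hf : ContinuousOn (fun x : ℝ × ℝ => f x.1 x.2) (Ico 0 T ×ˢ K)) (h0 : ∀ r ∈ K, 0 < f 0 r)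
    {t : ℝ} (ht : t ∈ Ioo 0 T) : ∃ δ ∈ Ioc 0 t, ∀ s ∈ Icc 0 δ, ∀ r ∈ K, 0 < f s r := by
  let Z : Set (ℝ × ℝ) := (Icc 0 t ×ˢ K) ∩ (fun x : ℝ × ℝ => f x.1 x.2) ⁻¹' Iic 0
  have hsub : Icc 0 t ⊆ Ico 0 T := fun s hs => ⟨hs.1, hs.2.trans_lt ht.2⟩
  have hcomp : IsCompact (Icc 0 t ×ˢ K) := isCompact_Icc.prod hK
  have hZ : IsCompact (Prod.fst '' Z) :=
    (hcomp.of_isClosed_subset ((hf.mono (prod_mono hsub le_rfl)).preimage_isClosed_of_isClosed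
      hcomp.isClosed isClosed_Iic) inter_subset_left).image continuous_fst
  have hmem : (0 : ℝ) ∈ (Prod.fst '' Z)ᶜ := by
    rintro ⟨⟨s, r⟩, ⟨⟨_, hr⟩, hle⟩, rfl : s = 0⟩
    exact absurd (h0 r hr) (not_lt.2 hle)
  obtain ⟨ε, hε, hball⟩ := Metric.isOpen_iff.1 hZ.isClosed.isOpen_compl 0 hmem
  refine ⟨min t (ε / 2), ⟨lt_min ht.1 (by positivity), min_le_left _ _⟩, fun s hs r hr => ?_⟩
  by_contra! hle
  have hs2 : s ∈ Metric.ball (0 : ℝ) ε := by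
    rw [mem_ball_zero_iff, Real.norm_eq_abs, abs_of_nonneg hs.1]
    linarith [hs.2.trans (min_le_right _ _)]
  exact hball hs2 ⟨(s, r), ⟨⟨⟨hs.1, hs.2.trans (min_le_left _ _)⟩, hr⟩, hle⟩, rfl⟩

theorem nonneg_of_nonneg_Ioo {p q : ℝ} (hpq : p < q) {f : ℝ → ℝ} (hf : ContinuousOn f (Icc p q))
    (h : ∀ x ∈ Ioo p q, 0 ≤ f x) : ∀ x ∈ Icc p q, 0 ≤ f x := by
  intro x hx
  have hx' : x ∈ closure (Ioo p q) := by rwa [closure_Ioo hpq.ne]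
  have : (𝓝[Ioo p q] x).NeBot := mem_closure_iff_nhdsWithin_neBot.1 hx'
  exact ge_of_tendsto ((hf x hx).mono Ioo_subset_Icc_self)
    (by filter_upwards [self_mem_nhdsWithin] with y hy using h y hy)

namespace RadialFlow

variable {P : Params} {T : ℝ} (F : RadialFlow P T) {t r : ℝ}

theorem ρ_deriv (ht : t ∈ Ioo 0 T) (hr : r ∈ Ioo 0 P.b) :
    HasDerivAt (fun s => F.ρ t s) (F.ρr t r) r :=
  (F.ρ_space t ht r (Ioo_subset_Icc_self hr)).hasDerivAt (Icc_mem_nhds hr.1 hr.2)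

theorem u_deriv (ht : t ∈ Ioo 0 T) (hr : r ∈ Ioo 0 P.b) :
    HasDerivAt (fun s => F.u t s) (F.ur t r) r :=
  (F.u_space t ht r (Ioo_subset_Icc_self hr)).hasDerivAt (Icc_mem_nhds hr.1 hr.2)

theorem ur_deriv (ht : t ∈ Ioo 0 T) (hr : r ∈ Ioo 0 P.b) :
    HasDerivAt (fun s => F.ur t s) (F.urr t r) r :=
  (F.ur_space t ht r (Ioo_subset_Icc_self hr)).hasDerivAt (Icc_mem_nhds hr.1 hr.2)

theorem θ_deriv (ht : t ∈ Ioo 0 T) (hr : r ∈ Ioo 0 P.b) :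
    HasDerivAt (fun s => F.θ t s) (F.θr t r) r :=
  (F.θ_space t ht r (Ioo_subset_Icc_self hr)).hasDerivAt (Icc_mem_nhds hr.1 hr.2)

theorem θr_deriv (ht : t ∈ Ioo 0 T) (hr : r ∈ Ioo 0 P.b) :
    HasDerivAt (fun s => F.θr t s) (F.θrr t r) r :=
  (F.θr_space t ht r (Ioo_subset_Icc_self hr)).hasDerivAt (Icc_mem_nhds hr.1 hr.2)

/-- On compact time intervals the velocity gradient is bounded. -/
theorem exists_gradient_bound {t₀ t₁ : ℝ} (ht₀ : 0 < t₀) (ht₁ : t₁ < T) :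
    ∃ K ≥ 0, ∀ t ∈ Icc t₀ t₁, ∀ r ∈ Ioo 0 P.b, |F.ur t r| ≤ K ∧ |F.u t r / r| ≤ K := by
  have hsub : Icc t₀ t₁ ⊆ Ioo 0 T := fun s hs => ⟨ht₀.trans_le hs.1, hs.2.trans_lt ht₁⟩
  have hcomp : IsCompact (Icc t₀ t₁ ×ˢ Icc 0 P.b) := isCompact_Icc.prod isCompact_Icc
  obtain ⟨K, hK⟩ := hcomp.exists_bound_of_continuousOn (F.ur_cont.mono (prod_mono hsub le_rfl))
  have hK' : ∀ t ∈ Icc t₀ t₁, ∀ r ∈ Icc 0 P.b, |F.ur t r| ≤ max K 0 := fun t ht r hr =>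
    (hK (t, r) ⟨ht, hr⟩).trans (le_max_left _ _)
  refine ⟨max K 0, le_max_right _ _, fun t ht r hr => ⟨hK' t ht r (Ioo_subset_Icc_self hr), ?_⟩⟩
  -- Because `u` vanishes at the center, `u / r` is a mean slope and inherits the bound of `u_r`.
  obtain ⟨z, hz, hzeq⟩ := exists_hasDerivAt_eq_slope (F.u t) (F.ur t) hr.1
    ((slice_continuousOn F.u_cont (Ioo_subset_Ico_self (hsub ht))).mono
      (Icc_subset_Icc_right hr.2.le))
    fun z hz => F.u_deriv (hsub ht) ⟨hz.1, hz.2.trans hr.2⟩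
  rw [F.u_zero, sub_zero, sub_zero] at hzeq
  rw [← hzeq]
  exact hK' t ht z ⟨hz.1.le, (hz.2.trans hr.2).le⟩

theorem abs_div_le {K a q : ℝ} (h : |a| ≤ K ∧ |q| ≤ K) : |a + 2 * q| ≤ 3 * K := by
  have := abs_add_le a (2 * q)
  rw [abs_mul, abs_two] at this
  linarith [h.1, h.2]

/-- Makes the transport term vanish at a spatial minimum: inside the interval the derivative is
zero, at both ends the velocity is. -/
theorem mul_deriv_eq_zero_of_isMinOn {f f' v : ℝ → ℝ} {b r : ℝ} (hr : r ∈ Icc 0 b)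
    (hmin : ∀ y ∈ Icc 0 b, f r ≤ f y) (hd : HasDerivWithinAt f (f' r) (Icc 0 b) r)
    (h0 : v 0 = 0) (hb : v b = 0) : f' r * v r = 0 := by
  rcases hr.1.eq_or_lt with h | h
  · rw [← h, h0, mul_zero]
  rcases hr.2.eq_or_lt with h' | h'
  · rw [h', hb, mul_zero]
  · rw [deriv_eq_zero_of_isMinOn_Icc ⟨h, h'⟩ hmin hd, zero_mul]

theorem exists_pos_le_of_continuousOn {p q : ℝ} (hpq : p ≤ q) {f : ℝ → ℝ}
    (hf : ContinuousOn f (Icc p q)) (h : ∀ x ∈ Icc p q, 0 < f x) :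
    ∃ m > 0, ∀ x ∈ Icc p q, m < f x := by
  obtain ⟨x, hx, hmin⟩ := isCompact_Icc.exists_isMinOn (nonempty_Icc.2 hpq) hf
  exact ⟨f x / 2, half_pos (h x hx), fun y hy => (half_lt_self (h x hx)).trans_le (hmin hy)⟩

theorem hasDerivAt_exp_barrier (m K t₀ t : ℝ) :
    HasDerivAt (fun s => m * Real.exp (-K * (s - t₀)))
      (-K * (m * Real.exp (-K * (t - t₀)))) t := by
  have := ((((hasDerivAt_id' t).sub_const t₀).const_mul (-K)).exp).const_mul m
  exact this.congr_deriv (by ring)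

/-- Along the flow `ρ` decays at most at the rate `|div U| ≤ 3K`, so it cannot touch a barrier
decaying at the faster rate `3K + 1`. The constant `K` is only local in time, which suffices for a
qualitative statement. -/
theorem ρ_pos (h0 : ∀ r ∈ Icc 0 P.b, 0 < F.ρ 0 r) :
    ∀ t ∈ Ico 0 T, ∀ r ∈ Icc 0 P.b, 0 < F.ρ t r := by
  intro t ht
  rcases ht.1.eq_or_lt with rfl | htpos
  · exact h0
  obtain ⟨δ, hδ, hpos⟩ := eventually_pos_of_continuousOn isCompact_Icc F.ρ_cont h0 ⟨htpos, ht.2⟩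
  have hsub : Icc δ t ⊆ Ioo 0 T := fun s hs => ⟨hδ.1.trans_le hs.1, hs.2.trans_lt ht.2⟩
  have hsub' : Icc δ t ⊆ Ico 0 T := hsub.trans Ioo_subset_Ico_self
  obtain ⟨K, hK0, hK⟩ := F.exists_gradient_bound hδ.1 ht.2
  obtain ⟨m, hm, hmlt⟩ := exists_pos_le_of_continuousOn P.b_pos.le
    (slice_continuousOn F.ρ_cont (hsub' ⟨le_rfl, hδ.2⟩)) (hpos δ ⟨hδ.1.le, le_rfl⟩)
  -- The mass equation turned into an inequality without `u / r`, so that continuity extends it to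
  -- both endpoints. The absolute value is there because the sign of `ρ` is not yet known.
  have htransport : ∀ s ∈ Icc δ t, ∀ r ∈ Icc 0 P.b,
      0 ≤ 3 * K * |F.ρ s r| + (F.ρt s r + F.ρr s r * F.u s r) := by
    intro s hs
    have c1 := slice_continuousOn F.ρ_cont (hsub' hs)
    have c2 := slice_continuousOn F.ρt_cont (hsub hs)
    have c3 := slice_continuousOn F.ρr_cont (hsub hs)
    have c4 := slice_continuousOn F.u_cont (hsub' hs)
    refine nonneg_of_nonneg_Ioo P.b_pos (by fun_prop) fun r hr => ?_
    have h1 := F.mass s (hsub hs) r hr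
    have h2 := abs_div_le (hK s hs r hr)
    have h3 : F.ρ s r * (F.ur s r + 2 * F.u s r / r) ≤ |F.ρ s r| * (3 * K) := by
      refine (le_abs_self _).trans ?_
      rw [abs_mul, mul_div_assoc]
      gcongr
    linarith
  have := pos_of_first_touch (t₀ := δ) (t₁ := t) (K := Icc 0 P.b) isCompact_Icc
    (g := fun s r => F.ρ s r - m * Real.exp (-(3 * K + 1) * (s - δ))) ?_ ?_ ?_
  · intro r hr
    have h1 := this t ⟨hδ.2, le_rfl⟩ r hr
    have h2 : 0 < m * Real.exp (-(3 * K + 1) * (t - δ)) := by positivity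
    linarith
  · have := F.ρ_cont.mono (prod_mono hsub' (le_refl (Icc 0 P.b)))
    fun_prop
  · intro r hr
    simpa using hmlt r hr
  · intro s hs r hr hz hmin
    have hs' : s ∈ Icc δ t := ⟨hs.1.le, hs.2⟩
    have hval : F.ρ s r = m * Real.exp (-(3 * K + 1) * (s - δ)) := by simpa [sub_eq_zero] using hz
    have hρ : 0 < F.ρ s r := by rw [hval]; positivity
    refine ⟨_, ?_, (F.ρ_time s (hsub hs') r hr).sub (hasDerivAt_exp_barrier m (3 * K + 1) δ s)⟩
    have h1 := htransport s hs' r hr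
    have h2 := mul_deriv_eq_zero_of_isMinOn (v := F.u s) hr
      (fun y hy => by linarith [hmin y hy]) (F.ρ_space s (hsub hs') r hr) (F.u_zero s)
      (F.u_bdry s (hsub hs'))
    rw [h2, abs_of_pos hρ] at h1
    rw [← hval]
    linarith

/-- The viscous dissipation dominates the square of the trace-free part of the deformation. -/
theorem dissipation_lower (P : Params) (a q : ℝ) :
    4 / 3 * P.mu * (a - q) ^ 2
      ≤ 2 * P.mu * (a ^ 2 + 2 * q ^ 2) + P.lam * (a + 2 * q) ^ 2 := by
  have h1 := P.visc_nonneg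
  have h2 := P.mu_pos
  have h3 : 0 ≤ 2 * P.mu + 3 * P.lam := by linarith
  -- The two sides differ by `(2μ/3 + λ)(a + 2q)²`.
  nlinarith [mul_nonneg h3 (sq_nonneg (a + 2 * q))]

/-- At a spatial minimum of `θ` diffusion and dissipation are nonnegative, so only the compression
term can lower the temperature, at a rate proportional to `|θ|`. The inequality is needed at the
center and at the boundary too, where the equation itself is not given. -/
theorem heat_inequality {t K : ℝ} (ht : t ∈ Ioo 0 T)
    (hK : ∀ r ∈ Ioo 0 P.b, |F.ur t r| ≤ K ∧ |F.u t r / r| ≤ K)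
    (hρ : ∀ r ∈ Icc 0 P.b, 0 < F.ρ t r) {r : ℝ} (hr : r ∈ Icc 0 P.b) (h0 : F.θr t r = 0)
    (h2 : 0 ≤ F.θrr t r) :
    0 ≤ P.cV * (F.θt t r + F.θr t r * F.u t r) + 3 * P.R * K * |F.θ t r| := by
  have ht' : t ∈ Ico 0 T := Ioo_subset_Ico_self ht
  have c1 := slice_continuousOn F.ρ_cont ht'
  have c2 := slice_continuousOn F.θ_cont ht'
  have c3 := slice_continuousOn F.u_cont ht'
  have c4 := slice_continuousOn F.θt_cont ht
  have c5 := slice_continuousOn F.θr_cont ht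
  have c6 := slice_continuousOn F.θrr_cont ht
  set G : ℝ → ℝ := fun r =>
    F.ρ t r * (P.cV * (F.θt t r + F.θr t r * F.u t r) + 3 * P.R * K * |F.θ t r|) with hG
  have cG : ContinuousOn G (Icc 0 P.b) := by fun_prop
  have hint : ∀ r ∈ Ioo 0 P.b, P.kappa * (F.θrr t r + 2 * (F.θr t r / r)) ≤ G r := by
    intro r hr
    have hen := F.energy t ht r hr
    have hm := F.mass t ht r hr
    have hdis := dissipation_lower P (F.ur t r) (F.u t r / r)
    have hdiv := abs_div_le (hK r hr)
    have hρr := hρ r (Ioo_subset_Icc_self hr)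
    have hdis0 : 0 ≤ 4 / 3 * P.mu * (F.ur t r - F.u t r / r) ^ 2 := by
      have := P.mu_pos; positivity
    have h3 : F.θ t r * (F.ur t r + 2 * (F.u t r / r)) ≤ |F.θ t r| * (3 * K) := by
      refine (le_abs_self _).trans ?_
      rw [abs_mul]
      gcongr
    have h4 : P.R * F.ρ t r * (F.θ t r * (F.ur t r + 2 * (F.u t r / r)))
        ≤ P.R * F.ρ t r * (|F.θ t r| * (3 * K)) :=
      mul_le_mul_of_nonneg_left h3 (mul_pos P.R_pos hρr).le
    simp only [mul_div_assoc] at hen hm hdis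
    have h5 : P.cV * F.ρ t r * (F.θt t r + F.θr t r * F.u t r)
        + P.R * F.ρ t r * (F.θ t r * (F.ur t r + 2 * (F.u t r / r)))
        = P.kappa * (F.θrr t r + 2 * (F.θr t r / r))
        + (2 * P.mu * (F.ur t r ^ 2 + 2 * (F.u t r / r) ^ 2)
          + P.lam * (F.ur t r + 2 * (F.u t r / r)) ^ 2) := by
      linear_combination hen - P.cV * F.θ t r * hm
    have h6 : G r = P.cV * F.ρ t r * (F.θt t r + F.θr t r * F.u t r)
        + P.R * F.ρ t r * (|F.θ t r| * (3 * K)) := by rw [hG]; ring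
    rw [h6]
    linarith
  have hkey : 0 ≤ G r := by
    have hk := P.kappa_pos
    rcases hr.1.eq_or_lt with h | h
    -- At the center `θ_r / r` is a difference quotient of `θ_r`, with limit `θ_rr`; hence the
    -- diffusion term tends to `3 κ θ_rr ≥ 0`.
    · subst h
      have hs := hasDerivWithinAt_iff_tendsto_slope.1 (F.θr_space t ht 0 hr)
      have hmono : Ioo 0 P.b ⊆ Icc 0 P.b \ {0} := fun y hy =>
        ⟨Ioo_subset_Icc_self hy, hy.1.ne'⟩
      have hs2 := hs.mono_left (nhdsWithin_mono 0 hmono)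
      have hs3 : Tendsto (F.θrr t) (𝓝[Ioo 0 P.b] 0) (𝓝 (F.θrr t 0)) :=
        (c6 0 hr).mono Ioo_subset_Icc_self
      have hs4 := (hs3.add (hs2.const_mul 2)).const_mul P.kappa
      have hs5 : Tendsto G (𝓝[Ioo 0 P.b] 0) (𝓝 (G 0)) := (cG 0 hr).mono Ioo_subset_Icc_self
      have : (𝓝[Ioo 0 P.b] (0 : ℝ)).NeBot := by
        rw [← mem_closure_iff_nhdsWithin_neBot, closure_Ioo P.b_pos.ne]
        exact hr
      have hle := le_of_tendsto_of_tendsto hs4 hs5 (by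
        filter_upwards [self_mem_nhdsWithin] with y hy
        have := hint y hy
        simpa [slope_def_field, h0] using this)
      exact le_trans (by positivity) hle
    -- Away from the center `θ_r / y` is continuous, so the interior inequality extends to `y = b`.
    · have hcl : ∀ y ∈ Icc (r / 2) P.b,
          0 ≤ G y - P.kappa * (F.θrr t y + 2 * (F.θr t y / y)) := by
        have hrb : r / 2 < P.b := by linarith [hr.2]
        have hsub : Icc (r / 2) P.b ⊆ Icc 0 P.b := Icc_subset_Icc_left (by linarith)
        have c5' := c5.mono hsub
        have c6' := c6.mono hsub
        have cG' := cG.mono hsub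
        have c7 : ContinuousOn (fun y => F.θr t y / y) (Icc (r / 2) P.b) :=
          c5'.div continuousOn_id fun y hy => by
            have := hy.1
            exact (by linarith : (0 : ℝ) < y).ne'
        refine nonneg_of_nonneg_Ioo hrb (by fun_prop) fun y hy => ?_
        linarith [hint y ⟨by linarith [hy.1], hy.2⟩]
      have h1 := hcl r ⟨by linarith, hr.2⟩
      rw [h0, zero_div, mul_zero, add_zero] at h1
      have := mul_nonneg hk.le h2
      linarith
  rw [hG] at hkey
  exact nonneg_of_mul_nonneg_right hkey (hρ r hr)

theorem θ_pos (h0ρ : ∀ r ∈ Icc 0 P.b, 0 < F.ρ 0 r) (h0 : ∀ r ∈ Icc 0 P.b, 0 < F.θ 0 r) :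
    ∀ t ∈ Ico 0 T, ∀ r ∈ Icc 0 P.b, 0 < F.θ t r := by
  intro t ht
  have hρ := F.ρ_pos h0ρ
  rcases ht.1.eq_or_lt with rfl | htpos
  · exact h0
  obtain ⟨δ, hδ, hpos⟩ := eventually_pos_of_continuousOn isCompact_Icc F.θ_cont h0 ⟨htpos, ht.2⟩
  have hsub : Icc δ t ⊆ Ioo 0 T := fun s hs => ⟨hδ.1.trans_le hs.1, hs.2.trans_lt ht.2⟩
  have hsub' : Icc δ t ⊆ Ico 0 T := hsub.trans Ioo_subset_Ico_self
  obtain ⟨K, hK0, hK⟩ := F.exists_gradient_bound hδ.1 ht.2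
  obtain ⟨m, hm, hmlt⟩ := exists_pos_le_of_continuousOn P.b_pos.le
    (slice_continuousOn F.θ_cont (hsub' ⟨le_rfl, hδ.2⟩)) (hpos δ ⟨hδ.1.le, le_rfl⟩)
  -- The first summand is the greatest decay rate allowed by `heat_inequality`; the `1` makes the
  -- comparison strict.
  set k : ℝ := 3 * P.R * K / P.cV + 1 with hk
  have hcV := P.cV_pos
  have := pos_of_first_touch (t₀ := δ) (t₁ := t) (K := Icc 0 P.b) isCompact_Icc
    (g := fun s r => F.θ s r - m * Real.exp (-k * (s - δ))) ?_ ?_ ?_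
  · intro r hr
    have h1 := this t ⟨hδ.2, le_rfl⟩ r hr
    have h2 : 0 < m * Real.exp (-k * (t - δ)) := by positivity
    linarith
  · have := F.θ_cont.mono (prod_mono hsub' (le_refl (Icc 0 P.b)))
    fun_prop
  · intro r hr
    simpa using hmlt r hr
  · intro s hs r hr hz hmin
    have hs' : s ∈ Icc δ t := ⟨hs.1.le, hs.2⟩
    have hval : F.θ s r = m * Real.exp (-k * (s - δ)) := by simpa [sub_eq_zero] using hz
    have hθ : 0 < F.θ s r := by rw [hval]; positivity
    refine ⟨_, ?_, (F.θ_time s (hsub hs') r hr).sub (hasDerivAt_exp_barrier m k δ s)⟩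
    have hmin' : ∀ y ∈ Icc 0 P.b, F.θ s r ≤ F.θ s y := fun y hy => by linarith [hmin y hy]
    have hr0 : F.θr s r = 0 := by
      rcases hr.1.eq_or_lt with h | h
      · rw [← h, F.θr_zero s (hsub hs')]
      rcases hr.2.eq_or_lt with h' | h'
      · rw [h', F.θr_bdry s (hsub hs')]
      · exact deriv_eq_zero_of_isMinOn_Icc ⟨h, h'⟩ hmin' (F.θ_space s (hsub hs') r hr)
    have hrr := second_deriv_nonneg_of_isMinOn_Icc P.b_pos hr hmin' (F.θ_space s (hsub hs')) hr0
      (F.θr_space s (hsub hs') r hr)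
    have h1 := F.heat_inequality (hsub hs') (hK s hs') (hρ s (hsub' hs')) hr hr0 hrr
    rw [hr0, zero_mul, add_zero, abs_of_pos hθ] at h1
    rw [← hval]
    have h2 : P.cV * (k * F.θ s r) = 3 * P.R * K * F.θ s r + P.cV * F.θ s r := by
      rw [hk]; field_simp
    have h3 : 0 < P.cV * (F.θt s r - -k * F.θ s r) := by
      have := mul_pos hcV hθ
      linarith
    exact pos_of_mul_pos_right h3 hcV.le

end RadialFlow

end NSF

/-! ### Balance laws for mass, energy and entropy. -/

namespace NSF

open Filter Topology

theorem eq_initial_of_hasDerivAt_zero {T : ℝ} {f : ℝ → ℝ} (hf : ContinuousOn f (Ico 0 T))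
    (hd : ∀ t ∈ Ioo 0 T, HasDerivAt f 0 t) : ∀ t ∈ Ico 0 T, f t = f 0 := by
  intro t ht
  rcases ht.1.eq_or_lt with rfl | h
  · rfl
  obtain ⟨z, hz, hzeq⟩ := exists_hasDerivAt_eq_slope f (fun _ => 0) h
    (hf.mono fun s hs => ⟨hs.1, hs.2.trans_lt ht.2⟩) fun s hs => hd s ⟨hs.1, hs.2.trans ht.2⟩
  have h2 : t - 0 ≠ 0 := by linarith
  field_simp at hzeq
  linarith

theorem initial_le_of_hasDerivAt_nonneg {T : ℝ} {f f' : ℝ → ℝ} (hf : ContinuousOn f (Ico 0 T))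
    (hd : ∀ t ∈ Ioo 0 T, HasDerivAt f (f' t) t) (h0 : ∀ t ∈ Ioo 0 T, 0 ≤ f' t) :
    ∀ t ∈ Ico 0 T, f 0 ≤ f t := by
  intro t ht
  rcases ht.1.eq_or_lt with rfl | h
  · rfl
  obtain ⟨z, hz, hzeq⟩ := exists_hasDerivAt_eq_slope f f' h
    (hf.mono fun s hs => ⟨hs.1, hs.2.trans_lt ht.2⟩) fun s hs => hd s ⟨hs.1, hs.2.trans ht.2⟩
  have h1 := h0 z ⟨hz.1, hz.2.trans ht.2⟩
  rw [hzeq, sub_zero] at h1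
  by_contra! hlt
  exact absurd (div_neg_of_neg_of_pos (by linarith : f t - f 0 < 0) h) (by linarith)

namespace RadialFlow

variable {P : Params} {T : ℝ} (F : RadialFlow P T) {t r : ℝ}

theorem hasDerivAt_mass (ht : t ∈ Ioo 0 T) :
    HasDerivAt (fun t => ∫ r in (0 : ℝ)..P.b, F.ρ t r * r ^ 2) 0 t := by
  have ht' := Ioo_subset_Ico_self ht
  have cρ := F.ρ_cont
  have cρt := F.ρt_cont
  have c1 := slice_continuousOn F.ρ_cont ht'
  have c2 := slice_continuousOn F.ρt_cont ht
  have c3 := slice_continuousOn F.u_cont ht'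
  have h1 := hasDerivAt_parametric_integral (f := fun t r => F.ρ t r * r ^ 2)
    (ft := fun t r => F.ρt t r * r ^ 2) P.b_pos.le
    (fun t ht r hr => (F.ρ_time t ht r hr).mul_const _)
    (fun t ht => by
      have := slice_continuousOn F.ρ_cont (Ioo_subset_Ico_self ht)
      fun_prop) (by fun_prop) ht
  have h2 : ∫ r in (0 : ℝ)..P.b, F.ρt t r * r ^ 2
      = -(P.b ^ 2 * (F.ρ t P.b * F.u t P.b)) - -(0 ^ 2 * (F.ρ t 0 * F.u t 0)) := by
    refine intervalIntegral.integral_eq_sub_of_hasDerivAt_of_le P.b_pos.le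
      (f := fun r => -(r ^ 2 * (F.ρ t r * F.u t r))) (by fun_prop) (fun r hr => ?_)
      (ContinuousOn.intervalIntegrable_of_Icc P.b_pos.le (by fun_prop))
    refine (((hasDerivAt_pow 2 r).fun_mul
      ((F.ρ_deriv ht hr).fun_mul (F.u_deriv ht hr))).fun_neg).congr_deriv ?_
    have h := F.mass t ht r hr
    have hr0 := hr.1.ne'
    linear_combination (norm := (field_simp; ring)) (-r ^ 2) * h
  rw [h2, F.u_bdry t ht, F.u_zero] at h1
  simpa using h1

theorem integral_mass (hm : ∫ r in (0 : ℝ)..P.b, F.ρ 0 r * r ^ 2 = 1) :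
    ∀ t ∈ Ico 0 T, ∫ r in (0 : ℝ)..P.b, F.ρ t r * r ^ 2 = 1 := by
  intro t ht
  rw [← hm]
  have cρ := F.ρ_cont
  exact eq_initial_of_hasDerivAt_zero (f := fun t => ∫ r in (0 : ℝ)..P.b, F.ρ t r * r ^ 2)
    (continuousOn_parametric_integral P.b_pos.le (by fun_prop))
    (fun t ht => F.hasDerivAt_mass ht) t ht

/-- The total energy. -/
noncomputable def totalEnergy (t : ℝ) : ℝ :=
  ∫ r in (0 : ℝ)..P.b, (1 / 2 * (F.ρ t r * F.u t r ^ 2) + P.cV * (F.ρ t r * F.θ t r)) * r ^ 2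

theorem hasDerivAt_totalEnergy (ht : t ∈ Ioo 0 T) : HasDerivAt F.totalEnergy 0 t := by
  have ht' := Ioo_subset_Ico_self ht
  have sub := prod_mono (Ioo_subset_Ico_self (a := (0 : ℝ)) (b := T)) (le_refl (Icc 0 P.b))
  have cρ := F.ρ_cont.mono sub
  have cu := F.u_cont.mono sub
  have cθ := F.θ_cont.mono sub
  have cρt := F.ρt_cont
  have cut := F.ut_cont
  have cθt := F.θt_cont
  have c1 := slice_continuousOn F.ρ_cont ht'
  have c2 := slice_continuousOn F.ρt_cont ht
  have c3 := slice_continuousOn F.u_cont ht'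
  have c4 := slice_continuousOn F.ut_cont ht
  have c5 := slice_continuousOn F.θ_cont ht'
  have c6 := slice_continuousOn F.θt_cont ht
  have c7 := slice_continuousOn F.ur_cont ht
  have c8 := slice_continuousOn F.θr_cont ht
  have h1 := hasDerivAt_parametric_integral
    (f := fun t r =>
      (1 / 2 * (F.ρ t r * F.u t r ^ 2) + P.cV * (F.ρ t r * F.θ t r)) * r ^ 2)
    (ft := fun t r => (1 / 2 * (F.ρt t r * F.u t r ^ 2 + F.ρ t r * (2 * F.u t r * F.ut t r))
      + P.cV * (F.ρt t r * F.θ t r + F.ρ t r * F.θt t r)) * r ^ 2) P.b_pos.le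
    (fun t ht r hr => by
      have d1 := F.ρ_time t ht r hr
      have d2 := F.u_time t ht r hr
      have d3 := F.θ_time t ht r hr
      have := (((d1.fun_mul (d2.fun_pow 2)).const_mul (1 / 2)).fun_add
        ((d1.fun_mul d3).const_mul P.cV)).mul_const (r ^ 2)
      refine this.congr_deriv ?_
      norm_num)
    (fun t ht => by
      have := slice_continuousOn cρ ht
      have := slice_continuousOn cu ht
      have := slice_continuousOn cθ ht
      fun_prop) (by fun_prop) ht
  -- The energy flux. Its viscous part is `r² u` times the normal stress `2μ u_r + λ (u_r + 2u/r)`,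
  -- so the coefficient of `r u²` is `2λ`. It vanishes at both ends.
  set Φ : ℝ → ℝ := fun r => r ^ 2 * (-(P.cV + P.R) * (F.ρ t r * F.θ t r * F.u t r)
      + P.kappa * F.θr t r - 1 / 2 * (F.ρ t r * F.u t r ^ 3)
      + (2 * P.mu + P.lam) * (F.u t r * F.ur t r))
    + (2 * (2 * P.mu + P.lam) - 4 * P.mu) * (r * F.u t r ^ 2) with hΦ
  have h2 : ∫ r in (0 : ℝ)..P.b, (1 / 2 * (F.ρt t r * F.u t r ^ 2
      + F.ρ t r * (2 * F.u t r * F.ut t r))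
      + P.cV * (F.ρt t r * F.θ t r + F.ρ t r * F.θt t r)) * r ^ 2 = Φ P.b - Φ 0 := by
    refine intervalIntegral.integral_eq_sub_of_hasDerivAt_of_le P.b_pos.le
      (f := Φ) (by fun_prop) (fun r hr => ?_)
      (ContinuousOn.intervalIntegrable_of_Icc P.b_pos.le (by fun_prop))
    have dρ := F.ρ_deriv ht hr
    have du := F.u_deriv ht hr
    have dθ := F.θ_deriv ht hr
    have dθr := F.θr_deriv ht hr
    have dur := F.ur_deriv ht hr
    have d1 := ((((dρ.fun_mul dθ).fun_mul du).const_mul (-(P.cV + P.R))).fun_add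
      (dθr.const_mul P.kappa)).fun_sub ((dρ.fun_mul (du.fun_pow 3)).const_mul (1 / 2))
    have d2 := d1.fun_add ((du.fun_mul dur).const_mul (2 * P.mu + P.lam))
    refine (((hasDerivAt_pow 2 r).fun_mul d2).fun_add
      (((hasDerivAt_id' r).fun_mul (du.fun_pow 2)).const_mul
        (2 * (2 * P.mu + P.lam) - 4 * P.mu))).congr_deriv ?_
    have e1 := F.mass t ht r hr
    have e2 := F.momentum t ht r hr
    have e3 := F.energy t ht r hr
    have hr0 := hr.1.ne'
    -- Multipliers: momentum by `u`, energy by `1`, mass by `-u²/2`, each weighted by `-r²`.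
    linear_combination (norm := (field_simp; ring))
      (-r ^ 2 * F.u t r) * e2 - r ^ 2 * e3 + (r ^ 2 * F.u t r ^ 2 / 2) * e1
  have h3 : Φ P.b - Φ 0 = 0 := by
    simp only [hΦ, F.u_bdry t ht, F.u_zero, F.θr_bdry t ht, F.θr_zero t ht]
    ring
  rw [h2, h3] at h1
  exact h1

theorem totalEnergy_eq : ∀ t ∈ Ico 0 T, F.totalEnergy t = F.totalEnergy 0 := by
  have cρ := F.ρ_cont
  have cu := F.u_cont
  have cθ := F.θ_cont
  exact eq_initial_of_hasDerivAt_zero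
    (continuousOn_parametric_integral P.b_pos.le (by fun_prop))
    fun t ht => F.hasDerivAt_totalEnergy ht

/-- The total entropy. -/
noncomputable def totalEntropy (t : ℝ) : ℝ :=
  ∫ r in (0 : ℝ)..P.b,
    F.ρ t r * (P.cV * Real.log (F.θ t r) - P.R * Real.log (F.ρ t r)) * r ^ 2

/-- The entropy production rate. -/
noncomputable def entropyProduction (t : ℝ) : ℝ :=
  ∫ r in (0 : ℝ)..P.b, (P.kappa * (r * F.θr t r / F.θ t r) ^ 2
    + (2 * P.mu * ((r * F.ur t r) ^ 2 + 2 * F.u t r ^ 2)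
      + P.lam * (r * F.ur t r + 2 * F.u t r) ^ 2) / F.θ t r)

variable (hρ : ∀ t ∈ Ico 0 T, ∀ r ∈ Icc 0 P.b, 0 < F.ρ t r)
  (hθ : ∀ t ∈ Ico 0 T, ∀ r ∈ Icc 0 P.b, 0 < F.θ t r)

include hθ in
theorem continuousOn_entropyProduction : ContinuousOn F.entropyProduction (Ioo 0 T) := by
  have sub := prod_mono (Ioo_subset_Ico_self (a := (0 : ℝ)) (b := T)) (le_refl (Icc 0 P.b))
  have cu := F.u_cont.mono sub
  have cθ := F.θ_cont.mono sub
  have cur := F.ur_cont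
  have cθr := F.θr_cont
  have hne : ∀ x ∈ Ioo 0 T ×ˢ Icc 0 P.b, F.θ x.1 x.2 ≠ 0 := fun x hx =>
    (hθ x.1 (Ioo_subset_Ico_self hx.1) x.2 hx.2).ne'
  exact continuousOn_parametric_integral P.b_pos.le (by fun_prop (disch := assumption))

include hρ hθ in
theorem continuousOn_totalEntropy : ContinuousOn F.totalEntropy (Ico 0 T) := by
  have cρ := F.ρ_cont
  have cθ := F.θ_cont
  have hne : ∀ x ∈ Ico 0 T ×ˢ Icc 0 P.b, F.θ x.1 x.2 ≠ 0 := fun x hx =>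
    (hθ x.1 hx.1 x.2 hx.2).ne'
  have hne' : ∀ x ∈ Ico 0 T ×ˢ Icc 0 P.b, F.ρ x.1 x.2 ≠ 0 := fun x hx =>
    (hρ x.1 hx.1 x.2 hx.2).ne'
  exact continuousOn_parametric_integral P.b_pos.le (by fun_prop (disch := assumption))

include hρ hθ in
theorem hasDerivAt_totalEntropy (ht : t ∈ Ioo 0 T) :
    HasDerivAt F.totalEntropy (F.entropyProduction t) t := by
  have ht' := Ioo_subset_Ico_self ht
  have sub := prod_mono (Ioo_subset_Ico_self (a := (0 : ℝ)) (b := T)) (le_refl (Icc 0 P.b))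
  have cρ := F.ρ_cont.mono sub
  have cθ := F.θ_cont.mono sub
  have cρt := F.ρt_cont
  have cθt := F.θt_cont
  have hne : ∀ x ∈ Ioo 0 T ×ˢ Icc 0 P.b, F.θ x.1 x.2 ≠ 0 := fun x hx =>
    (hθ x.1 (Ioo_subset_Ico_self hx.1) x.2 hx.2).ne'
  have hne' : ∀ x ∈ Ioo 0 T ×ˢ Icc 0 P.b, F.ρ x.1 x.2 ≠ 0 := fun x hx =>
    (hρ x.1 (Ioo_subset_Ico_self hx.1) x.2 hx.2).ne'
  have h1 := hasDerivAt_parametric_integral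
    (f := fun t r => F.ρ t r * (P.cV * Real.log (F.θ t r) - P.R * Real.log (F.ρ t r)) * r ^ 2)
    (ft := fun t r => (F.ρt t r * (P.cV * Real.log (F.θ t r) - P.R * Real.log (F.ρ t r))
      + F.ρ t r * (P.cV * (F.θt t r / F.θ t r) - P.R * (F.ρt t r / F.ρ t r))) * r ^ 2)
    P.b_pos.le
    (fun t ht r hr => by
      have d1 := F.ρ_time t ht r hr
      have d3 := F.θ_time t ht r hr
      exact (d1.fun_mul (((d3.log (hne (t, r) ⟨ht, hr⟩)).const_mul P.cV).fun_sub
        ((d1.log (hne' (t, r) ⟨ht, hr⟩)).const_mul P.R))).mul_const (r ^ 2))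
    (fun t ht => by
      have := slice_continuousOn cρ ht
      have := slice_continuousOn cθ ht
      have : ∀ r ∈ Icc 0 P.b, F.θ t r ≠ 0 := fun r hr => hne (t, r) ⟨ht, hr⟩
      have : ∀ r ∈ Icc 0 P.b, F.ρ t r ≠ 0 := fun r hr => hne' (t, r) ⟨ht, hr⟩
      fun_prop (disch := assumption)) (by fun_prop (disch := assumption)) ht
  have c1 := slice_continuousOn F.ρ_cont ht'
  have c2 := slice_continuousOn F.ρt_cont ht
  have c3 := slice_continuousOn F.u_cont ht'
  have c5 := slice_continuousOn F.θ_cont ht'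
  have c6 := slice_continuousOn F.θt_cont ht
  have c7 := slice_continuousOn F.ur_cont ht
  have c8 := slice_continuousOn F.θr_cont ht
  have n1 : ∀ r ∈ Icc 0 P.b, F.θ t r ≠ 0 := fun r hr => (hθ t ht' r hr).ne'
  have n2 : ∀ r ∈ Icc 0 P.b, F.ρ t r ≠ 0 := fun r hr => (hρ t ht' r hr).ne'
  -- Heat flux divided by the temperature, minus the entropy carried by the flow.
  set Φ : ℝ → ℝ := fun r => r ^ 2 * (P.kappa * (F.θr t r / F.θ t r)
    - F.u t r * (F.ρ t r * (P.cV * Real.log (F.θ t r) - P.R * Real.log (F.ρ t r)))) with hΦ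
  have h2 : (∫ r in (0 : ℝ)..P.b,
      (F.ρt t r * (P.cV * Real.log (F.θ t r) - P.R * Real.log (F.ρ t r))
      + F.ρ t r * (P.cV * (F.θt t r / F.θ t r) - P.R * (F.ρt t r / F.ρ t r))) * r ^ 2)
      - F.entropyProduction t = Φ P.b - Φ 0 := by
    rw [entropyProduction, ← intervalIntegral.integral_sub
      (ContinuousOn.intervalIntegrable_of_Icc P.b_pos.le (by fun_prop (disch := assumption)))
      (ContinuousOn.intervalIntegrable_of_Icc P.b_pos.le (by fun_prop (disch := assumption)))]
    refine intervalIntegral.integral_eq_sub_of_hasDerivAt_of_le P.b_pos.le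
      (f := Φ) (by fun_prop (disch := assumption)) (fun r hr => ?_)
      (ContinuousOn.intervalIntegrable_of_Icc P.b_pos.le (by fun_prop (disch := assumption)))
    have m1 := n1 r (Ioo_subset_Icc_self hr)
    have m2 := n2 r (Ioo_subset_Icc_self hr)
    have dρ := F.ρ_deriv ht hr
    have du := F.u_deriv ht hr
    have dθ := F.θ_deriv ht hr
    have dθr := F.θr_deriv ht hr
    refine ((hasDerivAt_pow 2 r).fun_mul (((dθr.fun_div dθ m1).const_mul P.kappa).fun_sub
      (du.fun_mul (dρ.fun_mul (((dθ.log m1).const_mul P.cV).fun_sub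
        ((dρ.log m2).const_mul P.R)))))).congr_deriv ?_
    have e1 := F.mass t ht r hr
    have e3 := F.energy t ht r hr
    have hr0 := hr.1.ne'
    -- The logarithms enter linearly; as free variables they leave a rational identity.
    generalize Real.log (F.θ t r) = a
    generalize Real.log (F.ρ t r) = c
    linear_combination (norm := (field_simp; ring))
      (-(r ^ 2 / F.θ t r)) * e3 - (r ^ 2 * (P.cV * a - P.R * c - P.cV - P.R)) * e1
  have h3 : Φ P.b - Φ 0 = 0 := by
    simp only [hΦ, F.u_bdry t ht, F.u_zero, F.θr_bdry t ht, F.θr_zero t ht]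
    ring
  rw [h3, sub_eq_zero] at h2
  rw [h2] at h1
  exact h1

end RadialFlow

end NSF

/-! ### A priori bounds from energy and entropy. -/

namespace NSF

open Filter Topology

/-- Bounds for the energy and for the entropy production in terms of a bound of the data. -/
noncomputable def energyBound (P : Params) (A : ℝ) : ℝ := A ^ 2 / 2 + P.cV * A

/-- A bound for the negative part of the initial entropy. -/
noncomputable def initialEntropyBound (P : Params) (A : ℝ) : ℝ := (P.cV + P.R) * Real.log A

/-- A bound for the total entropy production. -/
noncomputable def productionBound (P : Params) (A : ℝ) : ℝ :=
  energyBound P A + P.R * P.b ^ 3 + initialEntropyBound P A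

namespace RadialFlow

/-- The initial profiles are bounded by `A`, bounded away from zero by `A⁻¹` in the case of density
and temperature, and the mass is one. -/
structure DataBound {P : Params} {T : ℝ} (F : RadialFlow P T) (A : ℝ) : Prop where
  one_le : 1 ≤ A
  density : ∀ r ∈ Icc 0 P.b, A⁻¹ ≤ F.ρ 0 r ∧ F.ρ 0 r ≤ A
  temperature : ∀ r ∈ Icc 0 P.b, A⁻¹ ≤ F.θ 0 r ∧ F.θ 0 r ≤ A
  velocity : ∀ r ∈ Icc 0 P.b, |F.u 0 r| ≤ A
  mass_one : ∫ r in (0 : ℝ)..P.b, F.ρ 0 r * r ^ 2 = 1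

variable {P : Params} {T A : ℝ} {F : RadialFlow P T} {t r : ℝ}

theorem DataBound.pos (h : F.DataBound A) : 0 < A := zero_lt_one.trans_le h.one_le

theorem DataBound.ρ_pos (h : F.DataBound A) : ∀ t ∈ Ico 0 T, ∀ r ∈ Icc 0 P.b, 0 < F.ρ t r :=
  F.ρ_pos fun r hr => (inv_pos.2 h.pos).trans_le (h.density r hr).1

theorem DataBound.θ_pos (h : F.DataBound A) : ∀ t ∈ Ico 0 T, ∀ r ∈ Icc 0 P.b, 0 < F.θ t r :=
  F.θ_pos (fun r hr => (inv_pos.2 h.pos).trans_le (h.density r hr).1)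
    fun r hr => (inv_pos.2 h.pos).trans_le (h.temperature r hr).1

theorem DataBound.mass (h : F.DataBound A) (ht : t ∈ Ico 0 T) :
    ∫ r in (0 : ℝ)..P.b, F.ρ t r * r ^ 2 = 1 := F.integral_mass h.mass_one t ht

theorem energyBound_pos (P : Params) (hA : 1 ≤ A) : 0 < energyBound P A := by
  have := P.cV_pos
  unfold energyBound
  positivity

theorem initialEntropyBound_nonneg (P : Params) (hA : 1 ≤ A) : 0 ≤ initialEntropyBound P A :=
  mul_nonneg (add_pos P.cV_pos P.R_pos).le (Real.log_nonneg hA)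

theorem productionBound_pos (P : Params) (hA : 1 ≤ A) : 0 < productionBound P A := by
  have h1 := energyBound_pos P hA
  have h2 := initialEntropyBound_nonneg P hA
  have h3 := P.R_pos
  have h4 := P.b_pos
  unfold productionBound
  positivity

theorem DataBound.totalEnergy_le (h : F.DataBound A) (ht : t ∈ Ico 0 T) :
    F.totalEnergy t ≤ energyBound P A := by
  have h0 : (0 : ℝ) ∈ Ico 0 T := ⟨le_rfl, ht.1.trans_lt ht.2⟩
  rw [F.totalEnergy_eq t ht]
  have c1 := slice_continuousOn F.ρ_cont h0
  have c3 := slice_continuousOn F.u_cont h0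
  have c5 := slice_continuousOn F.θ_cont h0
  calc F.totalEnergy 0 ≤ ∫ r in (0 : ℝ)..P.b, energyBound P A * (F.ρ 0 r * r ^ 2) := by
        refine intervalIntegral.integral_mono_on P.b_pos.le
          (ContinuousOn.intervalIntegrable_of_Icc P.b_pos.le (by fun_prop))
          (ContinuousOn.intervalIntegrable_of_Icc P.b_pos.le (by fun_prop)) fun r hr => ?_
        have hρ := h.ρ_pos 0 h0 r hr
        have hu : F.u 0 r ^ 2 ≤ A ^ 2 := sq_le_sq' (abs_le.1 (h.velocity r hr)).1
          (abs_le.1 (h.velocity r hr)).2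
        have hθ := mul_le_mul_of_nonneg_left (h.temperature r hr).2 P.cV_pos.le
        have : 1 / 2 * F.u 0 r ^ 2 + P.cV * F.θ 0 r ≤ energyBound P A := by
          unfold energyBound; linarith
        calc _ = (1 / 2 * F.u 0 r ^ 2 + P.cV * F.θ 0 r) * (F.ρ 0 r * r ^ 2) := by ring
          _ ≤ _ := mul_le_mul_of_nonneg_right this (by positivity)
    _ = energyBound P A := by
        rw [intervalIntegral.integral_const_mul, h.mass_one, mul_one]

/-- Both summands of the conserved energy are nonnegative because `ρ` and `θ` are positive. -/
theorem DataBound.energy_parts (h : F.DataBound A) (ht : t ∈ Ico 0 T) :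
    (∫ r in (0 : ℝ)..P.b, F.ρ t r * F.u t r ^ 2 * r ^ 2) ≤ 2 * energyBound P A ∧
    P.cV * (∫ r in (0 : ℝ)..P.b, F.ρ t r * F.θ t r * r ^ 2) ≤ energyBound P A := by
  have c1 := slice_continuousOn F.ρ_cont ht
  have c3 := slice_continuousOn F.u_cont ht
  have c5 := slice_continuousOn F.θ_cont ht
  have e : F.totalEnergy t = 1 / 2 * (∫ r in (0 : ℝ)..P.b, F.ρ t r * F.u t r ^ 2 * r ^ 2)
      + P.cV * ∫ r in (0 : ℝ)..P.b, F.ρ t r * F.θ t r * r ^ 2 := by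
    rw [← intervalIntegral.integral_const_mul, ← intervalIntegral.integral_const_mul,
      ← intervalIntegral.integral_add
        (ContinuousOn.intervalIntegrable_of_Icc P.b_pos.le (by fun_prop))
        (ContinuousOn.intervalIntegrable_of_Icc P.b_pos.le (by fun_prop))]
    exact intervalIntegral.integral_congr fun r _ => by ring
  have hle := h.totalEnergy_le ht
  have h1 : 0 ≤ ∫ r in (0 : ℝ)..P.b, F.ρ t r * F.u t r ^ 2 * r ^ 2 :=
    intervalIntegral.integral_nonneg P.b_pos.le fun r hr => by
      have := h.ρ_pos t ht r hr; positivity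
  have h2 : 0 ≤ P.cV * ∫ r in (0 : ℝ)..P.b, F.ρ t r * F.θ t r * r ^ 2 :=
    mul_nonneg P.cV_pos.le <| intervalIntegral.integral_nonneg P.b_pos.le fun r hr => by
      have := h.ρ_pos t ht r hr
      have := h.θ_pos t ht r hr
      positivity
  constructor <;> linarith

theorem DataBound.totalEntropy_ge (h : F.DataBound A) (h0 : (0 : ℝ) ∈ Ico 0 T) :
    -initialEntropyBound P A ≤ F.totalEntropy 0 := by
  have c1 := slice_continuousOn F.ρ_cont h0
  have c5 := slice_continuousOn F.θ_cont h0
  have n1 : ∀ r ∈ Icc 0 P.b, F.θ 0 r ≠ 0 := fun r hr => (h.θ_pos 0 h0 r hr).ne'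
  have n2 : ∀ r ∈ Icc 0 P.b, F.ρ 0 r ≠ 0 := fun r hr => (h.ρ_pos 0 h0 r hr).ne'
  calc -initialEntropyBound P A
        = ∫ r in (0 : ℝ)..P.b, -initialEntropyBound P A * (F.ρ 0 r * r ^ 2) := by
        rw [intervalIntegral.integral_const_mul, h.mass_one, mul_one]
    _ ≤ F.totalEntropy 0 := by
        refine intervalIntegral.integral_mono_on P.b_pos.le
          (ContinuousOn.intervalIntegrable_of_Icc P.b_pos.le (by fun_prop))
          (ContinuousOn.intervalIntegrable_of_Icc P.b_pos.le
            (by fun_prop (disch := assumption))) fun r hr => ?_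
        have hρ := h.ρ_pos 0 h0 r hr
        have l1 : -Real.log A ≤ Real.log (F.θ 0 r) := by
          rw [← Real.log_inv]
          exact Real.log_le_log (inv_pos.2 h.pos) (h.temperature r hr).1
        have l2 : Real.log (F.ρ 0 r) ≤ Real.log A := Real.log_le_log hρ (h.density r hr).2
        have l3 := mul_le_mul_of_nonneg_left l1 P.cV_pos.le
        have l4 := mul_le_mul_of_nonneg_left l2 P.R_pos.le
        have : -initialEntropyBound P A
            ≤ P.cV * Real.log (F.θ 0 r) - P.R * Real.log (F.ρ 0 r) := by
          unfold initialEntropyBound; linarith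
        calc _ ≤ (P.cV * Real.log (F.θ 0 r) - P.R * Real.log (F.ρ 0 r)) * (F.ρ 0 r * r ^ 2) :=
              mul_le_mul_of_nonneg_right this (by positivity)
          _ = _ := by ring

theorem DataBound.entropyProduction_nonneg (h : F.DataBound A) (ht : t ∈ Ioo 0 T) :
    0 ≤ F.entropyProduction t := by
  refine intervalIntegral.integral_nonneg P.b_pos.le fun r hr => ?_
  have h1 := h.θ_pos t (Ioo_subset_Ico_self ht) r hr
  have h2 := dissipation_lower P (r * F.ur t r) (F.u t r)
  have h3 : 0 ≤ 4 / 3 * P.mu * (r * F.ur t r - F.u t r) ^ 2 := by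
    have := P.mu_pos; positivity
  have := P.kappa_pos
  exact add_nonneg (by positivity) (div_nonneg (h3.trans h2) h1.le)

theorem DataBound.initial_le_totalEntropy (h : F.DataBound A) (ht : t ∈ Ico 0 T) :
    -initialEntropyBound P A ≤ F.totalEntropy t :=
  (h.totalEntropy_ge ⟨le_rfl, ht.1.trans_lt ht.2⟩).trans
    (initial_le_of_hasDerivAt_nonneg (F.continuousOn_totalEntropy h.ρ_pos h.θ_pos)
      (fun _ ht => F.hasDerivAt_totalEntropy h.ρ_pos h.θ_pos ht)
      (fun _ ht => h.entropyProduction_nonneg ht) t ht)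

/-- The logarithm of `θ` lies below its tangent at `a`, and `-ρ log ρ ≤ 1`; integrate against unit
mass. The choice `a = 1` bounds the entropy production, while `a` equal to the total temperature
gives Jensen's inequality and the lower bound on that temperature. -/
theorem DataBound.totalEntropy_le (h : F.DataBound A) (ht : t ∈ Ico 0 T) {a : ℝ} (ha : 0 < a) :
    F.totalEntropy t ≤ P.cV * ((∫ r in (0 : ℝ)..P.b, F.ρ t r * F.θ t r * r ^ 2) / a - 1
      + Real.log a) + P.R * P.b ^ 3 := by
  have c1 := slice_continuousOn F.ρ_cont ht
  have c5 := slice_continuousOn F.θ_cont ht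
  have n1 : ∀ r ∈ Icc 0 P.b, F.θ t r ≠ 0 := fun r hr => (h.θ_pos t ht r hr).ne'
  have n2 : ∀ r ∈ Icc 0 P.b, F.ρ t r ≠ 0 := fun r hr => (h.ρ_pos t ht r hr).ne'
  have i1 : IntervalIntegrable (fun r => P.cV / a * (F.ρ t r * F.θ t r * r ^ 2)) volume 0 P.b :=
    ContinuousOn.intervalIntegrable_of_Icc P.b_pos.le (by fun_prop)
  have i2 : IntervalIntegrable (fun r => P.cV * (Real.log a - 1) * (F.ρ t r * r ^ 2))
      volume 0 P.b := ContinuousOn.intervalIntegrable_of_Icc P.b_pos.le (by fun_prop)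
  have i3 : IntervalIntegrable (fun _ => P.R * P.b ^ 2) volume 0 P.b := intervalIntegrable_const
  calc F.totalEntropy t
      ≤ ∫ r in (0 : ℝ)..P.b, (P.cV / a * (F.ρ t r * F.θ t r * r ^ 2)
          + P.cV * (Real.log a - 1) * (F.ρ t r * r ^ 2) + P.R * P.b ^ 2) := by
        refine intervalIntegral.integral_mono_on P.b_pos.le
          (ContinuousOn.intervalIntegrable_of_Icc P.b_pos.le
            (by fun_prop (disch := assumption))) ((i1.add i2).add i3) fun r hr => ?_
        have hρ := h.ρ_pos t ht r hr
        have hθ := h.θ_pos t ht r hr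
        have l1 : Real.log (F.θ t r) ≤ F.θ t r / a - 1 + Real.log a := by
          have := Real.log_le_sub_one_of_pos (div_pos hθ ha)
          rw [Real.log_div hθ.ne' ha.ne'] at this
          linarith
        have l2 : -Real.log (F.ρ t r) * F.ρ t r ≤ 1 := by
          have := Real.log_le_sub_one_of_pos (inv_pos.2 hρ)
          rw [Real.log_inv] at this
          calc _ ≤ ((F.ρ t r)⁻¹ - 1) * F.ρ t r := mul_le_mul_of_nonneg_right this hρ.le
            _ = 1 - F.ρ t r := by field_simp
            _ ≤ 1 := by linarith
        have hr2 : r ^ 2 ≤ P.b ^ 2 := pow_le_pow_left₀ hr.1 hr.2 2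
        have l3 : P.R * (-Real.log (F.ρ t r) * F.ρ t r * r ^ 2) ≤ P.R * P.b ^ 2 := by
          refine mul_le_mul_of_nonneg_left ?_ P.R_pos.le
          calc _ ≤ 1 * r ^ 2 := mul_le_mul_of_nonneg_right l2 (sq_nonneg r)
            _ ≤ _ := by linarith
        have l4 : P.cV * (Real.log (F.θ t r) * (F.ρ t r * r ^ 2))
            ≤ P.cV * ((F.θ t r / a - 1 + Real.log a) * (F.ρ t r * r ^ 2)) :=
          mul_le_mul_of_nonneg_left (mul_le_mul_of_nonneg_right l1 (by positivity)) P.cV_pos.le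
        calc _ = P.cV * (Real.log (F.θ t r) * (F.ρ t r * r ^ 2))
              + P.R * (-Real.log (F.ρ t r) * F.ρ t r * r ^ 2) := by ring
          _ ≤ P.cV * ((F.θ t r / a - 1 + Real.log a) * (F.ρ t r * r ^ 2)) + P.R * P.b ^ 2 :=
              add_le_add l4 l3
          _ = _ := by ring
    _ = _ := by
        rw [intervalIntegral.integral_add (i1.add i2) i3, intervalIntegral.integral_add i1 i2,
          intervalIntegral.integral_const_mul, intervalIntegral.integral_const_mul,
          h.mass ht, intervalIntegral.integral_const, smul_eq_mul]
        ring

/-- The integral is an increment of the entropy, which is bounded below by its initial value and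
above by the energy. The bound does not depend on `t₀` and `t₁`. -/
theorem DataBound.integral_entropyProduction_le (h : F.DataBound A) {t₀ t₁ : ℝ} (h0 : 0 < t₀)
    (h01 : t₀ ≤ t₁) (h1 : t₁ < T) :
    ∫ t in t₀..t₁, F.entropyProduction t ≤ productionBound P A := by
  have hsub : Icc t₀ t₁ ⊆ Ioo 0 T := fun s hs => ⟨h0.trans_le hs.1, hs.2.trans_lt h1⟩
  have e : ∫ t in t₀..t₁, F.entropyProduction t = F.totalEntropy t₁ - F.totalEntropy t₀ :=
    intervalIntegral.integral_eq_sub_of_hasDerivAt_of_le h01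
      ((F.continuousOn_totalEntropy h.ρ_pos h.θ_pos).mono (hsub.trans Ioo_subset_Ico_self))
      (fun t ht => F.hasDerivAt_totalEntropy h.ρ_pos h.θ_pos (hsub (Ioo_subset_Icc_self ht)))
      (ContinuousOn.intervalIntegrable_of_Icc h01
        ((F.continuousOn_entropyProduction h.θ_pos).mono hsub))
  have ht₁ : t₁ ∈ Ico 0 T := ⟨h0.le.trans h01, h1⟩
  have l1 := h.initial_le_totalEntropy (t := t₀) ⟨h0.le, h01.trans_lt h1⟩
  have l2 := h.totalEntropy_le ht₁ one_pos
  have l3 := (h.energy_parts ht₁).2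
  rw [Real.log_one, add_zero, div_one, mul_sub, mul_one] at l2
  rw [e]
  unfold productionBound
  linarith [P.cV_pos]

theorem DataBound.total_temperature_pos (h : F.DataBound A) (ht : t ∈ Ico 0 T) :
    0 < ∫ r in (0 : ℝ)..P.b, F.ρ t r * F.θ t r * r ^ 2 := by
  have c1 := slice_continuousOn F.ρ_cont ht
  have c5 := slice_continuousOn F.θ_cont ht
  refine intervalIntegral.intervalIntegral_pos_of_pos_on
    (ContinuousOn.intervalIntegrable_of_Icc P.b_pos.le (by fun_prop)) (fun r hr => ?_) P.b_pos
  have h1 := h.ρ_pos t ht r (Ioo_subset_Icc_self hr)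
  have h2 := h.θ_pos t ht r (Ioo_subset_Icc_self hr)
  have h3 := hr.1
  positivity

theorem DataBound.total_temperature_lower (h : F.DataBound A) (ht : t ∈ Ico 0 T) :
    Real.exp (-((initialEntropyBound P A + P.R * P.b ^ 3) / P.cV))
      ≤ ∫ r in (0 : ℝ)..P.b, F.ρ t r * F.θ t r * r ^ 2 := by
  have hpos := h.total_temperature_pos ht
  have l1 := h.initial_le_totalEntropy ht
  have l2 := h.totalEntropy_le ht hpos
  -- With `a` the total temperature itself only `c_V log a + R b³` remains above the initial
  -- entropy.
  rw [div_self hpos.ne', sub_self, zero_add] at l2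
  rw [← Real.le_log_iff_exp_le hpos, ← neg_div, div_le_iff₀ P.cV_pos]
  linarith

theorem DataBound.integral_temperature_gradient_le (h : F.DataBound A) (ht : t ∈ Ioo 0 T) :
    ∫ r in (0 : ℝ)..P.b, (r * F.θr t r / F.θ t r) ^ 2 ≤ F.entropyProduction t / P.kappa := by
  have ht' := Ioo_subset_Ico_self ht
  have c5 := slice_continuousOn F.θ_cont ht'
  have c3 := slice_continuousOn F.u_cont ht'
  have c7 := slice_continuousOn F.ur_cont ht
  have c8 := slice_continuousOn F.θr_cont ht
  have n1 : ∀ r ∈ Icc 0 P.b, F.θ t r ≠ 0 := fun r hr => (h.θ_pos t ht' r hr).ne'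
  rw [le_div_iff₀ P.kappa_pos, ← intervalIntegral.integral_mul_const]
  refine intervalIntegral.integral_mono_on P.b_pos.le
    (ContinuousOn.intervalIntegrable_of_Icc P.b_pos.le (by fun_prop (disch := assumption)))
    (ContinuousOn.intervalIntegrable_of_Icc P.b_pos.le (by fun_prop (disch := assumption)))
    fun r hr => ?_
  have h1 := h.θ_pos t ht' r hr
  have h2 := dissipation_lower P (r * F.ur t r) (F.u t r)
  have h3 : 0 ≤ 4 / 3 * P.mu * (r * F.ur t r - F.u t r) ^ 2 := by
    have := P.mu_pos; positivity
  rw [mul_comm]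
  exact le_add_of_nonneg_right (div_nonneg (h3.trans h2) h1.le)

theorem DataBound.integral_deformation_le (h : F.DataBound A) (ht : t ∈ Ioo 0 T) :
    ∫ r in (0 : ℝ)..P.b, (r * F.ur t r - F.u t r) ^ 2 / F.θ t r
      ≤ F.entropyProduction t / (4 / 3 * P.mu) := by
  have ht' := Ioo_subset_Ico_self ht
  have hmu := P.mu_pos
  have hk := P.kappa_pos
  have c5 := slice_continuousOn F.θ_cont ht'
  have c3 := slice_continuousOn F.u_cont ht'
  have c7 := slice_continuousOn F.ur_cont ht
  have c8 := slice_continuousOn F.θr_cont ht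
  have n1 : ∀ r ∈ Icc 0 P.b, F.θ t r ≠ 0 := fun r hr => (h.θ_pos t ht' r hr).ne'
  rw [le_div_iff₀ (by positivity), ← intervalIntegral.integral_mul_const]
  refine intervalIntegral.integral_mono_on P.b_pos.le
    (ContinuousOn.intervalIntegrable_of_Icc P.b_pos.le (by fun_prop (disch := assumption)))
    (ContinuousOn.intervalIntegrable_of_Icc P.b_pos.le (by fun_prop (disch := assumption)))
    fun r hr => ?_
  have h1 := h.θ_pos t ht' r hr
  have h2 := dissipation_lower P (r * F.ur t r) (F.u t r)
  have h3 : (r * F.ur t r - F.u t r) ^ 2 / F.θ t r * (4 / 3 * P.mu)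
      ≤ (2 * P.mu * ((r * F.ur t r) ^ 2 + 2 * F.u t r ^ 2)
        + P.lam * (r * F.ur t r + 2 * F.u t r) ^ 2) / F.θ t r := by
    rw [div_mul_eq_mul_div, mul_comm _ (4 / 3 * P.mu)]
    gcongr
  exact h3.trans (le_add_of_nonneg_left (by positivity))

end RadialFlow

end NSF

/-! ### Pointwise bounds of temperature and velocity away from the center. -/

namespace NSF

open Filter Topology

theorem integral_le_of_subinterval {b p q : ℝ} {f : ℝ → ℝ} (hf : ContinuousOn f (Icc 0 b))
    (h0 : ∀ x ∈ Icc 0 b, 0 ≤ f x) (hp : 0 ≤ p) (hpq : p ≤ q) (hq : q ≤ b) :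
    ∫ x in p..q, f x ≤ ∫ x in (0 : ℝ)..b, f x := by
  refine intervalIntegral.integral_mono_interval hp hpq hq ?_
    (ContinuousOn.intervalIntegrable_of_Icc (hp.trans (hpq.trans hq)) hf)
  filter_upwards [ae_restrict_mem measurableSet_Ioc] with x hx
  exact h0 x (Ioc_subset_Icc_self hx)

/-- A smooth function `η` on `[c/2, c]` which increases from `0` to `1` with flat ends, its first
two derivatives and a common bound. -/
structure Cutoff (c : ℝ) where
  (η w w' : ℝ → ℝ)
  K : ℝ
  K_nonneg : 0 ≤ K
  η_cont : Continuous η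
  w_cont : Continuous w
  w'_cont : Continuous w'
  η_deriv : ∀ r, HasDerivAt η (w r) r
  w_deriv : ∀ r, HasDerivAt w (w' r) r
  η_left : η (c / 2) = 0
  η_right : η c = 1
  w_left : w (c / 2) = 0
  w_right : w c = 0
  bound : ∀ r ∈ Icc (c / 2) c, |η r| ≤ K ∧ |w r| ≤ K ∧ |w' r| ≤ K

theorem exists_cutoff (c : ℝ) (hc : 0 < c) : Nonempty (Cutoff c) := by
  -- The cubic `3x² - 2x³` in `x = (r - c/2) / (c/2)`, with its first two derivatives.
  set k : ℝ := (c / 2) ^ 3 with hk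
  have hk0 : k ≠ 0 := by positivity
  have c1 : Continuous fun r : ℝ => (r - c / 2) ^ 2 * (5 / 2 * c - 2 * r) / k := by fun_prop
  have c2 : Continuous fun r : ℝ => 6 * ((r - c / 2) * (c - r)) / k := by fun_prop
  have c3 : Continuous fun r : ℝ => 6 * (3 / 2 * c - 2 * r) / k := by fun_prop
  obtain ⟨K1, h1⟩ := isCompact_Icc.exists_bound_of_continuousOn
    (s := Icc (c / 2) c) c1.continuousOn
  obtain ⟨K2, h2⟩ := isCompact_Icc.exists_bound_of_continuousOn
    (s := Icc (c / 2) c) c2.continuousOn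
  obtain ⟨K3, h3⟩ := isCompact_Icc.exists_bound_of_continuousOn
    (s := Icc (c / 2) c) c3.continuousOn
  refine ⟨⟨_, _, _, |K1| + |K2| + |K3|, by positivity, c1, c2, c3, fun r => ?_, fun r => ?_, ?_, ?_,
    ?_, ?_, fun r hr => ⟨?_, ?_, ?_⟩⟩⟩
  · have d := (((hasDerivAt_id' r).sub_const (c / 2)).fun_pow 2).fun_mul
      (((hasDerivAt_id' r).const_mul 2).const_sub (5 / 2 * c))
    refine (d.div_const k).congr_deriv ?_
    norm_num
    ring
  · have d := ((((hasDerivAt_id' r).sub_const (c / 2)).fun_mul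
      ((hasDerivAt_id' r).const_sub c)).const_mul 6).div_const k
    refine d.congr_deriv ?_
    ring
  · simp
  · simp only [hk]; field_simp; ring
  · simp
  · simp
  · have := h1 r hr
    rw [Real.norm_eq_abs] at this
    linarith [le_abs_self K1, abs_nonneg K2, abs_nonneg K3]
  · have := h2 r hr
    rw [Real.norm_eq_abs] at this
    linarith [le_abs_self K2, abs_nonneg K1, abs_nonneg K3]
  · have := h3 r hr
    rw [Real.norm_eq_abs] at this
    linarith [le_abs_self K3, abs_nonneg K2, abs_nonneg K1]

namespace RadialFlow

variable {P : Params} {T A c M W : ℝ} {F : RadialFlow P T} {t r : ℝ}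

/-- Density, specific volume and velocity are bounded by `M` for radii at most `c`. -/
def CoreBound (F : RadialFlow P T) (c M : ℝ) : Prop :=
  ∀ t ∈ Ico 0 T, ∀ r ∈ Icc 0 c, F.ρ t r ≤ M ∧ (F.ρ t r)⁻¹ ≤ M ∧ |F.u t r| ≤ M

/-- Where `r ≥ c` and `1/ρ ≤ W`, the weight `ρ r²` of the energy is at least `c² / W`. -/
theorem DataBound.integral_temperature_le (h : F.DataBound A) (hc : 0 < c) (ht : t ∈ Ico 0 T)
    {p q : ℝ} (hp : c ≤ p) (hpq : p ≤ q) (hq : q ≤ P.b)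
    (hW : ∀ r ∈ Icc p q, (F.ρ t r)⁻¹ ≤ W) : ∫ r in p..q, F.θ t r ≤ W * (energyBound P A / (c ^ 2 * P.cV)) := by
  have c1 := slice_continuousOn F.ρ_cont ht
  have c5 := slice_continuousOn F.θ_cont ht
  have hp0 : 0 ≤ p := hc.le.trans hp
  have hsub : Icc p q ⊆ Icc 0 P.b := Icc_subset_Icc hp0 hq
  have c1' := c1.mono hsub
  have c5' := c5.mono hsub
  have hW0 : 0 < W := (inv_pos.2 (h.ρ_pos t ht p ⟨hp0, hpq.trans hq⟩)).trans_le
    (hW p ⟨le_rfl, hpq⟩)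
  have hle : ∫ r in p..q, F.ρ t r * F.θ t r * r ^ 2 ≤ energyBound P A / P.cV := by
    rw [le_div_iff₀ P.cV_pos, mul_comm]
    refine le_trans (mul_le_mul_of_nonneg_left (integral_le_of_subinterval (b := P.b) (by fun_prop)
      (fun x hx => ?_) hp0 hpq hq) P.cV_pos.le) (h.energy_parts ht).2
    have h1 := h.ρ_pos t ht x hx
    have h2 := h.θ_pos t ht x hx
    positivity
  calc ∫ r in p..q, F.θ t r ≤ ∫ r in p..q, W / c ^ 2 * (F.ρ t r * F.θ t r * r ^ 2) := by
        refine intervalIntegral.integral_mono_on hpq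
          (ContinuousOn.intervalIntegrable_of_Icc hpq (by fun_prop))
          (ContinuousOn.intervalIntegrable_of_Icc hpq (by fun_prop)) fun r hr => ?_
        have hρ := h.ρ_pos t ht r (hsub hr)
        have hθ := h.θ_pos t ht r (hsub hr)
        have hcr : c ≤ r := hp.trans hr.1
        have h1 : 1 ≤ W * F.ρ t r := by
          have := mul_le_mul_of_nonneg_right (hW r hr) hρ.le
          rwa [inv_mul_cancel₀ hρ.ne'] at this
        have h2 : 1 ≤ r ^ 2 / c ^ 2 := by
          rw [one_le_div (by positivity)]
          exact pow_le_pow_left₀ hc.le hcr 2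
        calc F.θ t r = 1 * 1 * F.θ t r := by ring
          _ ≤ (W * F.ρ t r) * (r ^ 2 / c ^ 2) * F.θ t r := by gcongr
          _ = _ := by ring
    _ = W / c ^ 2 * ∫ r in p..q, F.ρ t r * F.θ t r * r ^ 2 :=
        intervalIntegral.integral_const_mul _ _
    _ ≤ W / c ^ 2 * (energyBound P A / P.cV) := by gcongr
    _ = _ := by field_simp

/-- The temperature away from the center is controlled by the entropy production and the
specific volume. -/
theorem DataBound.temperature_le (h : F.DataBound A) (hc : 0 < c) (hcb : c ≤ P.b)
    (hM : F.CoreBound c M) (ht : t ∈ Ioo 0 T)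
    (hW : ∀ r ∈ Icc (c / 2) P.b, (F.ρ t r)⁻¹ ≤ W) (hr : r ∈ Icc c P.b) :
    F.θ t r ≤ 16 * M * energyBound P A / (P.cV * c ^ 3)
      + 8 * energyBound P A / (c ^ 4 * P.cV * P.kappa) * (F.entropyProduction t * W) := by
  have ht' := Ioo_subset_Ico_self ht
  have c5 := slice_continuousOn F.θ_cont ht'
  have c8 := slice_continuousOn F.θr_cont ht
  have hc2 : 0 < c / 2 := half_pos hc
  have hsub : Icc (c / 2) c ⊆ Icc 0 P.b := Icc_subset_Icc hc2.le hcb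
  have hM0 : 0 < M := (inv_pos.2 (h.ρ_pos t ht' c ⟨hc.le, hcb⟩)).trans_le
    (hM t ht' c ⟨hc.le, le_rfl⟩).2.1
  have hW0 : 0 < W := (inv_pos.2 (h.ρ_pos t ht' c ⟨hc.le, hcb⟩)).trans_le
    (hW c ⟨by linarith, hcb⟩)
  have hE := energyBound_pos P h.one_le
  have hcV := P.cV_pos
  have hκ := P.kappa_pos
  -- A reference radius in the core: there `1/ρ ≤ M`, so the minimum of `θ` on `[c/2, c]` is at most
  -- a mean controlled by the energy.
  obtain ⟨r', hr', hmin⟩ := isCompact_Icc.exists_isMinOn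
    (nonempty_Icc.2 (by linarith : c / 2 ≤ c)) (c5.mono hsub)
  have hθr' : F.θ t r' ≤ 8 * M * energyBound P A / (P.cV * c ^ 3) := by
    have h1 : ∫ r in (c / 2)..c, F.θ t r' ≤ ∫ r in (c / 2)..c, F.θ t r := by
      refine intervalIntegral.integral_mono_on (by linarith) intervalIntegrable_const
        (ContinuousOn.intervalIntegrable_of_Icc (by linarith) (c5.mono hsub)) fun r hr => hmin hr
    have h2 := h.integral_temperature_le hc2 ht' le_rfl (by linarith : c / 2 ≤ c) hcb
      (W := M) fun r hr => (hM t ht' r ⟨hc2.le.trans hr.1, hr.2⟩).2.1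
    rw [intervalIntegral.integral_const, smul_eq_mul] at h1
    have h3 := h1.trans h2
    calc F.θ t r' = 2 / c * ((c - c / 2) * F.θ t r') := by field_simp; ring
      _ ≤ 2 / c * (M * (energyBound P A / ((c / 2) ^ 2 * P.cV))) := by gcongr
      _ = _ := by field_simp; ring
  have hr'r : r' ≤ r := hr'.2.trans hr.1
  have hIcc : Icc r' r ⊆ Icc 0 P.b := Icc_subset_Icc (hc2.le.trans hr'.1) hr.2
  have hpos : ∀ s ∈ Icc r' r, 0 < s := fun s hs => hc2.trans_le (hr'.1.trans hs.1)
  have hθpos : ∀ s ∈ Icc r' r, 0 < F.θ t s := fun s hs => h.θ_pos t ht' s (hIcc hs)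
  have hne : ∀ s ∈ Icc r' r, s ≠ 0 := fun s hs => (hpos s hs).ne'
  have hθne : ∀ s ∈ Icc r' r, F.θ t s ≠ 0 := fun s hs => (hθpos s hs).ne'
  have c5' := c5.mono hIcc
  have c8' := c8.mono hIcc
  have h2ne : ∀ s ∈ Icc r' r, 2 * s ≠ 0 := fun s hs => by have := hpos s hs; positivity
  have cf : ContinuousOn (fun s => s * F.θr t s / F.θ t s) (Icc r' r) := by
    fun_prop (disch := assumption)
  have cg : ContinuousOn (fun s => √(F.θ t s) / (2 * s)) (Icc r' r) := by
    fun_prop (disch := assumption)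
  -- The derivative of `√θ` is split so that Cauchy–Schwarz gives the entropy production for one
  -- factor and the integral of `θ` for the other.
  have hftc : ∫ s in r'..r, s * F.θr t s / F.θ t s * (√(F.θ t s) / (2 * s))
      = √(F.θ t r) - √(F.θ t r') := by
    refine intervalIntegral.integral_eq_sub_of_hasDerivAt_of_le hr'r
      (f := fun s => √(F.θ t s)) (by fun_prop) (fun s hs => ?_)
      (ContinuousOn.intervalIntegrable_of_Icc hr'r (cf.mul cg))
    have hs' := Ioo_subset_Icc_self hs
    have hsb : s ∈ Ioo 0 P.b := ⟨hpos s hs', hs.2.trans_le hr.2⟩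
    refine ((F.θ_deriv ht hsb).sqrt (hθne s hs')).congr_deriv ?_
    have hq := Real.sq_sqrt (hθpos s hs').le
    have hq0 := Real.sqrt_pos.2 (hθpos s hs')
    have hs0 := hpos s hs'
    have hθ0 := hθpos s hs'
    field_simp
    rw [hq]
  have hcs := integral_mul_sq_le hr'r cf cg
  rw [hftc] at hcs
  have hG := h.integral_temperature_gradient_le ht
  have hV : ∫ s in r'..r, (s * F.θr t s / F.θ t s) ^ 2 ≤ F.entropyProduction t / P.kappa := by
    refine (integral_le_of_subinterval ?_ (fun x _ => sq_nonneg _) (hc2.le.trans hr'.1) hr'r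
      hr.2).trans hG
    have : ∀ s ∈ Icc 0 P.b, F.θ t s ≠ 0 := fun s hs => (h.θ_pos t ht' s hs).ne'
    fun_prop (disch := assumption)
  have hθint := h.integral_temperature_le hc2 ht' hr'.1 hr'r hr.2
    (W := W) fun s hs => hW s ⟨hr'.1.trans hs.1, hs.2.trans hr.2⟩
  have hB : ∫ s in r'..r, (√(F.θ t s) / (2 * s)) ^ 2
      ≤ 1 / c ^ 2 * (W * (energyBound P A / ((c / 2) ^ 2 * P.cV))) := by
    refine le_trans ?_ (mul_le_mul_of_nonneg_left hθint (by positivity))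
    rw [← intervalIntegral.integral_const_mul]
    refine intervalIntegral.integral_mono_on hr'r
      (ContinuousOn.intervalIntegrable_of_Icc hr'r (by fun_prop))
      (ContinuousOn.intervalIntegrable_of_Icc hr'r (by fun_prop)) fun s hs => ?_
    rw [div_pow, Real.sq_sqrt (hθpos s hs).le, one_div, inv_mul_eq_div]
    have h1 := hθpos s hs
    have h2 : c ≤ 2 * s := by linarith [hr'.1, hs.1]
    gcongr
  have hG0 := h.entropyProduction_nonneg ht
  have hsq : (√(F.θ t r) - √(F.θ t r')) ^ 2
      ≤ 4 * energyBound P A / (c ^ 4 * P.cV * P.kappa) * (F.entropyProduction t * W) := by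
    calc _ ≤ _ := hcs
      _ ≤ F.entropyProduction t / P.kappa
          * (1 / c ^ 2 * (W * (energyBound P A / ((c / 2) ^ 2 * P.cV)))) := by
          refine mul_le_mul hV hB ?_ (by positivity)
          exact intervalIntegral.integral_nonneg hr'r fun s _ => sq_nonneg _
      _ = _ := by field_simp; ring
  have hfin : F.θ t r ≤ 2 * F.θ t r' + 2 * (√(F.θ t r) - √(F.θ t r')) ^ 2 := by
    have e1 := Real.sq_sqrt (hθpos r ⟨hr'r, le_rfl⟩).le
    have e2 := Real.sq_sqrt (hθpos r' ⟨le_rfl, hr'r⟩).le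
    -- `2y² + 2(x - y)² - x² = (x - 2y)²`.
    nlinarith [sq_nonneg (√(F.θ t r) - 2 * √(F.θ t r'))]
  calc _ ≤ _ := hfin
    _ ≤ 2 * (8 * M * energyBound P A / (P.cV * c ^ 3))
        + 2 * (4 * energyBound P A / (c ^ 4 * P.cV * P.kappa) * (F.entropyProduction t * W)) := by
        gcongr
    _ = _ := by ring

/-- The velocity away from the center is controlled by the entropy production and the specific
volume. -/
theorem DataBound.velocity_sq_le (h : F.DataBound A) (hc : 0 < c) (ht : t ∈ Ioo 0 T)
    (hW : ∀ r ∈ Icc c P.b, (F.ρ t r)⁻¹ ≤ W) (hr : r ∈ Icc c P.b) :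
    F.u t r ^ 2 ≤ 3 * P.b ^ 2 * energyBound P A / (4 * P.mu * c ^ 6 * P.cV)
      * (F.entropyProduction t * W) := by
  have ht' := Ioo_subset_Ico_self ht
  have hE := energyBound_pos P h.one_le
  have hcV := P.cV_pos
  have hmu := P.mu_pos
  have hb := P.b_pos
  have hr0 : 0 < r := hc.trans_le hr.1
  have hIcc : Icc r P.b ⊆ Icc 0 P.b := Icc_subset_Icc_left hr0.le
  have hpos : ∀ s ∈ Icc r P.b, 0 < s := fun s hs => hr0.trans_le hs.1
  have hθpos : ∀ s ∈ Icc r P.b, 0 < F.θ t s := fun s hs => h.θ_pos t ht' s (hIcc hs)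
  have hne : ∀ s ∈ Icc r P.b, s ≠ 0 := fun s hs => (hpos s hs).ne'
  have hne2 : ∀ s ∈ Icc r P.b, s ^ 2 ≠ 0 := fun s hs => pow_ne_zero 2 (hne s hs)
  have c5 := (slice_continuousOn F.θ_cont ht').mono hIcc
  have c3 := (slice_continuousOn F.u_cont ht').mono hIcc
  have c7 := (slice_continuousOn F.ur_cont ht).mono hIcc
  have hsqne : ∀ s ∈ Icc r P.b, √(F.θ t s) ≠ 0 := fun s hs => (Real.sqrt_pos.2 (hθpos s hs)).ne'
  have cf : ContinuousOn (fun s => (s * F.ur t s - F.u t s) / √(F.θ t s)) (Icc r P.b) := by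
    fun_prop (disch := assumption)
  have cg : ContinuousOn (fun s => √(F.θ t s) / s ^ 2) (Icc r P.b) := by
    fun_prop (disch := assumption)
  -- `(u/s)_s = (s u_s - u) / s²` contains exactly the trace-free deformation controlled by the
  -- entropy production, and `u` vanishes at the outer end.
  have hftc : ∫ s in r..P.b, (s * F.ur t s - F.u t s) / √(F.θ t s) * (√(F.θ t s) / s ^ 2)
      = F.u t P.b / P.b - F.u t r / r := by
    refine intervalIntegral.integral_eq_sub_of_hasDerivAt_of_le hr.2
      (f := fun s => F.u t s / s) (by fun_prop (disch := assumption)) (fun s hs => ?_)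
      (ContinuousOn.intervalIntegrable_of_Icc hr.2 (cf.mul cg))
    have hs' := Ioo_subset_Icc_self hs
    refine ((F.u_deriv ht ⟨hpos s hs', hs.2⟩).fun_div (hasDerivAt_id' s)
      (hne s hs')).congr_deriv ?_
    have := hsqne s hs'
    have := hne s hs'
    field_simp
  rw [F.u_bdry t ht, zero_div, zero_sub] at hftc
  have hcs := integral_mul_sq_le hr.2 cf cg
  rw [hftc, neg_sq] at hcs
  have hD : ∫ s in r..P.b, ((s * F.ur t s - F.u t s) / √(F.θ t s)) ^ 2
      ≤ F.entropyProduction t / (4 / 3 * P.mu) := by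
    have e : ∫ s in r..P.b, ((s * F.ur t s - F.u t s) / √(F.θ t s)) ^ 2
        = ∫ s in r..P.b, (s * F.ur t s - F.u t s) ^ 2 / F.θ t s := by
      refine intervalIntegral.integral_congr fun s hs => ?_
      rw [uIcc_of_le hr.2] at hs
      simp only [div_pow, Real.sq_sqrt (hθpos s hs).le]
    rw [e]
    refine (integral_le_of_subinterval ?_ (fun x hx => ?_) hr0.le hr.2
      le_rfl).trans (h.integral_deformation_le ht)
    · have : ∀ s ∈ Icc 0 P.b, F.θ t s ≠ 0 := fun s hs => (h.θ_pos t ht' s hs).ne'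
      have c5 := slice_continuousOn F.θ_cont ht'
      have c3 := slice_continuousOn F.u_cont ht'
      have c7 := slice_continuousOn F.ur_cont ht
      fun_prop (disch := assumption)
    · have := h.θ_pos t ht' x hx
      positivity
  have hθint := h.integral_temperature_le hc ht' hr.1 hr.2 le_rfl
    (W := W) fun s hs => hW s ⟨hr.1.trans hs.1, hs.2⟩
  have hB : ∫ s in r..P.b, (√(F.θ t s) / s ^ 2) ^ 2
      ≤ 1 / c ^ 4 * (W * (energyBound P A / (c ^ 2 * P.cV))) := by
    refine le_trans ?_ (mul_le_mul_of_nonneg_left hθint (by positivity))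
    rw [← intervalIntegral.integral_const_mul]
    refine intervalIntegral.integral_mono_on hr.2
      (ContinuousOn.intervalIntegrable_of_Icc hr.2 (by fun_prop))
      (ContinuousOn.intervalIntegrable_of_Icc hr.2 (by fun_prop)) fun s hs => ?_
    rw [div_pow, Real.sq_sqrt (hθpos s hs).le, one_div, inv_mul_eq_div, ← pow_mul]
    have h1 := hθpos s hs
    have h2 : c ≤ s := hr.1.trans hs.1
    norm_num
    gcongr
  have hG0 := h.entropyProduction_nonneg ht
  have hkey : (F.u t r / r) ^ 2 ≤ F.entropyProduction t / (4 / 3 * P.mu)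
      * (1 / c ^ 4 * (W * (energyBound P A / (c ^ 2 * P.cV)))) := by
    refine hcs.trans (mul_le_mul hD hB ?_ (by positivity))
    exact intervalIntegral.integral_nonneg hr.2 fun s _ => sq_nonneg _
  calc F.u t r ^ 2 = r ^ 2 * (F.u t r / r) ^ 2 := by field_simp
    _ ≤ P.b ^ 2 * (F.entropyProduction t / (4 / 3 * P.mu)
      * (1 / c ^ 4 * (W * (energyBound P A / (c ^ 2 * P.cV))))) := by
        gcongr
        exact hr.2
    _ = _ := by field_simp

end RadialFlow

end NSF

/-! ### The potential of the momentum and its time derivative. -/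

namespace NSF

open Filter Topology

namespace RadialFlow

variable {P : Params} {T A c M W : ℝ} (F : RadialFlow P T) (χ : Cutoff c) {t r : ℝ}

/-- A potential of the momentum, normalized by a cutoff function near the center. -/
noncomputable def potential (t r : ℝ) : ℝ :=
  (∫ s in (c / 2)..c, χ.η s * (F.ρ t s * F.u t s)) + ∫ s in c..r, F.ρ t s * F.u t s

/-- The lower order terms in the time derivative of the potential. -/
noncomputable def potentialRemainder (t r : ℝ) : ℝ :=
  (∫ s in (c / 2)..c, (χ.w s * (F.ρ t s * F.u t s ^ 2 + P.R * (F.ρ t s * F.θ t s))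
      + (2 * P.mu + P.lam) * (F.u t s * (χ.w' s - 2 * χ.w s / s))
      - 2 * (χ.η s * (F.ρ t s * F.u t s ^ 2 / s))))
    - ∫ s in c..r, 2 * (F.ρ t s * F.u t s ^ 2 / s)

theorem continuousOn_potential (hc : 0 < c) (hcb : c ≤ P.b) :
    ContinuousOn (fun x : ℝ × ℝ => F.potential χ x.1 x.2) (Ico 0 T ×ˢ Icc c P.b) := by
  have hη := χ.η_cont
  have h1 : ContinuousOn (fun t => ∫ s in (c / 2)..c, χ.η s * (F.ρ t s * F.u t s)) (Ico 0 T) := by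
    have cρ := F.ρ_cont.mono (prod_mono (le_refl (Ico 0 T))
      (Icc_subset_Icc (half_pos hc).le hcb))
    have cu := F.u_cont.mono (prod_mono (le_refl (Ico 0 T))
      (Icc_subset_Icc (half_pos hc).le hcb))
    exact continuousOn_parametric_integral (f := fun t s => χ.η s * (F.ρ t s * F.u t s))
      (by linarith) (by fun_prop)
  have h2 : ContinuousOn (fun x : ℝ × ℝ => ∫ s in c..x.2, F.ρ x.1 s * F.u x.1 s)
      (Ico 0 T ×ˢ Icc c P.b) := by
    have cρ := F.ρ_cont.mono (prod_mono (le_refl (Ico 0 T)) (Icc_subset_Icc_left hc.le))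
    have cu := F.u_cont.mono (prod_mono (le_refl (Ico 0 T)) (Icc_subset_Icc_left hc.le))
    exact continuousOn_parametric_primitive (f := fun t s => F.ρ t s * F.u t s) hcb (by fun_prop)
  exact (h1.comp continuousOn_fst fun x hx => hx.1).add h2

theorem potential_space (hc : 0 < c) (ht : t ∈ Ico 0 T) (hr : r ∈ Ioo c P.b) :
    HasDerivAt (F.potential χ t) (F.ρ t r * F.u t r) r := by
  have c1 := slice_continuousOn F.ρ_cont ht
  have c3 := slice_continuousOn F.u_cont ht
  have hcont : ContinuousOn (fun s => F.ρ t s * F.u t s) (Icc 0 P.b) := by fun_prop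
  have hr' : r ∈ Ioo 0 P.b := ⟨hc.trans hr.1, hr.2⟩
  have hnhds : Icc 0 P.b ∈ 𝓝 r := Icc_mem_nhds hr'.1 hr'.2
  refine HasDerivAt.const_add _ (intervalIntegral.integral_hasDerivAt_right
    (ContinuousOn.intervalIntegrable_of_Icc hr.1.le (hcont.mono (Icc_subset_Icc hc.le hr.2.le)))
    ?_ (hcont.continuousAt hnhds))
  exact hcont.stronglyMeasurableAtFilter_nhdsWithin measurableSet_Icc r |>.filter_mono
    (by rw [nhdsWithin_eq_nhds.2 hnhds])

/-- Integrating the momentum equation from `c` alone would leave the stress at `c`, which contains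
the uncontrolled `u_r`. The integral with the cutoff contributes the opposite boundary term because
`η(c) = 1` and `η(c/2) = 0`. The stress that remains under this integral still contains `u_r`; a
second integration by parts moves that derivative to `w`, which vanishes at both ends. The remainder
thus contains no derivative of the solution. -/
theorem potential_time (hc : 0 < c) (hcb : c ≤ P.b) (ht : t ∈ Ioo 0 T) (hr : r ∈ Icc c P.b) :
    HasDerivAt (fun s => F.potential χ s r)
      (-(F.ρ t r * F.u t r ^ 2 + P.R * (F.ρ t r * F.θ t r)
          - (2 * P.mu + P.lam) * (F.ur t r + 2 * F.u t r / r))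
        + F.potentialRemainder χ t r) t := by
  have ht' := Ioo_subset_Ico_self ht
  have hη := χ.η_cont
  have hw := χ.w_cont
  have hw' := χ.w'_cont
  have c2pos := half_pos hc
  have sub := prod_mono (Ioo_subset_Ico_self (a := (0 : ℝ)) (b := T)) (le_refl (Icc 0 P.b))
  have diffs : ∀ p q : ℝ, ∀ φ : ℝ → ℝ, Continuous φ → 0 < p → p ≤ q → q ≤ P.b →
      HasDerivAt (fun t => ∫ s in p..q, φ s * (F.ρ t s * F.u t s))
        (∫ s in p..q, φ s * (F.ρt t s * F.u t s + F.ρ t s * F.ut t s)) t := by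
    intro p q φ hφ hp hpq hq
    have hsub : Icc p q ⊆ Icc 0 P.b := Icc_subset_Icc hp.le hq
    have hsub2 := prod_mono (le_refl (Ioo 0 T)) hsub
    have cρ := (F.ρ_cont.mono sub).mono hsub2
    have cu := (F.u_cont.mono sub).mono hsub2
    have cρt := F.ρt_cont.mono hsub2
    have cut := F.ut_cont.mono hsub2
    refine hasDerivAt_parametric_integral hpq
      (f := fun t s => φ s * (F.ρ t s * F.u t s)) (ft := fun t s =>
        φ s * (F.ρt t s * F.u t s + F.ρ t s * F.ut t s)) (fun t ht s hs => ?_) (fun t ht => ?_)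
      (by fun_prop) ht
    · exact ((F.ρ_time t ht s (hsub hs)).fun_mul (F.u_time t ht s (hsub hs))).const_mul _
    · have := slice_continuousOn cρ ht
      have := slice_continuousOn cu ht
      fun_prop
  have d1 := diffs (c / 2) c χ.η hη c2pos (by linarith) hcb
  have d2 := diffs c r (fun _ => 1) continuous_const hc hr.1 hr.2
  simp only [one_mul] at d2
  have c1 := slice_continuousOn F.ρ_cont ht'
  have c2 := slice_continuousOn F.ρt_cont ht
  have c3 := slice_continuousOn F.u_cont ht'
  have c4 := slice_continuousOn F.ut_cont ht
  have c5 := slice_continuousOn F.θ_cont ht'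
  have c7 := slice_continuousOn F.ur_cont ht
  -- The momentum equation as `(ρu)_t + σ_s + 2ρu²/s = 0`, with `σ` the momentum flux including the
  -- viscous stress.
  have dσ : ∀ s ∈ Ioo 0 P.b, HasDerivAt (fun s => F.ρ t s * F.u t s ^ 2
      + P.R * (F.ρ t s * F.θ t s) - (2 * P.mu + P.lam) * (F.ur t s + 2 * F.u t s / s))
      (-(F.ρt t s * F.u t s + F.ρ t s * F.ut t s) - 2 * (F.ρ t s * F.u t s ^ 2 / s)) s := by
    intro s hs
    have dρ := F.ρ_deriv ht hs
    have du := F.u_deriv ht hs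
    have dθ := F.θ_deriv ht hs
    have dur := F.ur_deriv ht hs
    have hs0 := hs.1.ne'
    refine (((dρ.fun_mul (du.fun_pow 2)).fun_add ((dρ.fun_mul dθ).const_mul P.R)).fun_sub
      ((dur.fun_add ((du.const_mul 2).fun_div (hasDerivAt_id' s) hs0)).const_mul
        (2 * P.mu + P.lam))).congr_deriv ?_
    have e2 := F.momentum t ht s hs
    linear_combination (norm := (field_simp; ring)) e2
  set σ : ℝ → ℝ := fun s => F.ρ t s * F.u t s ^ 2
      + P.R * (F.ρ t s * F.θ t s) - (2 * P.mu + P.lam) * (F.ur t s + 2 * F.u t s / s) with hσ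
  have f2 : (∫ s in c..r, (F.ρt t s * F.u t s + F.ρ t s * F.ut t s))
      + (∫ s in c..r, 2 * (F.ρ t s * F.u t s ^ 2 / s)) = -σ r - -σ c := by
    have hsub : Icc c r ⊆ Icc 0 P.b := Icc_subset_Icc hc.le hr.2
    have hne : ∀ s ∈ Icc c r, s ≠ 0 := fun s hs => (hc.trans_le hs.1).ne'
    have c1 := c1.mono hsub
    have c2 := c2.mono hsub
    have c3 := c3.mono hsub
    have c4 := c4.mono hsub
    have c5 := c5.mono hsub
    have c7 := c7.mono hsub
    rw [← intervalIntegral.integral_add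
      (ContinuousOn.intervalIntegrable_of_Icc hr.1 (by fun_prop (disch := assumption)))
      (ContinuousOn.intervalIntegrable_of_Icc hr.1 (by fun_prop (disch := assumption)))]
    refine intervalIntegral.integral_eq_sub_of_hasDerivAt_of_le hr.1
      (f := fun s => -σ s) (by fun_prop (disch := assumption)) (fun s hs => ?_)
      (ContinuousOn.intervalIntegrable_of_Icc hr.1 (by fun_prop (disch := assumption)))
    exact (dσ s ⟨hc.trans hs.1, hs.2.trans_le hr.2⟩).fun_neg.congr_deriv (by ring)
  have f1 : (∫ s in (c / 2)..c, χ.η s * (F.ρt t s * F.u t s + F.ρ t s * F.ut t s))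
      - (∫ s in (c / 2)..c, (χ.w s * (F.ρ t s * F.u t s ^ 2 + P.R * (F.ρ t s * F.θ t s))
      + (2 * P.mu + P.lam) * (F.u t s * (χ.w' s - 2 * χ.w s / s))
      - 2 * (χ.η s * (F.ρ t s * F.u t s ^ 2 / s))))
      = (-(χ.η c * σ c) - (2 * P.mu + P.lam) * (χ.w c * F.u t c))
        - (-(χ.η (c / 2) * σ (c / 2))
          - (2 * P.mu + P.lam) * (χ.w (c / 2) * F.u t (c / 2))) := by
    have hle : c / 2 ≤ c := by linarith
    have hsub : Icc (c / 2) c ⊆ Icc 0 P.b := Icc_subset_Icc c2pos.le hcb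
    have hne : ∀ s ∈ Icc (c / 2) c, s ≠ 0 := fun s hs => (c2pos.trans_le hs.1).ne'
    have c1 := c1.mono hsub
    have c2 := c2.mono hsub
    have c3 := c3.mono hsub
    have c4 := c4.mono hsub
    have c5 := c5.mono hsub
    have c7 := c7.mono hsub
    rw [← intervalIntegral.integral_sub
      (ContinuousOn.intervalIntegrable_of_Icc hle (by fun_prop (disch := assumption)))
      (ContinuousOn.intervalIntegrable_of_Icc hle (by fun_prop (disch := assumption)))]
    refine intervalIntegral.integral_eq_sub_of_hasDerivAt_of_le hle
      (f := fun s => -(χ.η s * σ s) - (2 * P.mu + P.lam) * (χ.w s * F.u t s))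
      (by fun_prop (disch := assumption)) (fun s hs => ?_)
      (ContinuousOn.intervalIntegrable_of_Icc hle (by fun_prop (disch := assumption)))
    have hsb : s ∈ Ioo 0 P.b := ⟨c2pos.trans hs.1, hs.2.trans_le hcb⟩
    refine (((χ.η_deriv s).fun_mul (dσ s hsb)).fun_neg.fun_sub
      (((χ.w_deriv s).fun_mul (F.u_deriv ht hsb)).const_mul
        (2 * P.mu + P.lam))).congr_deriv ?_
    have hs0 := hsb.1.ne'
    simp only [hσ]
    field_simp
    ring
  rw [χ.η_left, χ.η_right, χ.w_left, χ.w_right] at f1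
  refine (d1.fun_add d2).congr_deriv ?_
  change _ = -σ r + F.potentialRemainder χ t r
  unfold potentialRemainder
  linarith

end RadialFlow

end NSF

/-! ### Bounds for the potential and its remainder. -/

namespace NSF

open Filter Topology

/-- A bound for the potential of the momentum. -/
noncomputable def potentialBound (P : Params) (A c K : ℝ) : ℝ :=
  (K / (c / 2) ^ 2 + 1 / c ^ 2) * (1 + 2 * energyBound P A)

/-- A bound for the lower order terms in the time derivative of the potential. -/
noncomputable def remainderBound (P : Params) (A c M K : ℝ) : ℝ :=
  (K / (c / 2) ^ 2 + 2 * K / (c / 2) ^ 3) * (2 * energyBound P A)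
    + P.R * K / (c / 2) ^ 2 * (energyBound P A / P.cV)
    + (2 * P.mu + P.lam) * (M * (K + 2 * K / (c / 2))) * P.b
    + 2 / c ^ 3 * (2 * energyBound P A)

theorem abs_integral_le_of_subinterval {b p q : ℝ} {f g : ℝ → ℝ} (hg : ContinuousOn g (Icc 0 b))
    (h0 : ∀ x ∈ Icc 0 b, 0 ≤ g x) (hp : 0 ≤ p) (hpq : p ≤ q) (hq : q ≤ b)
    (hfg : ∀ x ∈ Icc p q, |f x| ≤ g x) : |∫ x in p..q, f x| ≤ ∫ x in (0 : ℝ)..b, g x := by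
  refine le_trans ?_ (integral_le_of_subinterval hg h0 hp hpq hq)
  rw [← Real.norm_eq_abs]
  exact intervalIntegral.norm_integral_le_of_norm_le (f := f) hpq
    (Eventually.of_forall fun x hx => hfg x (Ioc_subset_Icc_self hx))
    (ContinuousOn.intervalIntegrable_of_Icc hpq (hg.mono (Icc_subset_Icc hp hq)))

theorem Params.viscosity_pos (P : Params) : 0 < 2 * P.mu + P.lam := by
  have h1 := P.visc_nonneg
  have h2 := P.mu_pos
  linarith

theorem one_le_sq_div {p s : ℝ} (hp : 0 < p) (hs : p ≤ s) : 1 ≤ s ^ 2 / p ^ 2 := by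
  rw [one_le_div (by positivity)]
  exact pow_le_pow_left₀ hp.le hs 2

theorem inv_le_sq_div {p s : ℝ} (hp : 0 < p) (hs : p ≤ s) : s⁻¹ ≤ s ^ 2 / p ^ 3 := by
  have hs0 := hp.trans_le hs
  rw [le_div_iff₀ (by positivity), inv_mul_le_iff₀ hs0, ← pow_succ']
  exact pow_le_pow_left₀ hp.le hs 3

namespace RadialFlow

variable {P : Params} {T A c M W : ℝ} {F : RadialFlow P T} (χ : Cutoff c) {t r : ℝ}

/-- Since `|u| ≤ 1 + u²`, mass and kinetic energy bound `∫ ρ|u| r²`; away from the center the weight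
`r²` is bounded below. -/
theorem DataBound.abs_potential_le (h : F.DataBound A) (hc : 0 < c) (ht : t ∈ Ico 0 T)
    (hr : r ∈ Icc c P.b) : |F.potential χ t r| ≤ potentialBound P A c χ.K := by
  have hK := χ.K_nonneg
  have c2pos := half_pos hc
  have c1 := slice_continuousOn F.ρ_cont ht
  have c3 := slice_continuousOn F.u_cont ht
  have hcb := hr.1.trans hr.2
  have hg : ContinuousOn (fun s => F.ρ t s * (1 + F.u t s ^ 2) * s ^ 2) (Icc 0 P.b) := by fun_prop
  have hg0 : ∀ s ∈ Icc 0 P.b, 0 ≤ F.ρ t s * (1 + F.u t s ^ 2) * s ^ 2 := fun s hs => by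
    have := h.ρ_pos t ht s hs; positivity
  have hint : ∫ s in (0 : ℝ)..P.b, F.ρ t s * (1 + F.u t s ^ 2) * s ^ 2
      ≤ 1 + 2 * energyBound P A := by
    have e : ∫ s in (0 : ℝ)..P.b, F.ρ t s * (1 + F.u t s ^ 2) * s ^ 2
        = (∫ s in (0 : ℝ)..P.b, F.ρ t s * s ^ 2)
          + ∫ s in (0 : ℝ)..P.b, F.ρ t s * F.u t s ^ 2 * s ^ 2 := by
      rw [← intervalIntegral.integral_add
        (ContinuousOn.intervalIntegrable_of_Icc P.b_pos.le (by fun_prop))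
        (ContinuousOn.intervalIntegrable_of_Icc P.b_pos.le (by fun_prop))]
      exact intervalIntegral.integral_congr fun r _ => by ring
    rw [e, h.mass ht]
    linarith [(h.energy_parts ht).1]
  have hu : ∀ v : ℝ, |v| ≤ 1 + v ^ 2 := fun v => by
    nlinarith [sq_nonneg (|v| - 1), sq_abs v, abs_nonneg v]
  have hρu : ∀ p : ℝ, 0 < p → ∀ s ∈ Icc 0 P.b, p ≤ s →
      |F.ρ t s * F.u t s| ≤ 1 / p ^ 2 * (F.ρ t s * (1 + F.u t s ^ 2) * s ^ 2) := by
    intro p hp s hs hps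
    have hρ := h.ρ_pos t ht s hs
    rw [abs_mul, abs_of_pos hρ]
    calc F.ρ t s * |F.u t s| ≤ F.ρ t s * (1 + F.u t s ^ 2) * 1 := by
          rw [mul_one]; exact mul_le_mul_of_nonneg_left (hu _) hρ.le
      _ ≤ F.ρ t s * (1 + F.u t s ^ 2) * (s ^ 2 / p ^ 2) := by
          gcongr; exact one_le_sq_div hp hps
      _ = _ := by ring
  have b1 : |∫ s in (c / 2)..c, χ.η s * (F.ρ t s * F.u t s)|
      ≤ ∫ s in (0 : ℝ)..P.b, χ.K / (c / 2) ^ 2 * (F.ρ t s * (1 + F.u t s ^ 2) * s ^ 2) := by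
    refine abs_integral_le_of_subinterval (by fun_prop) (fun s hs => ?_) c2pos.le
      (by linarith) hcb fun s hs => ?_
    · exact mul_nonneg (by positivity) (hg0 s hs)
    · rw [abs_mul]
      calc _ ≤ χ.K * (1 / (c / 2) ^ 2 * (F.ρ t s * (1 + F.u t s ^ 2) * s ^ 2)) :=
            mul_le_mul (χ.bound s hs).1
              (hρu _ c2pos s ⟨c2pos.le.trans hs.1, hs.2.trans hcb⟩ hs.1) (abs_nonneg _) hK
        _ = _ := by ring
  have b2 : |∫ s in c..r, F.ρ t s * F.u t s|
      ≤ ∫ s in (0 : ℝ)..P.b, 1 / c ^ 2 * (F.ρ t s * (1 + F.u t s ^ 2) * s ^ 2) := by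
    refine abs_integral_le_of_subinterval (by fun_prop) (fun s hs => ?_) hc.le hr.1 hr.2
      fun s hs => ?_
    · exact mul_nonneg (by positivity) (hg0 s hs)
    · exact hρu _ hc s ⟨hc.le.trans hs.1, hs.2.trans hr.2⟩ hs.1
  rw [intervalIntegral.integral_const_mul] at b1 b2
  have b3 := mul_le_mul_of_nonneg_left hint (by positivity : 0 ≤ χ.K / (c / 2) ^ 2)
  have b4 := mul_le_mul_of_nonneg_left hint (by positivity : 0 ≤ 1 / c ^ 2)
  calc |F.potential χ t r| ≤ _ := abs_add_le _ _
    _ ≤ potentialBound P A c χ.K := by unfold potentialBound; linarith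

/-- Every term carrying the density is dominated by an energy density once `1` and `1/s` are
replaced by multiples of `s²`. The viscous term has no factor `ρ`; it lives on `[c/2, c]`, where
`|u| ≤ M`. -/
theorem DataBound.abs_remainder_le (h : F.DataBound A) (hc : 0 < c) (hM : F.CoreBound c M)
    (ht : t ∈ Ico 0 T) (hr : r ∈ Icc c P.b) :
    |F.potentialRemainder χ t r| ≤ remainderBound P A c M χ.K := by
  have hK := χ.K_nonneg
  have c2pos := half_pos hc
  have hν := P.viscosity_pos
  have hR := P.R_pos
  have c1 := slice_continuousOn F.ρ_cont ht
  have c3 := slice_continuousOn F.u_cont ht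
  have c5 := slice_continuousOn F.θ_cont ht
  have hcb := hr.1.trans hr.2
  have hM0 : 0 ≤ M := (abs_nonneg _).trans (hM t ht c ⟨hc.le, le_rfl⟩).2.2
  set k₁ : ℝ := χ.K / (c / 2) ^ 2 + 2 * χ.K / (c / 2) ^ 3 with hk₁
  set k₂ : ℝ := P.R * χ.K / (c / 2) ^ 2 with hk₂
  set k₃ : ℝ := (2 * P.mu + P.lam) * (M * (χ.K + 2 * χ.K / (c / 2))) with hk₃
  have k₁0 : 0 ≤ k₁ := by positivity
  have k₂0 : 0 ≤ k₂ := by positivity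
  have k₃0 : 0 ≤ k₃ := by positivity
  have e1 := (h.energy_parts ht).1
  have e2 : ∫ s in (0 : ℝ)..P.b, F.ρ t s * F.θ t s * s ^ 2 ≤ energyBound P A / P.cV := by
    rw [le_div_iff₀ P.cV_pos, mul_comm]; exact (h.energy_parts ht).2
  have b1 : |∫ s in (c / 2)..c,
      (χ.w s * (F.ρ t s * F.u t s ^ 2 + P.R * (F.ρ t s * F.θ t s))
      + (2 * P.mu + P.lam) * (F.u t s * (χ.w' s - 2 * χ.w s / s))
      - 2 * (χ.η s * (F.ρ t s * F.u t s ^ 2 / s)))|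
      ≤ ∫ s in (0 : ℝ)..P.b, (k₁ * (F.ρ t s * F.u t s ^ 2 * s ^ 2)
        + k₂ * (F.ρ t s * F.θ t s * s ^ 2) + k₃) := by
    refine abs_integral_le_of_subinterval (by fun_prop) (fun s hs => ?_) c2pos.le
      (by linarith) hcb fun s hs => ?_
    · have h1 := h.ρ_pos t ht s hs
      have h2 := h.θ_pos t ht s hs
      positivity
    · have hsb : s ∈ Icc 0 P.b := ⟨c2pos.le.trans hs.1, hs.2.trans hcb⟩
      have hs0 := c2pos.trans_le hs.1
      have hρ := h.ρ_pos t ht s hsb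
      have hθ := h.θ_pos t ht s hsb
      have hu := (hM t ht s ⟨hsb.1, hs.2⟩).2.2
      obtain ⟨hη, hw, hw'⟩ := χ.bound s hs
      have i1 := one_le_sq_div c2pos hs.1
      have i2 := inv_le_sq_div c2pos hs.1
      have i3 : s⁻¹ ≤ (c / 2)⁻¹ := inv_anti₀ c2pos hs.1
      have t1 : |χ.w s * (F.ρ t s * F.u t s ^ 2 + P.R * (F.ρ t s * F.θ t s))|
          ≤ χ.K * (F.ρ t s * F.u t s ^ 2 + P.R * (F.ρ t s * F.θ t s))
            * (s ^ 2 / (c / 2) ^ 2) := by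
        have hx : 0 ≤ F.ρ t s * F.u t s ^ 2 + P.R * (F.ρ t s * F.θ t s) := by positivity
        rw [abs_mul, abs_of_nonneg hx]
        calc _ ≤ χ.K * (F.ρ t s * F.u t s ^ 2 + P.R * (F.ρ t s * F.θ t s)) * 1 := by
              rw [mul_one]; exact mul_le_mul_of_nonneg_right hw hx
          _ ≤ _ := mul_le_mul_of_nonneg_left i1 (by positivity)
      have t2 : |(2 * P.mu + P.lam) * (F.u t s * (χ.w' s - 2 * χ.w s / s))| ≤ k₃ := by
        rw [abs_mul, abs_of_pos hν, abs_mul]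
        refine mul_le_mul_of_nonneg_left (mul_le_mul hu ?_ (abs_nonneg _) hM0) hν.le
        refine (abs_sub _ _).trans (add_le_add hw' ?_)
        rw [abs_div, abs_mul, abs_two, abs_of_pos hs0, div_eq_mul_inv, div_eq_mul_inv]
        gcongr
      have t3 : |2 * (χ.η s * (F.ρ t s * F.u t s ^ 2 / s))|
          ≤ 2 * (χ.K * (F.ρ t s * F.u t s ^ 2 * (s ^ 2 / (c / 2) ^ 3))) := by
        have hx : 0 ≤ F.ρ t s * F.u t s ^ 2 / s := by positivity
        rw [abs_mul, abs_two, abs_mul, abs_of_nonneg hx, div_eq_mul_inv]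
        gcongr
      calc _ ≤ |χ.w s * (F.ρ t s * F.u t s ^ 2 + P.R * (F.ρ t s * F.θ t s))|
            + |(2 * P.mu + P.lam) * (F.u t s * (χ.w' s - 2 * χ.w s / s))|
            + |2 * (χ.η s * (F.ρ t s * F.u t s ^ 2 / s))| :=
            (abs_sub _ _).trans (add_le_add_left (abs_add_le _ _) _)
        _ ≤ _ := add_le_add (add_le_add t1 t2) t3
        _ = _ := by rw [hk₁, hk₂]; ring
  have b2 : |∫ s in c..r, 2 * (F.ρ t s * F.u t s ^ 2 / s)|
      ≤ ∫ s in (0 : ℝ)..P.b, 2 / c ^ 3 * (F.ρ t s * F.u t s ^ 2 * s ^ 2) := by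
    refine abs_integral_le_of_subinterval (by fun_prop) (fun s hs => ?_) hc.le hr.1 hr.2
      fun s hs => ?_
    · have h1 := h.ρ_pos t ht s hs
      positivity
    · have hsb : s ∈ Icc 0 P.b := ⟨hc.le.trans hs.1, hs.2.trans hr.2⟩
      have hs0 := hc.trans_le hs.1
      have hρ := h.ρ_pos t ht s hsb
      have hx : 0 ≤ F.ρ t s * F.u t s ^ 2 := by positivity
      rw [abs_of_nonneg (by positivity), div_eq_mul_inv]
      calc _ ≤ 2 * (F.ρ t s * F.u t s ^ 2 * (s ^ 2 / c ^ 3)) := by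
            gcongr; exact inv_le_sq_div hc hs.1
        _ = _ := by ring
  have i1 : IntervalIntegrable (fun s => k₁ * (F.ρ t s * F.u t s ^ 2 * s ^ 2)) volume 0 P.b :=
    ContinuousOn.intervalIntegrable_of_Icc P.b_pos.le (by fun_prop)
  have i2 : IntervalIntegrable (fun s => k₂ * (F.ρ t s * F.θ t s * s ^ 2)) volume 0 P.b :=
    ContinuousOn.intervalIntegrable_of_Icc P.b_pos.le (by fun_prop)
  rw [intervalIntegral.integral_add (i1.add i2) intervalIntegrable_const,
    intervalIntegral.integral_add i1 i2, intervalIntegral.integral_const_mul,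
    intervalIntegral.integral_const_mul, intervalIntegral.integral_const, smul_eq_mul,
    sub_zero, mul_comm P.b] at b1
  rw [intervalIntegral.integral_const_mul (2 / c ^ 3)] at b2
  have m1 := mul_le_mul_of_nonneg_left e1 k₁0
  have m2 := mul_le_mul_of_nonneg_left e2 k₂0
  have m3 := mul_le_mul_of_nonneg_left e1 (by positivity : 0 ≤ 2 / c ^ 3)
  calc |F.potentialRemainder χ t r| ≤ _ := abs_sub _ _
    _ ≤ k₁ * (2 * energyBound P A) + k₂ * (energyBound P A / P.cV) + k₃ * P.b
        + 2 / c ^ 3 * (2 * energyBound P A) := by linarith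

end RadialFlow

end NSF

/-! ### Barriers for the logarithm of the density. -/

namespace NSF

open Filter Topology

namespace RadialFlow

variable {P : Params} {T A c M W : ℝ} (F : RadialFlow P T) (χ : Cutoff c) {t r : ℝ}

/-- Extends the mass equation by continuity to `r = b`, where an extremum of `effectiveLog` may lie.
-/
theorem mass_closed (ht : t ∈ Ioo 0 T) (hr : r ∈ Ioc 0 P.b) :
    F.ρt t r + (F.ρr t r * F.u t r + F.ρ t r * (F.ur t r + 2 * F.u t r / r)) = 0 := by
  have ht' := Ioo_subset_Ico_self ht
  have hr2 : 0 < r / 2 := half_pos hr.1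
  have hlt : r / 2 < P.b := by linarith [hr.2, hr.1]
  have hsub : Icc (r / 2) P.b ⊆ Icc 0 P.b := Icc_subset_Icc_left hr2.le
  have hne : ∀ s ∈ Icc (r / 2) P.b, s ≠ 0 := fun s hs => (hr2.trans_le hs.1).ne'
  have c1 := (slice_continuousOn F.ρ_cont ht').mono hsub
  have c2 := (slice_continuousOn F.ρt_cont ht).mono hsub
  have c3 := (slice_continuousOn F.u_cont ht').mono hsub
  have c4 := (slice_continuousOn F.ρr_cont ht).mono hsub
  have c7 := (slice_continuousOn F.ur_cont ht).mono hsub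
  have hmem : r ∈ Icc (r / 2) P.b := ⟨by linarith [hr.1], hr.2⟩
  refine le_antisymm (neg_nonneg.1 ?_) ?_
  · refine nonneg_of_nonneg_Ioo hlt (f := fun r => -(F.ρt t r + (F.ρr t r * F.u t r
      + F.ρ t r * (F.ur t r + 2 * F.u t r / r)))) (by fun_prop (disch := assumption))
      (fun s hs => ?_) r hmem
    rw [F.mass t ht s ⟨hr2.trans hs.1, hs.2⟩, neg_zero]
  · refine nonneg_of_nonneg_Ioo hlt (f := fun r => F.ρt t r + (F.ρr t r * F.u t r
      + F.ρ t r * (F.ur t r + 2 * F.u t r / r))) (by fun_prop (disch := assumption))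
      (fun s hs => ?_) r hmem
    rw [F.mass t ht s ⟨hr2.trans hs.1, hs.2⟩]

/-- The sum of the logarithm of the density and the potential of the momentum. -/
noncomputable def effectiveLog (t r : ℝ) : ℝ :=
  (2 * P.mu + P.lam) * Real.log (F.ρ t r) + F.potential χ t r

variable {F}

theorem DataBound.continuousOn_effectiveLog (h : F.DataBound A) (hc : 0 < c) (hcb : c ≤ P.b) :
    ContinuousOn (fun x : ℝ × ℝ => F.effectiveLog χ x.1 x.2) (Ico 0 T ×ˢ Icc c P.b) := by
  have hsub : Icc c P.b ⊆ Icc 0 P.b := Icc_subset_Icc_left hc.le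
  have cρ := F.ρ_cont.mono (prod_mono (le_refl (Ico 0 T)) hsub)
  have cp := F.continuousOn_potential χ hc hcb
  have hne : ∀ x ∈ Ico 0 T ×ˢ Icc c P.b, F.ρ x.1 x.2 ≠ 0 := fun x hx =>
    (h.ρ_pos x.1 hx.1 x.2 (hsub hx.2)).ne'
  exact ((cρ.log hne).const_mul _).add cp

/-- At a spatial extremum the time derivative of the effective logarithm is given by the pressure
up to lower order terms. -/
theorem DataBound.effectiveLog_time (h : F.DataBound A) (hc : 0 < c) (hcb : c ≤ P.b)
    (ht : t ∈ Ioo 0 T) (hr : r ∈ Ioc c P.b)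
    (hext : IsExtrOn (F.effectiveLog χ t) (Icc c P.b) r) :
    HasDerivAt (fun s => F.effectiveLog χ s r)
      (-(P.R * (F.ρ t r * F.θ t r)) + F.potentialRemainder χ t r) t := by
  have ht' := Ioo_subset_Ico_self ht
  have hr0 : 0 < r := hc.trans hr.1
  have hρ := h.ρ_pos t ht' r ⟨hr0.le, hr.2⟩
  refine ((((F.ρ_time t ht r ⟨hr0.le, hr.2⟩).log hρ.ne').const_mul
    (2 * P.mu + P.lam)).fun_add
    (F.potential_time χ hc hcb ht ⟨hr.1.le, hr.2⟩)).congr_deriv ?_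
  have hm := F.mass_closed ht ⟨hr0, hr.2⟩
  -- The convective term: at `r = b` the velocity vanishes, at an interior extremum the spatial
  -- derivative does.
  have hz : ((2 * P.mu + P.lam) * (F.ρr t r / F.ρ t r) + F.ρ t r * F.u t r) * F.u t r = 0 := by
    rcases hr.2.eq_or_lt with hb | hb
    · rw [hb, F.u_bdry t ht, mul_zero]
    · have d : HasDerivAt (F.effectiveLog χ t)
          ((2 * P.mu + P.lam) * (F.ρr t r / F.ρ t r) + F.ρ t r * F.u t r) r :=
        (((F.ρ_deriv ht ⟨hr0, hb⟩).log hρ.ne').const_mul _).fun_add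
          (F.potential_space χ hc ht' ⟨hr.1, hb⟩)
      rw [(hext.isLocalExtr (Icc_mem_nhds hr.1 hb)).hasDerivAt_eq_zero d, zero_mul]
  linear_combination (norm := (field_simp; ring)) (2 * P.mu + P.lam) / F.ρ t r * hm - hz

/-- The initial value of the barriers. -/
noncomputable def barrierStart (P : Params) (A c M K : ℝ) : ℝ :=
  (2 * P.mu + P.lam) * Real.log (2 * A + M) + potentialBound P A c K + 1

theorem DataBound.core_abs_log_le (h : F.DataBound A) (hM : F.CoreBound c M) (hcb : c ≤ P.b)
    (ht : t ∈ Ico 0 T) (hr : r ∈ Icc 0 c) : |Real.log (F.ρ t r)| ≤ Real.log (2 * A + M) := by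
  have hρ := h.ρ_pos t ht r ⟨hr.1, hr.2.trans hcb⟩
  obtain ⟨h1, h2, _⟩ := hM t ht r hr
  have hA := h.pos
  rw [abs_le, neg_le, ← Real.log_inv]
  exact ⟨Real.log_le_log (inv_pos.2 hρ) (by linarith), Real.log_le_log hρ (by linarith)⟩

theorem abs_le_of_abs_log {ν x p q : ℝ} (hν : 0 < ν) (hx : |x| ≤ q) (hp : |p| ≤ r) :
    |ν * x + p| ≤ ν * q + r := by
  refine (abs_add_le _ _).trans (add_le_add ?_ hp)
  rw [abs_mul, abs_of_pos hν]
  gcongr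

/-- At a first contact the function has a spatial maximum, where the pressure only lowers it, so it
grows at most at the rate of the remainder bound; the extra `1` in the slope gives strictness. -/
theorem DataBound.effectiveLog_lt_barrier (h : F.DataBound A) (hc : 0 < c) (hcb : c ≤ P.b)
    (hM : F.CoreBound c M) {t₀ t₁ : ℝ} (h0 : 0 < t₀) (h01 : t₀ ≤ t₁)
    (h1 : t₁ < T)
    (hstart : ∀ r ∈ Icc 0 P.b, |Real.log (F.ρ t₀ r)| ≤ Real.log (2 * A + M)) :
    ∀ t ∈ Icc t₀ t₁, ∀ r ∈ Icc c P.b, F.effectiveLog χ t r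
      < barrierStart P A c M χ.K + (remainderBound P A c M χ.K + 1) * (t - t₀) := by
  have hsub : Icc t₀ t₁ ⊆ Ioo 0 T := fun s hs => ⟨h0.trans_le hs.1, hs.2.trans_lt h1⟩
  have hsub' : Icc t₀ t₁ ⊆ Ico 0 T := hsub.trans Ioo_subset_Ico_self
  have hν := P.viscosity_pos
  have cL := (h.continuousOn_effectiveLog χ hc hcb).mono
    (prod_mono hsub' (le_refl (Icc c P.b)))
  have hbelow : ∀ t ∈ Icc t₀ t₁, ∀ r ∈ Icc c P.b, |Real.log (F.ρ t r)| ≤ Real.log (2 * A + M) →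
      F.effectiveLog χ t r < barrierStart P A c M χ.K := by
    intro t ht r hr hlog
    have := (abs_le.1 (abs_le_of_abs_log hν hlog (h.abs_potential_le χ hc (hsub' ht) hr))).2
    unfold effectiveLog barrierStart
    linarith
  have := pos_of_first_touch (t₀ := t₀) (t₁ := t₁) (K := Icc c P.b) isCompact_Icc
    (g := fun s r => barrierStart P A c M χ.K + (remainderBound P A c M χ.K + 1) * (s - t₀)
      - F.effectiveLog χ s r) (by fun_prop) ?_ ?_
  · intro t ht r hr
    linarith [this t ht r hr]
  · intro r hr
    have := hbelow t₀ ⟨le_rfl, h01⟩ r hr (hstart r ⟨hc.le.trans hr.1, hr.2⟩)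
    simp only [sub_self, mul_zero, add_zero]
    linarith
  · intro t ht r hr hz hmin
    have ht' : t ∈ Icc t₀ t₁ := ⟨ht.1.le, ht.2⟩
    have hB := h.abs_remainder_le χ hc hM (hsub' ht') hr
    have hB0 := (abs_nonneg _).trans hB
    -- At the inner end the core bound alone keeps the function below the barrier, so contact takes
    -- place in `(c, b]`.
    have hrc : r ≠ c := by
      rintro rfl
      have h2 := hbelow t ht' r hr (h.core_abs_log_le hM hcb (hsub' ht') ⟨hc.le, le_rfl⟩)
      have h3 : 0 ≤ (remainderBound P A r M χ.K + 1) * (t - t₀) :=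
        mul_nonneg (by linarith) (by linarith [ht.1])
      linarith
    have hd := h.effectiveLog_time χ hc hcb (hsub ht') ⟨lt_of_le_of_ne hr.1 hrc.symm, hr.2⟩
      (Or.inr fun y hy => by
        have := hmin y hy
        simp only [mem_ofPred_eq]
        linarith)
    have hφ : HasDerivAt (fun s => barrierStart P A c M χ.K
        + (remainderBound P A c M χ.K + 1) * (s - t₀)) (remainderBound P A c M χ.K + 1) t :=
      ((((hasDerivAt_id' t).sub_const t₀).const_mul _).const_add _).congr_deriv (by ring)
    refine ⟨_, ?_, hφ.fun_sub hd⟩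
    have hr0 : 0 ≤ r := hc.le.trans hr.1
    have hp : 0 < P.R * (F.ρ t r * F.θ t r) := mul_pos P.R_pos (mul_pos
      (h.ρ_pos t (hsub' ht') r ⟨hr0, hr.2⟩) (h.θ_pos t (hsub' ht') r ⟨hr0, hr.2⟩))
    linarith [le_abs_self (F.potentialRemainder χ t r)]

/-- The growth rate of the barrier for the specific volume. -/
noncomputable def pressureBound (P : Params) (A c M K : ℝ) : ℝ :=
  P.R * Real.exp (potentialBound P A c K / (2 * P.mu + P.lam))
    * (16 * M * energyBound P A / (P.cV * c ^ 3)
      + 8 * energyBound P A / (c ^ 4 * P.cV * P.kappa)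
        * (M + Real.exp (potentialBound P A c K / (2 * P.mu + P.lam))))

/-- At a point where the effective logarithm touches a negative lower barrier, the pressure is
controlled by the entropy production. -/
theorem DataBound.pressure_le (h : F.DataBound A) (hc : 0 < c) (hcb : c ≤ P.b)
    (hM : F.CoreBound c M) (ht : t ∈ Ioo 0 T) (hr : r ∈ Icc c P.b) {φ : ℝ} (hφ : 0 ≤ φ)
    (htouch : F.effectiveLog χ t r = -φ)
    (hge : ∀ y ∈ Icc c P.b, -φ ≤ F.effectiveLog χ t y) :
    P.R * (F.ρ t r * F.θ t r) ≤ pressureBound P A c M χ.K * (1 + F.entropyProduction t) := by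
  have ht' := Ioo_subset_Ico_self ht
  have hν := P.viscosity_pos
  have hR := P.R_pos
  have hcV := P.cV_pos
  have hκ := P.kappa_pos
  have hE := energyBound_pos P h.one_le
  have hG := h.entropyProduction_nonneg ht
  have hM0 : 0 ≤ M := (abs_nonneg _).trans (hM t ht' c ⟨hc.le, le_rfl⟩).2.2
  set q := potentialBound P A c χ.K with hq
  set ν := 2 * P.mu + P.lam with hνdef
  set k := Real.exp (q / ν) with hk
  set z := Real.exp (φ / ν) with hz
  have hk0 : 0 < k := Real.exp_pos _
  have hz1 : 1 ≤ z := Real.one_le_exp (by positivity)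
  have hz0 : 0 < z := by linarith
  have hpos : ∀ y ∈ Icc c P.b, 0 < F.ρ t y := fun y hy =>
    h.ρ_pos t ht' y ⟨hc.le.trans hy.1, hy.2⟩
  have hpot : ∀ y ∈ Icc c P.b, |F.potential χ t y| ≤ q := fun y hy =>
    h.abs_potential_le χ hc ht' hy
  -- Minimality gives `1/ρ ≤ k z` on all of `[c, b]`, and the contact itself gives `ρ ≤ k / z` at
  -- `r`. The temperature bound is linear in the specific volume, so the growing factor `z` cancels
  -- in `ρ θ`; the term with `M` uses `z ≥ 1`.
  have hvol : ∀ y ∈ Icc c P.b, (F.ρ t y)⁻¹ ≤ k * z := by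
    intro y hy
    have h1 := hge y hy
    unfold effectiveLog at h1
    have h2 : Real.log (F.ρ t y)⁻¹ ≤ q / ν + φ / ν := by
      rw [Real.log_inv, ← add_div, le_div_iff₀ hν]
      linarith [(abs_le.1 (hpot y hy)).2]
    rw [hk, hz, ← Real.exp_add]
    exact (Real.log_le_iff_le_exp (inv_pos.2 (hpos y hy))).1 h2
  have hdens : F.ρ t r ≤ k * z⁻¹ := by
    unfold effectiveLog at htouch
    have h2 : Real.log (F.ρ t r) ≤ q / ν + -(φ / ν) := by
      rw [← sub_eq_add_neg, ← sub_div, le_div_iff₀ hν]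
      linarith [(abs_le.1 (hpot r hr)).1]
    rw [hk, hz, ← Real.exp_neg, ← Real.exp_add]
    exact (Real.log_le_iff_le_exp (hpos r hr)).1 h2
  have hW : ∀ y ∈ Icc (c / 2) P.b, (F.ρ t y)⁻¹ ≤ M + k * z := by
    intro y hy
    rcases le_total y c with hyc | hyc
    · have := (hM t ht' y ⟨(half_pos hc).le.trans hy.1, hyc⟩).2.1
      have : 0 ≤ k * z := by positivity
      linarith
    · linarith [hvol y ⟨hyc, hy.2⟩]
  have hθ := h.temperature_le hc hcb hM ht hW hr
  set C₃ := 16 * M * energyBound P A / (P.cV * c ^ 3) with hC₃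
  set C₄ := 8 * energyBound P A / (c ^ 4 * P.cV * P.kappa) with hC₄
  have hC₃0 : 0 ≤ C₃ := by positivity
  have hC₄0 : 0 ≤ C₄ := by positivity
  have hzi : z⁻¹ ≤ 1 := inv_le_one_of_one_le₀ hz1
  have hzi0 : 0 < z⁻¹ := inv_pos.2 hz0
  have hθ0 := h.θ_pos t ht' r ⟨hc.le.trans hr.1, hr.2⟩
  calc P.R * (F.ρ t r * F.θ t r)
      ≤ P.R * ((k * z⁻¹) * (C₃ + C₄ * (F.entropyProduction t * (M + k * z)))) := by gcongr
    _ = P.R * k * (C₃ * z⁻¹ + C₄ * (F.entropyProduction t * (M * z⁻¹ + k))) := by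
        field_simp
    _ ≤ P.R * k * (C₃ * 1 + C₄ * (F.entropyProduction t * (M * 1 + k))) := by gcongr
    _ ≤ P.R * k * (C₃ * (1 + F.entropyProduction t)
          + C₄ * ((1 + F.entropyProduction t) * (M + k))) := by
        rw [mul_one M]
        gcongr <;> linarith
    _ = _ := by unfold pressureBound; ring

/-- The barrier descends at the rate at which pressure and remainder can push the minimum down by
`pressure_le`, plus `1`. That rate is affine in the entropy production, so the barrier stays bounded
on a finite time interval. -/
theorem DataBound.effectiveLog_gt_barrier (h : F.DataBound A) (hc : 0 < c) (hcb : c ≤ P.b)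
    (hM : F.CoreBound c M) {t₀ t₁ : ℝ} (h0 : 0 < t₀) (h01 : t₀ ≤ t₁)
    (h1 : t₁ < T)
    (hstart : ∀ r ∈ Icc 0 P.b, |Real.log (F.ρ t₀ r)| ≤ Real.log (2 * A + M)) :
    ∀ t ∈ Icc t₀ t₁, ∀ r ∈ Icc c P.b, -(barrierStart P A c M χ.K
      + ∫ s in t₀..t, (pressureBound P A c M χ.K * (1 + F.entropyProduction s)
        + remainderBound P A c M χ.K + 1)) < F.effectiveLog χ t r := by
  have hsub : Icc t₀ t₁ ⊆ Ioo 0 T := fun s hs => ⟨h0.trans_le hs.1, hs.2.trans_lt h1⟩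
  have hsub' : Icc t₀ t₁ ⊆ Ico 0 T := hsub.trans Ioo_subset_Ico_self
  have hν := P.viscosity_pos
  have cL := (h.continuousOn_effectiveLog χ hc hcb).mono
    (prod_mono hsub' (le_refl (Icc c P.b)))
  have cG := F.continuousOn_entropyProduction h.θ_pos
  set ψ : ℝ → ℝ := fun s => pressureBound P A c M χ.K * (1 + F.entropyProduction s)
    + remainderBound P A c M χ.K + 1 with hψ
  have cψ : ContinuousOn ψ (Ioo 0 T) := by fun_prop
  have hM0 : 0 ≤ M := (abs_nonneg _).trans (hM t₀ (hsub' ⟨le_rfl, h01⟩) c ⟨hc.le, le_rfl⟩).2.2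
  have hp0 : 0 ≤ pressureBound P A c M χ.K := by
    have := energyBound_pos P h.one_le
    have := P.cV_pos
    have := P.R_pos
    have := P.kappa_pos
    unfold pressureBound
    positivity
  have hB0 : 0 ≤ remainderBound P A c M χ.K := (abs_nonneg _).trans
    (h.abs_remainder_le χ hc hM (hsub' ⟨le_rfl, h01⟩) ⟨le_rfl, hcb⟩)
  have hψ0 : ∀ s ∈ Ioo 0 T, 0 ≤ ψ s := fun s hs => by
    have := h.entropyProduction_nonneg hs
    simp only [hψ]
    positivity
  have hφt : ∀ t ∈ Icc t₀ t₁, HasDerivAt (fun t => ∫ s in t₀..t, ψ s) (ψ t) t := by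
    intro t ht
    have hnhds : Ioo 0 T ∈ 𝓝 t := Ioo_mem_nhds (hsub ht).1 (hsub ht).2
    refine intervalIntegral.integral_hasDerivAt_right
      (ContinuousOn.intervalIntegrable_of_Icc ht.1 (cψ.mono fun s hs =>
        hsub ⟨hs.1, hs.2.trans ht.2⟩)) ?_ (cψ.continuousAt hnhds)
    exact cψ.stronglyMeasurableAtFilter isOpen_Ioo t (hsub ht)
  have hint0 : ∀ t ∈ Icc t₀ t₁, 0 ≤ ∫ s in t₀..t, ψ s := fun t ht =>
    intervalIntegral.integral_nonneg ht.1 fun s hs => hψ0 s (hsub ⟨hs.1, hs.2.trans ht.2⟩)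
  have hstart0 : 1 ≤ barrierStart P A c M χ.K := by
    have h2 := (abs_nonneg _).trans (hstart 0 ⟨le_rfl, P.b_pos.le⟩)
    have h3 := (abs_nonneg _).trans (h.abs_potential_le χ hc (hsub' ⟨le_rfl, h01⟩) ⟨le_rfl, hcb⟩)
    have := mul_nonneg hν.le h2
    unfold barrierStart
    linarith
  have habove : ∀ t ∈ Icc t₀ t₁, ∀ r ∈ Icc c P.b, |Real.log (F.ρ t r)| ≤ Real.log (2 * A + M) →
      -barrierStart P A c M χ.K < F.effectiveLog χ t r := by
    intro t ht r hr hlog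
    have := (abs_le.1 (abs_le_of_abs_log hν hlog (h.abs_potential_le χ hc (hsub' ht) hr))).1
    unfold effectiveLog barrierStart
    linarith
  have cφ : ContinuousOn (fun t => ∫ s in t₀..t, ψ s) (Icc t₀ t₁) := fun t ht =>
    (hφt t ht).continuousAt.continuousWithinAt
  have cφ2 : ContinuousOn (fun x : ℝ × ℝ => ∫ s in t₀..x.1, ψ s) (Icc t₀ t₁ ×ˢ Icc c P.b) :=
    cφ.comp continuousOn_fst fun x hx => hx.1
  have := pos_of_first_touch (t₀ := t₀) (t₁ := t₁) (K := Icc c P.b) isCompact_Icc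
    (g := fun s r => (barrierStart P A c M χ.K + ∫ τ in t₀..s, ψ τ) + F.effectiveLog χ s r)
    (by fun_prop) ?_ ?_
  · intro t ht r hr
    linarith [this t ht r hr]
  · intro r hr
    have := habove t₀ ⟨le_rfl, h01⟩ r hr (hstart r ⟨hc.le.trans hr.1, hr.2⟩)
    simp only [intervalIntegral.integral_same, add_zero]
    linarith
  · intro t ht r hr hz hmin
    have ht' : t ∈ Icc t₀ t₁ := ⟨ht.1.le, ht.2⟩
    have hB := h.abs_remainder_le χ hc hM (hsub' ht') hr
    have hrc : r ≠ c := by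
      rintro rfl
      have h2 := habove t ht' r hr (h.core_abs_log_le hM hcb (hsub' ht') ⟨hc.le, le_rfl⟩)
      linarith [hint0 t ht']
    have hd := h.effectiveLog_time χ hc hcb (hsub ht') ⟨lt_of_le_of_ne hr.1 hrc.symm, hr.2⟩
      (Or.inl fun y hy => by
        have := hmin y hy
        simp only [mem_ofPred_eq]
        linarith)
    refine ⟨_, ?_, ((hφt t ht').const_add _).fun_add hd⟩
    have hp := h.pressure_le χ hc hcb hM (hsub ht') hr
      (φ := barrierStart P A c M χ.K + ∫ τ in t₀..t, ψ τ) (by linarith [hint0 t ht'])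
      (by linarith) (fun y hy => by linarith [hmin y hy])
    simp only [hψ]
    linarith [neg_abs_le (F.potentialRemainder χ t r)]

/-- A bound for the logarithm of the density. -/
noncomputable def logDensityBound (P : Params) (A c M K T : ℝ) : ℝ :=
  (barrierStart P A c M K + potentialBound P A c K
    + (pressureBound P A c M K + remainderBound P A c M K + 1) * T
    + pressureBound P A c M K * productionBound P A) / (2 * P.mu + P.lam)
    + Real.log (2 * A + M)

/-- The two barriers, with the potential subtracted, control `log ρ` for `r ≥ c`, and the core bound
does so for `r ≤ c`. The estimate therefore holds on the whole ball. -/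
theorem DataBound.abs_log_density_le (h : F.DataBound A) (hc : 0 < c) (hcb : c ≤ P.b)
    (hM : F.CoreBound c M) (ht : t ∈ Ico 0 T) (hr : r ∈ Icc 0 P.b) :
    |Real.log (F.ρ t r)| ≤ logDensityBound P A c M χ.K T := by
  have hT : 0 < T := ht.1.trans_lt ht.2
  have h00 : (0 : ℝ) ∈ Ico 0 T := ⟨le_rfl, hT⟩
  have hA := h.pos
  have hν := P.viscosity_pos
  have hM0 : 0 ≤ M := (abs_nonneg _).trans (hM 0 h00 c ⟨hc.le, le_rfl⟩).2.2
  have hp0 : 0 ≤ pressureBound P A c M χ.K := by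
    have := energyBound_pos P h.one_le
    have := P.cV_pos
    have := P.R_pos
    have := P.kappa_pos
    unfold pressureBound
    positivity
  have hB0 : 0 ≤ remainderBound P A c M χ.K := (abs_nonneg _).trans
    (h.abs_remainder_le χ hc hM h00 ⟨le_rfl, hcb⟩)
  have hq0 : 0 ≤ potentialBound P A c χ.K := (abs_nonneg _).trans
    (h.abs_potential_le χ hc h00 ⟨le_rfl, hcb⟩)
  have hlog0 : 0 ≤ Real.log (2 * A + M) := Real.log_nonneg (by linarith [h.one_le])
  have hS0 : 0 ≤ barrierStart P A c M χ.K := by unfold barrierStart; positivity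
  have hpr := productionBound_pos P h.one_le
  have hle : Real.log (2 * A + M) ≤ logDensityBound P A c M χ.K T := by
    unfold logDensityBound
    exact le_add_of_nonneg_left (by positivity)
  rcases le_total r c with hrc | hrc
  · exact (h.core_abs_log_le hM hcb ht ⟨hr.1, hrc⟩).trans hle
  have hinit : ∀ s : ℝ, ∀ r : ℝ, 0 < F.ρ s r → F.ρ s r ≤ 2 * A → (2 * A)⁻¹ ≤ F.ρ s r →
      |Real.log (F.ρ s r)| ≤ Real.log (2 * A + M) := by
    intro s r h1 h2 h3
    rw [abs_le, neg_le, ← Real.log_inv]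
    refine ⟨Real.log_le_log (inv_pos.2 h1) ?_, Real.log_le_log h1 (by linarith)⟩
    have := inv_anti₀ (by positivity) h3
    rw [inv_inv] at this
    linarith
  have hA2 : (2 * A)⁻¹ < A⁻¹ := inv_strictAnti₀ hA (by linarith)
  rcases ht.1.eq_or_lt with h0 | h0
  · subst h0
    have hd := h.density r hr
    exact (hinit 0 r (h.ρ_pos 0 ht r hr) (by linarith [hd.2]) (hA2.le.trans hd.1)).trans hle
  obtain ⟨δ₁, hδ₁, hp₁⟩ := eventually_pos_of_continuousOn isCompact_Icc
    (f := fun s r => 2 * A - F.ρ s r) (continuousOn_const.sub F.ρ_cont)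
    (fun r hr => by linarith [(h.density r hr).2]) ⟨h0, ht.2⟩
  obtain ⟨δ₂, hδ₂, hp₂⟩ := eventually_pos_of_continuousOn isCompact_Icc
    (f := fun s r => F.ρ s r - (2 * A)⁻¹) (F.ρ_cont.sub continuousOn_const)
    (fun r hr => by linarith [(h.density r hr).1]) ⟨h0, ht.2⟩
  -- Up to this positive time the density stays within `[1/(2A), 2A]`, which explains the `2A` in
  -- `barrierStart`. The final bound does not depend on `t₀`.
  set t₀ := min δ₁ δ₂ with ht₀
  have ht₀0 : 0 < t₀ := lt_min hδ₁.1 hδ₂.1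
  have ht₀t : t₀ ≤ t := (min_le_left _ _).trans hδ₁.2
  have hstart : ∀ r ∈ Icc 0 P.b, |Real.log (F.ρ t₀ r)| ≤ Real.log (2 * A + M) := by
    intro r hr
    have h1 := hp₁ t₀ ⟨ht₀0.le, min_le_left _ _⟩ r hr
    have h2 := hp₂ t₀ ⟨ht₀0.le, min_le_right _ _⟩ r hr
    exact hinit t₀ r (h.ρ_pos t₀ ⟨ht₀0.le, ht₀t.trans_lt ht.2⟩ r hr) (by linarith) (by linarith)
  have hup := h.effectiveLog_lt_barrier χ hc hcb hM ht₀0 ht₀t ht.2 hstart t ⟨ht₀t, le_rfl⟩ r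
    ⟨hrc, hr.2⟩
  have hlow := h.effectiveLog_gt_barrier χ hc hcb hM ht₀0 ht₀t ht.2 hstart t ⟨ht₀t, le_rfl⟩ r
    ⟨hrc, hr.2⟩
  have hpot := abs_le.1 (h.abs_potential_le χ hc ht ⟨hrc, hr.2⟩)
  have hint : ∫ s in t₀..t, (pressureBound P A c M χ.K * (1 + F.entropyProduction s)
        + remainderBound P A c M χ.K + 1)
      ≤ (pressureBound P A c M χ.K + remainderBound P A c M χ.K + 1) * T
        + pressureBound P A c M χ.K * productionBound P A := by
    have hG : IntervalIntegrable F.entropyProduction volume t₀ t :=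
      ContinuousOn.intervalIntegrable_of_Icc ht₀t
        ((F.continuousOn_entropyProduction h.θ_pos).mono fun s hs =>
          ⟨ht₀0.trans_le hs.1, hs.2.trans_lt ht.2⟩)
    have e : ∫ s in t₀..t, (pressureBound P A c M χ.K * (1 + F.entropyProduction s)
        + remainderBound P A c M χ.K + 1)
        = (pressureBound P A c M χ.K + remainderBound P A c M χ.K + 1) * (t - t₀)
        + pressureBound P A c M χ.K * ∫ s in t₀..t, F.entropyProduction s := by
      rw [← intervalIntegral.integral_const_mul, mul_comm _ (t - t₀), ← smul_eq_mul (t - t₀),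
        ← intervalIntegral.integral_const,
        ← intervalIntegral.integral_add intervalIntegrable_const (hG.const_mul _)]
      exact intervalIntegral.integral_congr fun s _ => by ring
    rw [e]
    have := h.integral_entropyProduction_le ht₀0 ht₀t ht.2
    have hT' : t - t₀ ≤ T := by linarith [ht.2]
    gcongr
  have hT' : (remainderBound P A c M χ.K + 1) * (t - t₀)
      ≤ (pressureBound P A c M χ.K + remainderBound P A c M χ.K + 1) * T := by
    gcongr
    · linarith
    · linarith [ht.2]
  have hpp : 0 ≤ pressureBound P A c M χ.K * productionBound P A := by positivity
  unfold effectiveLog at hup hlow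
  unfold logDensityBound
  refine le_trans ?_ (le_add_of_nonneg_right hlog0)
  rw [le_div_iff₀ hν, ← abs_of_pos hν, ← abs_mul, abs_le]
  constructor <;> linarith

end RadialFlow

end NSF

/-! ### Lagrangian coordinates and integration in time. -/

namespace NSF

open Filter Topology

theorem norm_radialVector (v : ℝ → ℝ) (x : E3) : ‖radialVector v x‖ = |radialComp v ‖x‖| := by
  rcases eq_or_ne x 0 with rfl | hx
  · simp [radialVector, radialComp_zero]
  · have h := norm_pos_iff.2 hx
    rw [radialComp_of_pos h, radialVector, norm_smul, norm_div, norm_norm, Real.norm_eq_abs,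
      div_mul_cancel₀ _ h.ne']

/-- The entropy production is only known on compact subintervals of `(0, T)`, and nothing is assumed
about it as time tends to zero. Exhausting `(0, t]` by the intervals `(1/(n+1), t]` passes the
uniform bound to the limit. -/
theorem setLIntegral_Ioc_le {T C : ℝ} {f : ℝ → ℝ} (hf : ContinuousOn f (Ioo 0 T))
    (h0 : ∀ t ∈ Ioo 0 T, 0 ≤ f t)
    (hC : ∀ t₀ t₁, 0 < t₀ → t₀ ≤ t₁ → t₁ < T → ∫ t in t₀..t₁, f t ≤ C) {t : ℝ}
    (ht : t ∈ Ico 0 T) : ∫⁻ τ in Ioc 0 t, ENNReal.ofReal (f τ) ≤ ENNReal.ofReal C := by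
  have hU : Ioc 0 t = ⋃ n : ℕ, Ioc (1 / ((n : ℝ) + 1)) t := by
    ext x
    simp only [mem_iUnion, mem_Ioc]
    constructor
    · rintro ⟨h1, h2⟩
      obtain ⟨n, hn⟩ := exists_nat_one_div_lt h1
      exact ⟨n, hn, h2⟩
    · rintro ⟨n, h1, h2⟩
      exact ⟨lt_trans (by positivity) h1, h2⟩
  have hdir : Directed (· ⊆ ·) fun n : ℕ => Ioc (1 / ((n : ℝ) + 1)) t :=
    Monotone.directed_le fun m n hmn => Ioc_subset_Ioc_left (Nat.one_div_le_one_div hmn)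
  rw [hU, setLIntegral_iUnion_of_directed _ hdir]
  refine iSup_le fun n => ?_
  have hn : 0 < 1 / ((n : ℝ) + 1) := by positivity
  rcases le_or_gt (1 / ((n : ℝ) + 1)) t with hle | hlt
  · have hsub : Icc (1 / ((n : ℝ) + 1)) t ⊆ Ioo 0 T := fun s hs =>
      ⟨hn.trans_le hs.1, hs.2.trans_lt ht.2⟩
    have hint : IntegrableOn f (Ioc (1 / ((n : ℝ) + 1)) t) :=
      ((hf.mono hsub).integrableOn_Icc).mono_set Ioc_subset_Icc_self
    rw [← ofReal_integral_eq_lintegral_ofReal hint, ← intervalIntegral.integral_of_le hle]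
    · exact ENNReal.ofReal_le_ofReal (hC _ _ hn hle ht.2)
    · filter_upwards [ae_restrict_mem measurableSet_Ioc] with x hx
      exact h0 x (hsub (Ioc_subset_Icc_self hx))
  · rw [Ioc_eq_empty (by linarith)]
    simp

namespace RadialFlow

variable {P : Params} {T A c M : ℝ} {F : RadialFlow P T} {t r h : ℝ}

theorem massCoord_hasDerivAt (ht : t ∈ Ico 0 T) (hr : r ∈ Ioo 0 P.b) :
    HasDerivAt (massCoord F.ρ t) (F.ρ t r * r ^ 2) r := by
  have c1 := slice_continuousOn F.ρ_cont ht
  have hcont : ContinuousOn (fun s => F.ρ t s * s ^ 2) (Icc 0 P.b) := by fun_prop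
  have hnhds : Icc 0 P.b ∈ 𝓝 r := Icc_mem_nhds hr.1 hr.2
  refine intervalIntegral.integral_hasDerivAt_right
    (ContinuousOn.intervalIntegrable_of_Icc hr.1.le (hcont.mono (Icc_subset_Icc_right hr.2.le)))
    ?_ (hcont.continuousAt hnhds)
  exact hcont.stronglyMeasurableAtFilter_nhdsWithin measurableSet_Icc r |>.filter_mono
    (by rw [nhdsWithin_eq_nhds.2 hnhds])

theorem continuousOn_massCoord (ht : t ∈ Ico 0 T) :
    ContinuousOn (massCoord F.ρ t) (Icc 0 P.b) := by
  have c1 := F.ρ_cont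
  exact slice_continuousOn (continuousOn_parametric_primitive
    (f := fun t s => F.ρ t s * s ^ 2) P.b_pos.le (by fun_prop)) ht

theorem massCoord_zero : massCoord F.ρ t 0 = 0 := intervalIntegral.integral_same

theorem DataBound.massCoord_radius (hd : F.DataBound A) (ht : t ∈ Ico 0 T) :
    massCoord F.ρ t P.b = 1 := hd.mass ht

theorem DataBound.strictMonoOn_massCoord (hd : F.DataBound A) (ht : t ∈ Ico 0 T) :
    StrictMonoOn (massCoord F.ρ t) (Icc 0 P.b) := by
  refine strictMonoOn_of_deriv_pos (convex_Icc _ _) (continuousOn_massCoord ht) fun r hr => ?_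
  rw [interior_Icc] at hr
  rw [(massCoord_hasDerivAt ht hr).deriv]
  have := hd.ρ_pos t ht r (Ioo_subset_Icc_self hr)
  have := hr.1
  positivity

theorem DataBound.image_massCoord (hd : F.DataBound A) (ht : t ∈ Ico 0 T) :
    massCoord F.ρ t '' Icc 0 P.b = Icc 0 1 := by
  have hmono := (hd.strictMonoOn_massCoord ht).monotoneOn
  have h0 : (0 : ℝ) ∈ Icc 0 P.b := ⟨le_rfl, P.b_pos.le⟩
  have hb : P.b ∈ Icc 0 P.b := ⟨P.b_pos.le, le_rfl⟩
  have e0 : massCoord F.ρ t 0 = 0 := massCoord_zero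
  have e1 := hd.massCoord_radius ht
  refine Subset.antisymm ?_ ?_
  · rintro _ ⟨r, hr, rfl⟩
    exact ⟨e0 ▸ hmono h0 hr hr.1, e1 ▸ hmono hr hb hr.2⟩
  · have := intermediate_value_Icc P.b_pos.le (continuousOn_massCoord (F := F) ht)
    rwa [e0, e1] at this

theorem DataBound.lagRadius_mem (hd : F.DataBound A) (ht : t ∈ Ico 0 T) (hh : h ∈ Icc 0 1) :
    lagRadius P F.ρ t h ∈ Icc 0 P.b ∧ massCoord F.ρ t (lagRadius P F.ρ t h) = h := by
  have hmem : h ∈ massCoord F.ρ t '' Icc 0 P.b := by rwa [hd.image_massCoord ht]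
  exact ⟨Function.invFunOn_mem hmem, Function.invFunOn_eq hmem⟩

theorem DataBound.lagRadius_massCoord (hd : F.DataBound A) (ht : t ∈ Ico 0 T)
    (hr : r ∈ Icc 0 P.b) : lagRadius P F.ρ t (massCoord F.ρ t r) = r := by
  have hm : massCoord F.ρ t r ∈ Icc 0 1 := hd.image_massCoord ht ▸ mem_image_of_mem _ hr
  have h1 := hd.lagRadius_mem ht hm
  exact (hd.strictMonoOn_massCoord ht).injOn h1.1 hr h1.2

theorem DataBound.lagRadius_pos (hd : F.DataBound A) (ht : t ∈ Ico 0 T) (hh : h ∈ Ioc 0 1) :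
    0 < lagRadius P F.ρ t h := by
  have h1 := hd.lagRadius_mem ht (Ioc_subset_Icc_self hh)
  refine lt_of_le_of_ne h1.1.1 fun heq => ?_
  rw [← heq, massCoord_zero] at h1
  exact hh.1.ne h1.2

/-- The inverse of a continuous injection of a compact interval: preimages of closed sets are images
of compact sets. -/
theorem DataBound.continuousOn_lagRadius (hd : F.DataBound A) (ht : t ∈ Ico 0 T) :
    ContinuousOn (lagRadius P F.ρ t) (Icc 0 1) := by
  rw [continuousOn_iff_isClosed]
  intro Z hZ
  refine ⟨massCoord F.ρ t '' (Icc 0 P.b ∩ Z), ?_, ?_⟩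
  · exact ((isCompact_Icc.inter_right hZ).image_of_continuousOn
      ((continuousOn_massCoord ht).mono inter_subset_left)).isClosed
  · ext x
    constructor
    · rintro ⟨hxZ, hx⟩
      have h1 := hd.lagRadius_mem ht hx
      exact ⟨⟨_, ⟨h1.1, hxZ⟩, h1.2⟩, hx⟩
    · rintro ⟨⟨r, ⟨hr, hrZ⟩, rfl⟩, hx⟩
      refine ⟨?_, hx⟩
      rw [mem_preimage, hd.lagRadius_massCoord ht hr]
      exact hrZ

/-- The total temperature in Lagrangian and in Eulerian coordinates. -/
theorem DataBound.integral_lag_temperature (hd : F.DataBound A) (ht : t ∈ Ico 0 T) :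
    IntervalIntegrable (lag P F.ρ F.θ t) volume 0 1 ∧
    ∫ h in (0 : ℝ)..1, lag P F.ρ F.θ t h = ∫ r in (0 : ℝ)..P.b, F.ρ t r * F.θ t r * r ^ 2 := by
  have hcont : ContinuousOn (lag P F.ρ F.θ t) (Icc 0 1) :=
    (slice_continuousOn F.θ_cont ht).comp (hd.continuousOn_lagRadius ht)
      fun h hh => (hd.lagRadius_mem ht hh).1
  refine ⟨ContinuousOn.intervalIntegrable_of_Icc zero_le_one hcont, ?_⟩
  have c1 := slice_continuousOn F.ρ_cont ht
  have hI : uIcc 0 P.b = Icc 0 P.b := uIcc_of_le P.b_pos.le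
  -- Change of variables `dh = ρ r² dr`.
  have h1 := intervalIntegral.integral_comp_mul_deriv'' (a := 0) (b := P.b)
    (f := massCoord F.ρ t) (f' := fun r => F.ρ t r * r ^ 2) (g := lag P F.ρ F.θ t)
    (hI ▸ continuousOn_massCoord ht) (fun r hr => by
      rw [min_eq_left P.b_pos.le, max_eq_right P.b_pos.le] at hr
      exact (massCoord_hasDerivAt ht hr).hasDerivWithinAt)
    (by rw [hI]; fun_prop) (by rw [hI, hd.image_massCoord ht]; exact hcont)
  rw [massCoord_zero, hd.massCoord_radius ht] at h1
  rw [← h1]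
  refine intervalIntegral.integral_congr fun r hr => ?_
  rw [hI] at hr
  simp only [Function.comp, lag, hd.lagRadius_massCoord ht hr]
  ring

/-- The factor of the entropy production in the bound of the velocity. -/
noncomputable def velocityFactor (P : Params) (A c Λ : ℝ) : ℝ :=
  3 * P.b ^ 2 * energyBound P A / (4 * P.mu * c ^ 6 * P.cV) * Real.exp Λ

/-- Joins the core bound `|u| ≤ M` with `velocity_sq_le` outside, where `1/ρ ≤ exp Λ`; the result
holds at all radii. -/
theorem DataBound.velocity_sq_le' (hd : F.DataBound A) (hc : 0 < c)
    (hM : F.CoreBound c M) {Λ : ℝ}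
    (hΛ : ∀ t ∈ Ico 0 T, ∀ r ∈ Icc 0 P.b, |Real.log (F.ρ t r)| ≤ Λ) (ht : t ∈ Ioo 0 T)
    (hr : r ∈ Icc 0 P.b) :
    F.u t r ^ 2 ≤ M ^ 2 + velocityFactor P A c Λ * F.entropyProduction t := by
  have ht' := Ioo_subset_Ico_self ht
  have hE := energyBound_pos P hd.one_le
  have hcV := P.cV_pos
  have hmu := P.mu_pos
  have hG := hd.entropyProduction_nonneg ht
  rcases le_total r c with hrc | hrc
  · have h1 := abs_le.1 (hM t ht' r ⟨hr.1, hrc⟩).2.2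
    have h2 : F.u t r ^ 2 ≤ M ^ 2 := sq_le_sq' h1.1 h1.2
    refine h2.trans (le_add_of_nonneg_right ?_)
    unfold velocityFactor
    positivity
  · have h1 := hd.velocity_sq_le hc ht (W := Real.exp Λ) (fun s hs => ?_) ⟨hrc, hr.2⟩
    · refine (h1.trans_eq ?_).trans (le_add_of_nonneg_left (sq_nonneg M))
      unfold velocityFactor
      ring
    · have hs' : s ∈ Icc 0 P.b := ⟨hc.le.trans hs.1, hs.2⟩
      rw [← Real.log_le_iff_le_exp (inv_pos.2 (hd.ρ_pos t ht' s hs')), Real.log_inv]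
      linarith [(abs_le.1 (hΛ t ht' s hs')).1]

/-- A bound for the time integral of the squared velocity. -/
noncomputable def velocityBound (P : Params) (A c M Λ T : ℝ) : ℝ :=
  M ^ 2 * T + velocityFactor P A c Λ * productionBound P A

theorem velocityFactor_nonneg (P : Params) (hA : 1 ≤ A) (hc : 0 < c) (Λ : ℝ) :
    0 ≤ velocityFactor P A c Λ := by
  have hE := energyBound_pos P hA
  have hcV := P.cV_pos
  have hmu := P.mu_pos
  unfold velocityFactor
  positivity

theorem velocityBound_nonneg (P : Params) (hA : 1 ≤ A) (hc : 0 < c) (M Λ : ℝ) (hT : 0 ≤ T) :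
    0 ≤ velocityBound P A c M Λ T := by
  have := productionBound_pos P hA
  have := velocityFactor_nonneg P hA hc Λ
  unfold velocityBound
  positivity

theorem DataBound.lintegral_velocity_le (hd : F.DataBound A) (hc : 0 < c) {Λ : ℝ}
    (ht : t ∈ Ico 0 T) :
    ∫⁻ τ in Ioc 0 t, ENNReal.ofReal (M ^ 2 + velocityFactor P A c Λ * F.entropyProduction τ)
      ≤ ENNReal.ofReal (velocityBound P A c M Λ T) := by
  have hf0 := velocityFactor_nonneg P hd.one_le hc Λ
  have cG := F.continuousOn_entropyProduction hd.θ_pos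
  refine setLIntegral_Ioc_le (T := T) (by fun_prop) (fun s hs => ?_) (fun t₀ t₁ h0 h01 h1 => ?_) ht
  · have := hd.entropyProduction_nonneg hs
    positivity
  · have hG : IntervalIntegrable F.entropyProduction volume t₀ t₁ :=
      ContinuousOn.intervalIntegrable_of_Icc h01
        (cG.mono fun s hs => ⟨h0.trans_le hs.1, hs.2.trans_lt h1⟩)
    rw [intervalIntegral.integral_add intervalIntegrable_const (hG.const_mul _),
      intervalIntegral.integral_const_mul, intervalIntegral.integral_const, smul_eq_mul,
      mul_comm (t₁ - t₀)]
    have h2 := hd.integral_entropyProduction_le h0 h01 h1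
    have h3 : t₁ - t₀ ≤ T := by linarith
    unfold velocityBound
    gcongr

theorem DataBound.outerBounds (hd : F.DataBound A) (hT : 0 ≤ T) (hc : 0 < c)
    (hM : F.CoreBound c M) {Λ h₀ : ℝ}
    (hΛ : ∀ t ∈ Ico 0 T, ∀ r ∈ Icc 0 P.b, |Real.log (F.ρ t r)| ≤ Λ) (hh₀ : 0 < h₀)
    {u : ℝ → ℝ → ℝ} (hu : F.u = fun t => radialComp (u t)) :
    OuterBounds P T h₀ (Real.exp Λ + velocityBound P A c M Λ T
      + velocityBound P A c M Λ T ^ (1 / 2 : ℝ)) F.ρ u := by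
  have hf0 := velocityFactor_nonneg P hd.one_le hc Λ
  have hV0 := velocityBound_nonneg P hd.one_le hc M Λ hT
  set V := velocityBound P A c M Λ T with hV
  have hV2 : 0 ≤ V ^ (1 / 2 : ℝ) := by positivity
  have hexp := Real.exp_pos Λ
  have hdens : ∀ t ∈ Ico 0 T, ∀ h ∈ Icc h₀ 1,
      Real.exp (-Λ) ≤ lag P F.ρ F.ρ t h ∧ lag P F.ρ F.ρ t h ≤ Real.exp Λ := by
    intro t ht h hh
    have hmem := (hd.lagRadius_mem ht ⟨hh₀.le.trans hh.1, hh.2⟩).1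
    have hρ := hd.ρ_pos t ht _ hmem
    have hl := abs_le.1 (hΛ t ht _ hmem)
    exact ⟨(Real.le_log_iff_exp_le hρ).1 hl.1, (Real.log_le_iff_le_exp hρ).1 hl.2⟩
  refine ⟨fun t ht h hh => ?_, fun t ht => ?_, fun t ht h hh => ?_⟩
  · obtain ⟨h1, h2⟩ := hdens t ht h hh
    refine ⟨le_trans ?_ h1, by linarith⟩
    rw [Real.exp_neg]
    exact inv_anti₀ hexp (by linarith)
  · refine le_trans ?_ ((hd.lintegral_velocity_le hc (M := M) (Λ := Λ) ht).trans
      (ENNReal.ofReal_le_ofReal (by linarith)))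
    refine setLIntegral_mono' measurableSet_Ioc fun τ hτ => iSup₂_le fun h hh => ?_
    have hτ' : τ ∈ Ioo 0 T := ⟨hτ.1, hτ.2.trans_lt ht.2⟩
    have hτ'' := Ioo_subset_Ico_self hτ'
    have hh' : h ∈ Ioc 0 1 := ⟨hh₀.trans_le hh.1, hh.2⟩
    have hmem := (hd.lagRadius_mem hτ'' (Ioc_subset_Icc_self hh')).1
    -- Here `h₀ > 0` matters: the radius is positive, so the raw profile `u` agrees with
    -- `radialComp`.
    have hpos := hd.lagRadius_pos hτ'' hh'
    have h1 := hd.velocity_sq_le' hc hM hΛ hτ' hmem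
    rw [hu] at h1
    simp only [radialComp_of_pos hpos] at h1
    exact ENNReal.ofReal_le_ofReal h1
  · have hmain : ∫⁻ τ in Ioc 0 t,
        eLpNorm (radialVector (u τ)) ∞ (volume.restrict (outerRegion P F.ρ τ h)) ^ 2
        ≤ ENNReal.ofReal V := by
      refine le_trans ?_ (hd.lintegral_velocity_le hc (M := M) (Λ := Λ) ht)
      refine setLIntegral_mono' measurableSet_Ioc fun τ hτ => ?_
      have hτ' : τ ∈ Ioo 0 T := ⟨hτ.1, hτ.2.trans_lt ht.2⟩
      have hG := hd.entropyProduction_nonneg hτ'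
      have hb : ∀ x ∈ outerRegion P F.ρ τ h, ‖radialVector (u τ) x‖
          ≤ √(M ^ 2 + velocityFactor P A c Λ * F.entropyProduction τ) := by
        intro x hx
        have hx1 : ‖x‖ ≤ P.b := by simpa [Params.dom] using hx.1
        have h1 := hd.velocity_sq_le' hc hM hΛ hτ' ⟨norm_nonneg x, hx1⟩
        rw [hu] at h1
        rw [norm_radialVector]
        exact Real.abs_le_sqrt h1
      have hmeas : MeasurableSet (outerRegion P F.ρ τ h) :=
        Metric.isClosed_closedBall.measurableSet.inter
          (measurableSet_lt measurable_const measurable_norm)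
      have h2 : eLpNorm (radialVector (u τ)) ∞ (volume.restrict (outerRegion P F.ρ τ h))
          ≤ ENNReal.ofReal √(M ^ 2 + velocityFactor P A c Λ * F.entropyProduction τ) := by
        rw [eLpNorm_exponent_top]
        exact eLpNormEssSup_le_of_ae_bound (by
          filter_upwards [ae_restrict_mem hmeas] with x hx using hb x hx)
      calc _ ≤ ENNReal.ofReal
            √(M ^ 2 + velocityFactor P A c Λ * F.entropyProduction τ) ^ 2 := by gcongr
        _ = _ := by
          rw [← ENNReal.ofReal_pow (Real.sqrt_nonneg _), Real.sq_sqrt (by positivity)]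
    calc _ ≤ ENNReal.ofReal (Real.exp Λ) + ENNReal.ofReal V ^ (1 / 2 : ℝ) := by
          gcongr
          exact (hdens t ht h hh).2
      _ = ENNReal.ofReal (Real.exp Λ + V ^ (1 / 2 : ℝ)) := by
          rw [ENNReal.ofReal_rpow_of_nonneg hV0 (by norm_num), ENNReal.ofReal_add hexp.le hV2]
      _ ≤ _ := ENNReal.ofReal_le_ofReal (by linarith)

end RadialFlow

end NSF

/-! ### From the one-dimensional estimates back to spherical solutions. -/

namespace NSF

open Filter Topology

/-- The initial profiles are bounded by `A`, with density and temperature bounded away from zero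
by `A⁻¹`. -/
structure ProfileBound (P : Params) (ρ₀ u₀ θ₀ : ℝ → ℝ) (A : ℝ) : Prop where
  one_le : 1 ≤ A
  density : ∀ r ∈ Icc 0 P.b, A⁻¹ ≤ ρ₀ r ∧ ρ₀ r ≤ A
  temperature : ∀ r ∈ Icc 0 P.b, A⁻¹ ≤ θ₀ r ∧ θ₀ r ≤ A
  velocity : ∀ r ∈ Icc 0 P.b, |radialComp u₀ r| ≤ A

namespace IsSphericalSolution

open RadialFlow

variable {P : Params} {T A c M r₁ : ℝ} {ρ₀ u₀ θ₀ : ℝ → ℝ} {ρ u θ : ℝ → ℝ → ℝ} {t r : ℝ}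

theorem density_zero (h : IsSphericalSolution P T ρ₀ u₀ θ₀ ρ u θ) (hr : r ∈ Icc 0 P.b) :
    ρ 0 r = ρ₀ r := by
  have := h.init_density _ (P.smul_axis_mem_dom hr)
  rwa [radialScalar_axis _ hr.1, radialScalar_axis _ hr.1] at this

theorem temperature_zero (h : IsSphericalSolution P T ρ₀ u₀ θ₀ ρ u θ) (hr : r ∈ Icc 0 P.b) :
    θ 0 r = θ₀ r := by
  have := h.init_temperature _ (P.smul_axis_mem_dom hr)
  rwa [radialScalar_axis _ hr.1, radialScalar_axis _ hr.1] at this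

theorem velocity_zero (h : IsSphericalSolution P T ρ₀ u₀ θ₀ ρ u θ) (hr : r ∈ Icc 0 P.b) :
    radialComp (u 0) r = radialComp u₀ r := by
  rw [radialComp, radialComp, h.init_velocity _ (P.smul_axis_mem_dom hr)]

theorem exists_bounds {p q : ℝ} (hpq : p ≤ q) {f : ℝ → ℝ} (hf : ContinuousOn f (Icc p q))
    (h : ∀ x ∈ Icc p q, 0 < f x) : ∃ B, ∀ A, B ≤ A → ∀ x ∈ Icc p q, A⁻¹ ≤ f x ∧ f x ≤ A := by
  obtain ⟨m, hm, hmlt⟩ := RadialFlow.exists_pos_le_of_continuousOn hpq hf h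
  obtain ⟨C, hC⟩ := isCompact_Icc.exists_bound_of_continuousOn hf
  refine ⟨max m⁻¹ C, fun A hA x hx => ⟨?_, ?_⟩⟩
  · have h1 : m⁻¹ ≤ A := (le_max_left _ _).trans hA
    have h2 := inv_anti₀ (inv_pos.2 hm) h1
    rw [inv_inv] at h2
    exact h2.trans (hmlt x hx).le
  · exact (le_abs_self _).trans ((hC x hx).trans ((le_max_right _ _).trans hA))

/-- The initial profiles of a classical solution are bounded. -/
theorem exists_profileBound (hdata : IsInitialData P ρ₀ θ₀) (hT : 0 < T)
    (h : IsSphericalSolution P T ρ₀ u₀ θ₀ ρ u θ) : ∃ A, ProfileBound P ρ₀ u₀ θ₀ A := by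
  obtain ⟨F, rfl, hu, rfl⟩ := exists_radialFlow h.solution
  have h0 : (0 : ℝ) ∈ Ico 0 T := ⟨le_rfl, hT⟩
  obtain ⟨m, hm, hmle⟩ := hdata.density_pos
  obtain ⟨B₁, hB₁⟩ := exists_bounds P.b_pos.le (slice_continuousOn F.ρ_cont h0) fun r hr => by
    rw [h.density_zero hr]; exact hm.trans_le (hmle r hr)
  obtain ⟨B₂, hB₂⟩ := exists_bounds P.b_pos.le (slice_continuousOn F.θ_cont h0) fun r hr => by
    rw [h.temperature_zero hr]; exact hdata.temperature_pos r hr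
  obtain ⟨B₃, hB₃⟩ := isCompact_Icc.exists_bound_of_continuousOn (slice_continuousOn F.u_cont h0)
  refine ⟨max 1 (max B₁ (max B₂ B₃)), le_max_left _ _, fun r hr => ?_, fun r hr => ?_,
    fun r hr => ?_⟩
  · rw [← h.density_zero hr]
    exact hB₁ _ (by simp) r hr
  · rw [← h.temperature_zero hr]
    exact hB₂ _ (by simp) r hr
  · have := hB₃ r hr
    simp only [Real.norm_eq_abs, hu, h.velocity_zero hr] at this
    exact this.trans (by simp)

/-- The constant `A` bounds the initial profiles alone, so one `A` serves all solutions with these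
data and all later constants are uniform. -/
theorem exists_dataBound (hdata : IsInitialData P ρ₀ θ₀)
    (h : IsSphericalSolution P T ρ₀ u₀ θ₀ ρ u θ) (hA : ProfileBound P ρ₀ u₀ θ₀ A) :
    ∃ F : RadialFlow P T, F.ρ = ρ ∧ F.u = (fun t => radialComp (u t)) ∧ F.θ = θ ∧
      F.DataBound A := by
  obtain ⟨F, hρ, hu, hθ⟩ := exists_radialFlow h.solution
  refine ⟨F, hρ, hu, hθ, hA.one_le, fun r hr => ?_, fun r hr => ?_, fun r hr => ?_, ?_⟩
  · rw [hρ, h.density_zero hr]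
    exact hA.density r hr
  · rw [hθ, h.temperature_zero hr]
    exact hA.temperature r hr
  · simp only [hu, h.velocity_zero hr]
    exact hA.velocity r hr
  · rw [← hdata.mass_one]
    refine intervalIntegral.integral_congr fun r hr => ?_
    rw [uIcc_of_le P.b_pos.le] at hr
    simp only [hρ, h.density_zero hr]

theorem exists_total_temperature_bounds (hdata : IsInitialData P ρ₀ θ₀)
    (hA : ProfileBound P ρ₀ u₀ θ₀ A) :
    ∃ C > 0, ∀ (T : ℝ) (ρ u θ : ℝ → ℝ → ℝ), IsSphericalSolution P T ρ₀ u₀ θ₀ ρ u θ →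
      ∀ t ∈ Ico 0 T, IntervalIntegrable (lag P ρ θ t) volume 0 1 ∧
        C⁻¹ ≤ ∫ h in (0 : ℝ)..1, lag P ρ θ t h ∧ ∫ h in (0 : ℝ)..1, lag P ρ θ t h ≤ C := by
  have hcV := P.cV_pos
  have hE := energyBound_pos P hA.one_le
  set k := (initialEntropyBound P A + P.R * P.b ^ 3) / P.cV with hk
  have hexp := Real.exp_pos k
  refine ⟨energyBound P A / P.cV + Real.exp k, by positivity, fun T ρ u θ h t ht => ?_⟩
  obtain ⟨F, rfl, hu, rfl, hd⟩ := h.exists_dataBound hdata hA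
  obtain ⟨h1, h2⟩ := hd.integral_lag_temperature ht
  refine ⟨h1, ?_, ?_⟩
  · rw [h2]
    refine le_trans ?_ (hd.total_temperature_lower ht)
    rw [Real.exp_neg]
    exact inv_anti₀ hexp (le_add_of_nonneg_left (by positivity))
  · rw [h2]
    refine le_trans ?_ (le_add_of_nonneg_right hexp.le)
    rw [le_div_iff₀ hcV, mul_comm]
    exact (hd.energy_parts ht).2

theorem coreBound {F : RadialFlow P T} (hd : F.DataBound A)
    (hu : F.u = fun t => radialComp (u t)) (hM : ∀ t ∈ Ico 0 T, CenterBound P r₁ M F.ρ u t) :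
    F.CoreBound (min r₁ P.b) M := by
  intro t ht r hr
  have hrb : r ∈ Icc 0 P.b := ⟨hr.1, hr.2.trans (min_le_right _ _)⟩
  have hn : ‖r • axis‖ = r := by rw [norm_smul_axis, abs_of_nonneg hr.1]
  have h1 := hM t ht (r • axis) (P.smul_axis_mem_dom hrb)
    (hn.le.trans (hr.2.trans (min_le_left _ _)))
  rw [radialScalar_axis _ hr.1, norm_radialVector, hn] at h1
  have hρ := hd.ρ_pos t ht r hrb
  have hρ' := inv_pos.2 hρ
  have hu0 := abs_nonneg (radialComp (u t) r)
  rw [hu]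
  exact ⟨by linarith, by linarith, by linarith⟩

/-- The core radius is `min r₁ b`, and cutoff and constant are fixed before the solution is
introduced. The constant obtained does not involve `h₀`, because `log ρ` is bounded on the whole
ball. -/
theorem exists_outerBounds (hdata : IsInitialData P ρ₀ θ₀) (hA : ProfileBound P ρ₀ u₀ θ₀ A)
    (T : ℝ) (hr₁ : 0 < r₁) (M : ℝ) {h₀ : ℝ} (hh₀ : 0 < h₀) :
    ∃ C > 0, ∀ ρ u θ : ℝ → ℝ → ℝ, IsSphericalSolution P T ρ₀ u₀ θ₀ ρ u θ →
      (∀ t ∈ Ico 0 T, CenterBound P r₁ M ρ u t) → OuterBounds P T h₀ C ρ u := by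
  have hc : 0 < min r₁ P.b := lt_min hr₁ P.b_pos
  have hcb : min r₁ P.b ≤ P.b := min_le_right _ _
  obtain ⟨χ⟩ := exists_cutoff _ hc
  rcases le_or_gt T 0 with hT | hT
  · have hno : ∀ t ∈ Ico 0 T, False := fun t ht => by linarith [ht.1, ht.2]
    exact ⟨1, one_pos, fun ρ u θ _ _ => ⟨fun t ht => (hno t ht).elim,
      fun t ht => (hno t ht).elim, fun t ht => (hno t ht).elim⟩⟩
  set Λ := logDensityBound P A (min r₁ P.b) M χ.K T with hΛ
  have hV0 := velocityBound_nonneg P hA.one_le hc M Λ hT.le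
  refine ⟨Real.exp Λ + velocityBound P A (min r₁ P.b) M Λ T +
    velocityBound P A (min r₁ P.b) M Λ T ^ (1 / 2 : ℝ), ?_, fun ρ u θ h hM => ?_⟩
  · have := Real.exp_pos Λ
    positivity
  · obtain ⟨F, rfl, hu, rfl, hd⟩ := h.exists_dataBound hdata hA
    have hcore := coreBound hd hu hM
    exact hd.outerBounds hT.le hc hcore
      (fun t ht r hr => hd.abs_log_density_le χ hc hcb hcore ht hr) hh₀ hu

/-- On compact subintervals of the time interval of existence the density, the specific volume and
the velocity are bounded. -/
theorem exists_centerBound (hdata : IsInitialData P ρ₀ θ₀)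
    (h : IsSphericalSolution P T ρ₀ u₀ θ₀ ρ u θ) {T' : ℝ} (hT' : T' < T) (r₁ : ℝ) :
    ∃ M, ∀ t ∈ Icc 0 T', CenterBound P r₁ M ρ u t := by
  rcases lt_or_ge T' 0 with hneg | hnonneg
  · exact ⟨0, fun t ht => absurd (ht.1.trans ht.2) (not_le.2 hneg)⟩
  obtain ⟨A, hA⟩ := h.exists_profileBound hdata (hnonneg.trans_lt hT')
  obtain ⟨F, rfl, hu, rfl, hd⟩ := h.exists_dataBound hdata hA
  have hsub : Icc 0 T' ⊆ Ico 0 T := fun s hs => ⟨hs.1, hs.2.trans_lt hT'⟩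
  have hcomp : IsCompact (Icc 0 T' ×ˢ Icc 0 P.b) := isCompact_Icc.prod isCompact_Icc
  have cρ := F.ρ_cont.mono (prod_mono hsub (le_refl (Icc 0 P.b)))
  have cu := F.u_cont.mono (prod_mono hsub (le_refl (Icc 0 P.b)))
  have hne : ∀ x ∈ Icc 0 T' ×ˢ Icc 0 P.b, F.ρ x.1 x.2 ≠ 0 := fun x hx =>
    (hd.ρ_pos x.1 (hsub hx.1) x.2 hx.2).ne'
  obtain ⟨M, hM⟩ := hcomp.exists_bound_of_continuousOn
    (f := fun x : ℝ × ℝ => F.ρ x.1 x.2 + (F.ρ x.1 x.2)⁻¹ + |F.u x.1 x.2|)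
    (by fun_prop (disch := assumption))
  refine ⟨M, fun t ht x hx _ => ?_⟩
  have hxb : ‖x‖ ≤ P.b := by simpa [Params.dom] using hx
  have h1 := (le_abs_self _).trans (hM (t, ‖x‖) ⟨ht, norm_nonneg x, hxb⟩)
  rw [norm_radialVector]
  simp only [hu] at h1
  exact h1

end IsSphericalSolution

end NSF

theorem mainTheorem2 (P : NSF.Params) (ρ₀ u₀ θ₀ : ℝ → ℝ) (hdata : NSF.IsInitialData P ρ₀ θ₀) :
    -- total temperature: the constant depends on the parameters and the initial data only
    (∃ C > 0, ∀ (Tstar : ℝ) (ρ u θ : ℝ → ℝ → ℝ),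
      NSF.IsSphericalSolution P Tstar ρ₀ u₀ θ₀ ρ u θ →
      ∀ t ∈ Set.Ico 0 Tstar,
        IntervalIntegrable (NSF.lag P ρ θ t) MeasureTheory.volume 0 1 ∧
        C⁻¹ ≤ ∫ h in (0 : ℝ)..1, NSF.lag P ρ θ t h ∧
        ∫ h in (0 : ℝ)..1, NSF.lag P ρ θ t h ≤ C) ∧
    -- bounds near the center up to `Tstar` give bounds away from the center
    (∀ (Tstar : ℝ) (ρ u θ : ℝ → ℝ → ℝ), 0 < Tstar →
      NSF.IsSphericalSolution P Tstar ρ₀ u₀ θ₀ ρ u θ →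
      ∀ ε > 0, ∀ r₁ > 0, ∀ M : ℝ,
        (∀ t ∈ Set.Ico 0 Tstar, Tstar - ε < t → NSF.CenterBound P r₁ M ρ u t) →
      ∀ h₀ ∈ Set.Ioc (0 : ℝ) 1, ∃ C > 0, NSF.OuterBounds P Tstar h₀ C ρ u) ∧
    -- the constant depends on the solution only through the initial data, the time `Tstar` and
    -- the bound near the center on `[0, Tstar)`
    (∀ Tstar > 0, ∀ r₁ > 0, ∀ M : ℝ, ∀ h₀ ∈ Set.Ioc (0 : ℝ) 1, ∃ C > 0,
      ∀ ρ u θ : ℝ → ℝ → ℝ, NSF.IsSphericalSolution P Tstar ρ₀ u₀ θ₀ ρ u θ →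
        (∀ t ∈ Set.Ico 0 Tstar, NSF.CenterBound P r₁ M ρ u t) →
        NSF.OuterBounds P Tstar h₀ C ρ u) := by
  refine ⟨?_, ?_, ?_⟩
  -- Upper bounds of the data are not assumed; they come from the continuity of some solution at
  -- time zero. Without any solution the claim is vacuous.
  · by_cases hex : ∃ (T : ℝ) (ρ u θ : ℝ → ℝ → ℝ), 0 < T ∧
      NSF.IsSphericalSolution P T ρ₀ u₀ θ₀ ρ u θ
    · obtain ⟨T, ρ, u, θ, hT, h⟩ := hex
      obtain ⟨A, hA⟩ := h.exists_profileBound hdata hT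
      exact NSF.IsSphericalSolution.exists_total_temperature_bounds hdata hA
    · exact ⟨1, one_pos, fun T ρ u θ h t ht =>
        (hex ⟨T, ρ, u, θ, ht.1.trans_lt ht.2, h⟩).elim⟩
  · intro T ρ u θ hT h ε hε r₁ hr₁ M hM h₀ hh₀
    obtain ⟨A, hA⟩ := h.exists_profileBound hdata hT
    -- Compactness supplies the center bound on `[0, T - ε]`. The constant `M'` depends on the
    -- solution, so the constant of this part does too.
    obtain ⟨M', hM'⟩ := h.exists_centerBound hdata (by linarith : T - ε < T) r₁
    obtain ⟨C, hC, hout⟩ := NSF.IsSphericalSolution.exists_outerBounds hdata hA T hr₁ (max M M')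
      hh₀.1
    refine ⟨C, hC, hout ρ u θ h fun t ht x hx hxr => ?_⟩
    rcases lt_or_ge (T - ε) t with hlt | hge
    · exact (hM t ht hlt x hx hxr).trans (le_max_left _ _)
    · exact (hM' t ⟨ht.1, hge⟩ x hx hxr).trans (le_max_right _ _)
  · intro T hT r₁ hr₁ M h₀ hh₀
    by_cases hex : ∃ ρ u θ : ℝ → ℝ → ℝ, NSF.IsSphericalSolution P T ρ₀ u₀ θ₀ ρ u θ
    · obtain ⟨ρ, u, θ, h⟩ := hex
      obtain ⟨A, hA⟩ := h.exists_profileBound hdata hT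
      exact NSF.IsSphericalSolution.exists_outerBounds hdata hA T hr₁ M hh₀.1
    · exact ⟨1, one_pos, fun ρ u θ h _ => (hex ⟨ρ, u, θ, h⟩).elim⟩
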